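/- Let $E=(E^0,E^1,r,s)$ be a directed graph with countable vertex set $E^0$, countable edge set $E^1$, range map $r$ and source map $s$, and let $R$ be a commutative ring with unit. Let $L_R(E)$ be the Leavitt path algebra: the universal (not necessarily unital) $R$-algebra generated by elements $v$ ($v\in E^0$) and $e,e^*$ ($e\in E^1$) such that the $v$ are pairwise orthogonal idempotents, $s(e)e=er(e)=e$, $r(e)e^*=e^*s(e)=e^*$, $e^*f=\delta_{e,f}\,r(e)$, and $v=\sum_{s(e)=v}ee^*$ whenever $0<|s^{-1}(v)|<\infty$. It is $\mathbb Z$-graded by $L_R(E)_k=\operatorname{span}_R\{\alpha\beta^*: \alpha,\beta \text{ finite paths},\ r(\alpha)=r(\beta),\ |\alpha|-|\beta|=k\}$, and an ideal $I$ is graded if $I=\bigoplus_k (I\cap L_R(E)_k)$. A set $X\subseteq E^0$ is hereditary if $s(e)\in X$ implies $r(e)\in X$, and saturated if $v\in X$ whenever $0<|s^{-1}(v)|<\infty$ and $r(s^{-1}(v))\subseteq X$. For $H$ saturated and hereditary let $$B_H=\{v\in E^0\setminus H: |s^{-1}(v)|=\infty,\ 0<|s^{-1}(v)\cap r^{-1}(E^0\setminus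 H)|<\infty\},\qquad v^H=v-\sum_{s(e)=v,\ r(e)\notin H}ee^*\quad(v\in B_H).$$ An admissible pair is a pair $(H,S)$ with $H$ saturated and hereditary and $S\subseteq B_H$; $I(H,S)$ is the ideal of $L_R(E)$ generated by $H\cup\{v^H:v\in S\}$, and $I(X)$ is the ideal generated by $X$. Put $E_X=(X,s^{-1}(X),r,s)$ for $X$ hereditary. Let $E_{(H,S)}$ be the graph with vertex set $H\cup S$ and edge set $\{e:s(e)\in H\}\cup\{e:s(e)\in S,\ r(e)\in H\}$. Let $E/(H,S)$ be the graph with vertex set $(E^0\setminus H)\sqcup\{v':v\in B_H\setminus S\}$ and edge set $\{e:r(e)\notin H\}\sqcup\{e':r(e)\in B_H\setminus S\}$, where $s(e')=s(e)$ and $r(e')=r(e)'$. An ideal $I$ of $L_R(E)$ is basic if, for every $r\in R\setminus\{0\}$, $rx\in I$ implies $x\in I$ whenever $x\in E^0$ or $x=v-\sum_{i=1}^n e_ie_i^*$ with $v\in E^0$ and distinct edges $e_1,\dots,e_n$ with source $v$. Two rings (possibly without identity) are Morita equivalent if their categories of left modules $M$ satisfying $AM=M$ and ($Am=0\Rightarrow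 m=0$), where $A$ denotes the ring, are equivalent via an additive functor. Then: 1. If $X\subseteq E^0$ is hereditary, then the rings $I(X)$ and $L_R(E_X)$ are Morita equivalent. 2. If $(H,S)$ is an admissible pair in $E$, then the rings $I(H,S)$ and $L_R(E_{(H,S)})$ are Morita equivalent. 3. If $(H,S)$ is an admissible pair in $E$, then there is a canonical isomorphism of $R$-algebras $L_R(E)/I(H,S)\cong L_R(E/(H,S))$. It sends the class of $v\in E^0$ to $0$ if $v\in H$, to $v+v'$ if $v\in B_H\setminus S$, and to $v$ otherwise; and it sends the classes of $e$ and $e^*$ to $0$ if $r(e)\in H$, to $e+e'$ and $e^*+(e')^*$ if $r(e)\in B_H\setminus S$, and to $e$ and $e^*$ otherwise. 4. If $R\neq 0$, the map $(H,S)\mapsto I(H,S)$ is a bijection from the set of admissible pairs in $E$ onto the set of graded basic ideals of $L_R(E)$. -/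

import Mathlib

universe u v w

/-- A directed graph with vertex set `V`, edge set `E`, and source and range maps. -/
structure DirGraph (V : Type u) (E : Type v) where
  /-- the source of an edge -/
  src : E → V
  /-- the range of an edge -/
  rng : E → V

namespace DirGraph

variable {V : Type u} {E : Type v}

/-- The set `s⁻¹(v)` of edges emitted by `v`. -/
def emit (G : DirGraph V E) (v : V) : Set E := {e | G.src e = v}

/-- A set of vertices is hereditary if it contains the range of each edge whose source it
contains. -/
def IsHereditary (G : DirGraph V E) (X : Set V) : Prop :=
  ∀ e : E, G.src e ∈ X → G.rng e ∈ X

/-- A set of vertices is saturated if it contains each finite emitter (a vertex emitting at least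
one and only finitely many edges) all of whose edges have their range in the set. -/
def IsSaturated (G : DirGraph V E) (X : Set V) : Prop :=
  ∀ v : V, (G.emit v).Finite → (G.emit v).Nonempty → (∀ e ∈ G.emit v, G.rng e ∈ X) → v ∈ X

/-- The edges emitted by `v` whose range is not in `H`. -/
def emitOutside (G : DirGraph V E) (H : Set V) (v : V) : Set E :=
  {e | G.src e = v ∧ G.rng e ∉ H}

/-- The set `B_H` of breaking vertices of `H`: the infinite emitters outside `H` that emit a
nonzero finite number of edges with range outside `H`. -/
def breaking (G : DirGraph V E) (H : Set V) : Set V :=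
  {v | v ∉ H ∧ (G.emit v).Infinite ∧ (G.emitOutside H v).Nonempty ∧ (G.emitOutside H v).Finite}

/-- An admissible pair `(H, S)`: `H` is a saturated hereditary set of vertices and `S ⊆ B_H`. -/
@[ext]
structure AdmissiblePair (G : DirGraph V E) where
  /-- the saturated hereditary set -/
  H : Set V
  /-- the set of breaking vertices -/
  S : Set V
  hereditary : G.IsHereditary H
  saturated : G.IsSaturated H
  subset_breaking : S ⊆ G.breaking H

/-- The graph `E_X = (X, s⁻¹(X), r, s)` of a hereditary set `X` of vertices. -/
def restrict (G : DirGraph V E) (X : Set V) (hX : G.IsHereditary X) :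
    DirGraph {v : V // v ∈ X} {e : E // G.src e ∈ X} where
  src e := ⟨G.src e.1, e.2⟩
  rng e := ⟨G.rng e.1, hX e.1 e.2⟩

/-- The graph `E_{(H,S)}` of an admissible pair: its vertices are those of `H ∪ S`, its edges are
the edges with source in `H` and the edges from `S` to `H`. -/
def pairGraph (G : DirGraph V E) (p : G.AdmissiblePair) :
    DirGraph {v : V // v ∈ p.H ∪ p.S}
      {e : E // G.src e ∈ p.H ∨ (G.src e ∈ p.S ∧ G.rng e ∈ p.H)} where
  src e := ⟨G.src e.1, e.2.elim Or.inl fun h => Or.inr h.1⟩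
  rng e := ⟨G.rng e.1, Or.inl (e.2.elim (p.hereditary e.1) fun h => h.2)⟩

/-- The vertices of the quotient graph `E/(H,S)`: `Sum.inl v` is the vertex `v ∉ H` itself, and
`Sum.inr v` is the new vertex `v'` attached to `v ∈ B_H \ S`. -/
abbrev QuotVertex (G : DirGraph V E) (p : G.AdmissiblePair) : Type u :=
  {v : V // v ∉ p.H} ⊕ {v : V // v ∈ G.breaking p.H \ p.S}

/-- The edges of the quotient graph `E/(H,S)`: `Sum.inl e` is the edge `e` with `r(e) ∉ H` itself,
and `Sum.inr e` is the new edge `e'` attached to `e` with `r(e) ∈ B_H \ S`. -/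
abbrev QuotEdge (G : DirGraph V E) (p : G.AdmissiblePair) : Type v :=
  {e : E // G.rng e ∉ p.H} ⊕ {e : E // G.rng e ∈ G.breaking p.H \ p.S}

/-- The quotient graph `E/(H,S)`, with `s(e') = s(e)` and `r(e') = r(e)'`. -/
def quotGraph (G : DirGraph V E) (p : G.AdmissiblePair) :
    DirGraph (G.QuotVertex p) (G.QuotEdge p) where
  src e := e.elim
    (fun e => Sum.inl ⟨G.src e.1, fun h => e.2 (p.hereditary e.1 h)⟩)
    (fun e => Sum.inl ⟨G.src e.1, fun h => e.2.1.1 (p.hereditary e.1 h)⟩)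
  rng e := e.elim
    (fun e => Sum.inl ⟨G.rng e.1, e.2⟩)
    (fun e => Sum.inr ⟨G.rng e.1, e.2⟩)

/-- Finite paths from `u` to `w`: the vertex `v` as a path of length zero, and the paths
`e α` where `r(e)` is the source of `α`. -/
inductive Path (G : DirGraph V E) : V → V → Type (max u v)
  | nil (v : V) : Path G v v
  | cons {a b : V} (e : E) (h : G.src e = a) (α : Path G (G.rng e) b) : Path G a b

/-- The length of a path. -/
def Path.length {G : DirGraph V E} : {a b : V} → G.Path a b → ℕ
  | _, _, .nil _ => 0
  | _, _, .cons _ _ α => α.length + 1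

end DirGraph

/-! ### The Leavitt path algebra -/

namespace Leavitt

open DirGraph

variable {V : Type u} {E : Type v}

/-- The generating symbols `v`, `e` and `e*`. -/
inductive Gen (V : Type u) (E : Type v) : Type (max u v)
  | vertex (v : V) : Gen V E
  | edge (e : E) : Gen V E
  | ghost (e : E) : Gen V E

/-- The relations satisfied by a Leavitt `E`-family. -/
inductive Rel (R : Type w) [CommRing R] (G : DirGraph V E) :
    FreeAlgebra R (Gen V E) → FreeAlgebra R (Gen V E) → Prop
  | idem (v : V) : Rel R G
      (FreeAlgebra.ι R (.vertex v) * FreeAlgebra.ι R (.vertex v)) (FreeAlgebra.ι R (.vertex v))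
  | orth (v v' : V) (h : v ≠ v') : Rel R G
      (FreeAlgebra.ι R (.vertex v) * FreeAlgebra.ι R (.vertex v')) 0
  | src_edge (e : E) : Rel R G
      (FreeAlgebra.ι R (.vertex (G.src e)) * FreeAlgebra.ι R (.edge e)) (FreeAlgebra.ι R (.edge e))
  | edge_rng (e : E) : Rel R G
      (FreeAlgebra.ι R (.edge e) * FreeAlgebra.ι R (.vertex (G.rng e))) (FreeAlgebra.ι R (.edge e))
  | rng_ghost (e : E) : Rel R G
      (FreeAlgebra.ι R (.vertex (G.rng e)) * FreeAlgebra.ι R (.ghost e))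
      (FreeAlgebra.ι R (.ghost e))
  | ghost_src (e : E) : Rel R G
      (FreeAlgebra.ι R (.ghost e) * FreeAlgebra.ι R (.vertex (G.src e)))
      (FreeAlgebra.ι R (.ghost e))
  | ghost_edge_same (e : E) : Rel R G
      (FreeAlgebra.ι R (.ghost e) * FreeAlgebra.ι R (.edge e))
      (FreeAlgebra.ι R (.vertex (G.rng e)))
  | ghost_edge_ne (e f : E) (h : e ≠ f) : Rel R G
      (FreeAlgebra.ι R (.ghost e) * FreeAlgebra.ι R (.edge f)) 0
  | finite_emitter (v : V) (hfin : (G.emit v).Finite) (hne : (G.emit v).Nonempty) : Rel R G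
      (FreeAlgebra.ι R (.vertex v))
      (∑ e ∈ hfin.toFinset, FreeAlgebra.ι R (.edge e) * FreeAlgebra.ι R (.ghost e))

/-- The universal *unital* `R`-algebra generated by a Leavitt `E`-family. It is the unitization of
the Leavitt path algebra. -/
abbrev UnitalEnvelope (R : Type w) [CommRing R] (G : DirGraph V E) : Type (max u v w) :=
  RingQuot (Rel R G)

/-- The class of a generating symbol in the unital envelope. -/
noncomputable def genEnv (R : Type w) [CommRing R] (G : DirGraph V E) (x : Gen V E) :
    UnitalEnvelope R G :=
  RingQuot.mkAlgHom R (Rel R G) (FreeAlgebra.ι R x)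

/-- The Leavitt path algebra `L_R(E)`, the universal (in general non-unital) `R`-algebra generated
by a Leavitt `E`-family. It is realized as the non-unital subalgebra generated by all `v`, `e`,
`e*` inside the universal unital algebra on these symbols: since non-unital algebras embed in
their unitizations, this subalgebra has the universal property among non-unital algebras (see
`Leavitt.exists_lift`). -/
def LPA (R : Type w) [CommRing R] (G : DirGraph V E) : Type (max u v w) :=
  ↥(NonUnitalAlgebra.adjoin R (Set.range (genEnv R G)))

section
variable (R : Type w) [CommRing R] (G : DirGraph V E)

noncomputable instance : NonUnitalRing (LPA R G) :=
  inferInstanceAs (NonUnitalRing ↥(NonUnitalAlgebra.adjoin R (Set.range (genEnv R G))))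

noncomputable instance : Module R (LPA R G) :=
  inferInstanceAs (Module R ↥(NonUnitalAlgebra.adjoin R (Set.range (genEnv R G))))

instance : IsScalarTower R (LPA R G) (LPA R G) :=
  inferInstanceAs (IsScalarTower R ↥(NonUnitalAlgebra.adjoin R (Set.range (genEnv R G)))
    ↥(NonUnitalAlgebra.adjoin R (Set.range (genEnv R G))))

instance : SMulCommClass R (LPA R G) (LPA R G) :=
  inferInstanceAs (SMulCommClass R ↥(NonUnitalAlgebra.adjoin R (Set.range (genEnv R G)))
    ↥(NonUnitalAlgebra.adjoin R (Set.range (genEnv R G))))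

/-- A generator of the Leavitt path algebra. -/
noncomputable def gen (x : Gen V E) : LPA R G :=
  ⟨genEnv R G x, NonUnitalAlgebra.subset_adjoin R ⟨x, rfl⟩⟩

/-- The vertex `v` as an element of `L_R(E)`. -/
noncomputable def vert (v : V) : LPA R G := gen R G (.vertex v)

/-- The edge `e` as an element of `L_R(E)`. -/
noncomputable def edge (e : E) : LPA R G := gen R G (.edge e)

/-- The ghost edge `e*` as an element of `L_R(E)`. -/
noncomputable def ghost (e : E) : LPA R G := gen R G (.ghost e)

end

section
variable (R : Type w) [CommRing R] (G : DirGraph V E)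

/-- A Leavitt `E`-family in a ring: elements `a v`, `b e`, `c e` standing for `v`, `e`, `e*`. -/
structure IsFamily {A : Type*} [NonUnitalRing A] (G : DirGraph V E)
    (a : V → A) (b c : E → A) : Prop where
  idem : ∀ v, a v * a v = a v
  orth : ∀ v v', v ≠ v' → a v * a v' = 0
  src_edge : ∀ e, a (G.src e) * b e = b e
  edge_rng : ∀ e, b e * a (G.rng e) = b e
  rng_ghost : ∀ e, a (G.rng e) * c e = c e
  ghost_src : ∀ e, c e * a (G.src e) = c e
  ghost_edge_same : ∀ e, c e * b e = a (G.rng e)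
  ghost_edge_ne : ∀ e f, e ≠ f → c e * b f = 0
  finite_emitter : ∀ v (hfin : (G.emit v).Finite), (G.emit v).Nonempty →
    a v = ∑ e ∈ hfin.toFinset, b e * c e

theorem lpa_isFamily : IsFamily G (vert R G) (edge R G) (ghost R G) := by
  have key : ∀ {x y : FreeAlgebra R (Gen V E)}, Rel R G x y →
      RingQuot.mkAlgHom R (Rel R G) x = RingQuot.mkAlgHom R (Rel R G) y :=
    fun h => RingQuot.mkAlgHom_rel R h
  constructor
  · exact fun v => Subtype.ext ((map_mul _ _ _).symm.trans (key (Rel.idem v)))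
  · exact fun v v' h => Subtype.ext (
      (map_mul _ _ _).symm.trans ((key (Rel.orth v v' h)).trans (map_zero _)))
  · exact fun e => Subtype.ext ((map_mul _ _ _).symm.trans (key (Rel.src_edge e)))
  · exact fun e => Subtype.ext ((map_mul _ _ _).symm.trans (key (Rel.edge_rng e)))
  · exact fun e => Subtype.ext ((map_mul _ _ _).symm.trans (key (Rel.rng_ghost e)))
  · exact fun e => Subtype.ext ((map_mul _ _ _).symm.trans (key (Rel.ghost_src e)))
  · exact fun e => Subtype.ext ((map_mul _ _ _).symm.trans (key (Rel.ghost_edge_same e)))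
  · exact fun e f h => Subtype.ext (
      (map_mul _ _ _).symm.trans ((key (Rel.ghost_edge_ne e f h)).trans (map_zero _)))
  · intro v hfin hne
    have h := key (Rel.finite_emitter v hfin hne)
    rw [map_sum] at h
    refine Subtype.ext (h.trans ?_)
    have := map_sum (NonUnitalSubalgebraClass.subtype
      (NonUnitalAlgebra.adjoin R (Set.range (genEnv R G))))
      (fun e => (edge R G e * ghost R G e : LPA R G)) hfin.toFinset
    refine Eq.trans ?_ this.symm
    exact Finset.sum_congr rfl fun e _ => map_mul _ _ _

/-- The universal property of the Leavitt path algebra. -/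
theorem exists_lift {A : Type*} [NonUnitalRing A] [Module R A] [IsScalarTower R A A]
    [SMulCommClass R A A] {a : V → A} {b c : E → A} (h : IsFamily G a b c) :
    ∃! φ : LPA R G →ₙₐ[R] A, (∀ v, φ (vert R G v) = a v) ∧ (∀ e, φ (edge R G e) = b e) ∧
      ∀ e, φ (ghost R G e) = c e := by
  let g : Gen V E → A := fun x => match x with
    | .vertex v => a v
    | .edge e => b e
    | .ghost e => c e
  let f₀ : FreeAlgebra R (Gen V E) →ₐ[R] Unitization R A :=
    FreeAlgebra.lift R fun x => (g x : Unitization R A)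
  have hf₀ : ∀ ⦃x y⦄, Rel R G x y → f₀ x = f₀ y := by
    intro x y hxy
    cases hxy with
    | finite_emitter v hfin hne =>
      simp only [f₀, map_sum, map_mul, FreeAlgebra.lift_ι_apply, g, ← Unitization.inr_mul]
      rw [h.finite_emitter v hfin hne]
      exact map_sum (Unitization.inrNonUnitalAlgHom R A) _ _
    | idem v => simp [f₀, g, ← Unitization.inr_mul, h.idem]
    | orth v v' hv => simp [f₀, g, ← Unitization.inr_mul, h.orth v v' hv]
    | src_edge e => simp [f₀, g, ← Unitization.inr_mul, h.src_edge]
    | edge_rng e => simp [f₀, g, ← Unitization.inr_mul, h.edge_rng]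
    | rng_ghost e => simp [f₀, g, ← Unitization.inr_mul, h.rng_ghost]
    | ghost_src e => simp [f₀, g, ← Unitization.inr_mul, h.ghost_src]
    | ghost_edge_same e => simp [f₀, g, ← Unitization.inr_mul, h.ghost_edge_same]
    | ghost_edge_ne e e' he => simp [f₀, g, ← Unitization.inr_mul, h.ghost_edge_ne e e' he]
  let f : UnitalEnvelope R G →ₐ[R] Unitization R A := RingQuot.liftAlgHom R ⟨f₀, hf₀⟩
  have hf : ∀ x, f (genEnv R G x) = (g x : Unitization R A) := fun x => by
    simp [f, genEnv, f₀]
  let S := NonUnitalAlgebra.adjoin R (Set.range (genEnv R G))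
  let ι := Unitization.inrNonUnitalAlgHom R A
  have hle : S ≤ (NonUnitalAlgHom.range ι).comap (f : UnitalEnvelope R G →ₙₐ[R] _) := by
    refine NonUnitalAlgebra.adjoin_le ?_
    rintro _ ⟨x, rfl⟩
    exact ⟨g x, (hf x).symm⟩
  have hfst : ∀ x : S, ((f x).snd : Unitization R A) = f x := by
    intro x
    obtain ⟨y, hy⟩ := hle x.2
    have hy' : (y : Unitization R A) = f x := hy
    rw [← hy', Unitization.snd_inr]
  have hinj : Function.Injective (Unitization.inr : A → Unitization R A) :=
    Unitization.inr_injective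
  let φ : S →ₙₐ[R] A :=
    { toFun := fun x => (f x).snd
      map_smul' := fun r x => by
        change (f (r • (x : UnitalEnvelope R G))).snd = r • (f x).snd
        rw [map_smul, Unitization.snd_smul]
      map_zero' := by
        change (f 0).snd = 0
        simp
      map_add' := fun x y => by
        change (f ((x : UnitalEnvelope R G) + y)).snd = _
        rw [map_add, Unitization.snd_add]
      map_mul' := fun x y => by
        apply hinj
        rw [Unitization.inr_mul, hfst, hfst, hfst, ← map_mul]
        rfl }
  have hφ : ∀ x, φ (gen R G x) = g x := fun x => by
    change (f (genEnv R G x)).snd = g x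
    rw [hf, Unitization.snd_inr]
  refine ⟨φ, ⟨fun v => hφ _, fun e => hφ _, fun e => hφ _⟩, ?_⟩
  rintro ψ ⟨h1, h2, h3⟩
  have : ∀ x, ψ (gen R G x) = φ (gen R G x) := by
    intro x
    rw [hφ]
    cases x with
    | vertex v => exact h1 v
    | edge e => exact h2 e
    | ghost e => exact h3 e
  let ψ' : S →ₙₐ[R] A := ψ
  have hS : ψ' = φ := by
    refine NonUnitalAlgHom.ext fun x => ?_
    refine NonUnitalAlgebra.adjoin_induction
      (p := fun y hy => ψ' ⟨y, hy⟩ = φ ⟨y, hy⟩) ?_ ?_ ?_ ?_ ?_ x.2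
    · rintro _ ⟨y, rfl⟩
      exact this y
    · intro y z hy hz h1 h2
      exact (map_add ψ' ⟨y, hy⟩ ⟨z, hz⟩).trans ((congrArg₂ (· + ·) h1 h2).trans
        (map_add φ ⟨y, hy⟩ ⟨z, hz⟩).symm)
    · exact (map_zero ψ').trans (map_zero φ).symm
    · intro y z hy hz h1 h2
      exact (map_mul ψ' ⟨y, hy⟩ ⟨z, hz⟩).trans ((congrArg₂ (· * ·) h1 h2).trans
        (map_mul φ ⟨y, hy⟩ ⟨z, hz⟩).symm)
    · intro r y hy h1
      exact (map_smul ψ' r ⟨y, hy⟩).trans ((congrArg (r • ·) h1).trans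
        (map_smul φ r ⟨y, hy⟩).symm)
  exact hS

end

/-- The element `α` of `L_R(E)` given by a path `α`. -/
noncomputable def pathElem (R : Type w) [CommRing R] {G : DirGraph V E} :
    {a b : V} → G.Path a b → LPA R G
  | _, _, .nil v => vert R G v
  | _, _, .cons e _ α => edge R G e * pathElem R α

/-- The element `α*` of `L_R(E)` given by a path `α`. -/
noncomputable def pathGhost (R : Type w) [CommRing R] {G : DirGraph V E} :
    {a b : V} → G.Path a b → LPA R G
  | _, _, .nil v => vert R G v
  | _, _, .cons e _ α => pathGhost R α * ghost R G e

section
variable (R : Type w) [CommRing R] (G : DirGraph V E)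

/-- The homogeneous component of degree `k` of `L_R(E)`: the `R`-span of the elements `αβ*` with
`r(α) = r(β)` and `|α| - |β| = k`. -/
noncomputable def component (k : ℤ) : Submodule R (LPA R G) :=
  Submodule.span R {x | ∃ (a b c : V) (α : G.Path a c) (β : G.Path b c),
    (α.length : ℤ) - (β.length : ℤ) = k ∧ x = pathElem R α * pathGhost R β}

variable {R G}

/-- An ideal `I` is graded if `I = ⨁ₖ (I ∩ L_R(E)ₖ)`, that is, each of its elements is in exactly
one way a finite sum of elements `f k ∈ I ∩ L_R(E)ₖ`. -/
def IsGradedIdeal (I : TwoSidedIdeal (LPA R G)) : Prop :=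
  ∀ x ∈ I, ∃! f : ℤ →₀ LPA R G,
    (∀ k, f k ∈ I ∧ f k ∈ component R G k) ∧ (f.sum fun _ y => y) = x

/-- An ideal `I` is basic if `r x ∈ I` with `r ≠ 0` implies `x ∈ I`, whenever `x` is a vertex `v`,
or `x = v - ∑ᵢ eᵢ eᵢ*` for finitely many distinct edges `eᵢ` with source `v`. -/
def IsBasicIdeal (I : TwoSidedIdeal (LPA R G)) : Prop :=
  (∀ (r : R) (v : V), r ≠ 0 → r • vert R G v ∈ I → vert R G v ∈ I) ∧
  ∀ (r : R) (v : V) (F : Finset E), r ≠ 0 → (∀ e ∈ F, G.src e = v) →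
    r • (vert R G v - ∑ e ∈ F, edge R G e * ghost R G e) ∈ I →
    vert R G v - ∑ e ∈ F, edge R G e * ghost R G e ∈ I

variable (R)

/-- The element `v^H = v - ∑ e e*`, the sum being over the finitely many edges `e` with `s(e) = v`
and `r(e) ∉ H`, for `v ∈ B_H`. -/
noncomputable def breakElem {H : Set V} {v : V} (hv : v ∈ G.breaking H) : LPA R G :=
  vert R G v - ∑ e ∈ hv.2.2.2.toFinset, edge R G e * ghost R G e

/-- The ideal `I(X)` of `L_R(E)` generated by the vertices in `X`. -/
noncomputable def vertexIdeal (G : DirGraph V E) (X : Set V) : TwoSidedIdeal (LPA R G) :=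
  TwoSidedIdeal.span {x | ∃ v ∈ X, x = vert R G v}

/-- The ideal `I(H,S)` of `L_R(E)` generated by the vertices in `H` and the elements `v^H` with
`v ∈ S`. -/
noncomputable def pairIdeal (p : G.AdmissiblePair) : TwoSidedIdeal (LPA R G) :=
  TwoSidedIdeal.span ({x | ∃ v ∈ p.H, x = vert R G v} ∪
    {x | ∃ (v : V) (hv : v ∈ p.S), x = breakElem R (p.subset_breaking hv)})

open scoped Classical in
/-- The sum in `L_R(E/(H,S))` of the vertices lying over a vertex `v`: it is `0` if `v ∈ H`, it is
`v + v'` if `v ∈ B_H \ S`, and it is `v` otherwise. -/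
noncomputable def quotVert (p : G.AdmissiblePair) (v : V) : LPA R (G.quotGraph p) :=
  (if h : v ∉ p.H then vert R (G.quotGraph p) (Sum.inl ⟨v, h⟩) else 0) +
  (if h : v ∈ G.breaking p.H \ p.S then vert R (G.quotGraph p) (Sum.inr ⟨v, h⟩) else 0)

open scoped Classical in
/-- The sum in `L_R(E/(H,S))` of the edges lying over an edge `e`: it is `0` if `r(e) ∈ H`, it is
`e + e'` if `r(e) ∈ B_H \ S`, and it is `e` otherwise. -/
noncomputable def quotEdge (p : G.AdmissiblePair) (e : E) : LPA R (G.quotGraph p) :=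
  (if h : G.rng e ∉ p.H then edge R (G.quotGraph p) (Sum.inl ⟨e, h⟩) else 0) +
  (if h : G.rng e ∈ G.breaking p.H \ p.S then edge R (G.quotGraph p) (Sum.inr ⟨e, h⟩) else 0)

open scoped Classical in
/-- The sum in `L_R(E/(H,S))` of the ghost edges lying over an edge `e`: it is `0` if `r(e) ∈ H`,
it is `e* + (e')*` if `r(e) ∈ B_H \ S`, and it is `e*` otherwise. -/
noncomputable def quotGhost (p : G.AdmissiblePair) (e : E) : LPA R (G.quotGraph p) :=
  (if h : G.rng e ∉ p.H then ghost R (G.quotGraph p) (Sum.inl ⟨e, h⟩) else 0) +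
  (if h : G.rng e ∈ G.breaking p.H \ p.S then ghost R (G.quotGraph p) (Sum.inr ⟨e, h⟩) else 0)

end

end Leavitt

/-! ### Morita equivalence of rings without identity -/

open CategoryTheory in
/-- The modules over a ring `A` that need not have an identity are the unital modules over its
unitization `ℤ ⊕ A`. Such a module `M` is a *nondegenerate* `A`-module if `A M = M` and if
`A m = 0` implies `m = 0`. -/
def nondegenerateModule (A : Type u) [NonUnitalRing A] :
    ObjectProperty (ModuleCat.{w} (Unitization ℤ A)) :=
  fun M =>
    (∀ m : M, m ∈ AddSubgroup.closure {x : M | ∃ (a : A) (y : M), x = (a : Unitization ℤ A) • y}) ∧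
    ∀ m : M, (∀ a : A, (a : Unitization ℤ A) • m = 0) → m = 0

open CategoryTheory in
/-- Two rings, possibly without identity, are Morita equivalent if their categories of
nondegenerate left modules are equivalent through an additive functor. For rings with local units
the second condition on a nondegenerate module follows from the first, and for unital rings these
are the usual categories of unital modules. -/
def RingsMoritaEquivalent (A : Type u) (B : Type v) [NonUnitalRing A] [NonUnitalRing B] : Prop :=
  ∃ F : (nondegenerateModule.{u, max u v} A).FullSubcategory ≌
      (nondegenerateModule.{v, max u v} B).FullSubcategory,
    F.functor.Additive

/-!
# Morita equivalence, quotients and graded basic ideals of Leavitt path algebras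

Everything rests on the grading of `L_R(E)` and on two facts about vertices. The grading is
detected by a homomorphism to Laurent polynomials (`degHom`), so that homogeneous components are
unique. A nonzero multiple `r v` of a vertex is never zero (`smul_vert_ne_zero`), because
`L_R(E)` acts on the functions on `E⁰ × ℕ`, where `{v} × ℕ` is the disjoint union of the copies
of `ℕ` that belong to the edges emitted by `v`; countability enters here. Finally, a nonzero
homogeneous element is carried to a nonzero multiple of a vertex by multiplication from both
sides (`exists_mul_mul_eq_smul_vert`). Hence a graded ideal that contains no `r v` with `r ≠ 0`
is zero, and a graded homomorphism that does not kill any such `r v` is injective: the graded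
uniqueness theorems `eq_zero_of_mem_graded` and `injective_of_graded`.

*The quotient.* The elements `v + v'`, `e + e'`, `e* + e'*` form a Leavitt `E`-family in
`L_R(E/(H,S))` that kills `I(H,S)` (`toQuot`). Conversely, for `v ∈ B_H \ S` the classes of
`∑ e e*` and of `v^H` modulo `I(H,S)` behave as the vertices `v` and `v'` of `E/(H,S)`, which gives
the inverse map (`ofQuot`, `exists_quotEquiv`).

*Graded basic ideals.* `I(H,S)` is generated in degree zero, hence graded, and its pair can be read
off from it, and it is basic, since a vertex of `E/(H,S)` has no vanishing multiple. If `I` is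
graded and basic, let `(H,S)` consist of the vertices in `I` and the `v ∈ B_H` with `v^H ∈ I`. The
image of `I` in `L_R(E/(H,S))` is graded and contains no nonzero multiple of a vertex, so it
vanishes by graded uniqueness (`pairIdeal_admissiblePairOf`).

*Morita equivalence.* The generating idempotents `q` of `I(X)` and of `I(H,S)`, with the edges
between them, form a Leavitt family of the graph `F = E_X` or `F = E_{(H,S)}`. By graded uniqueness
`L_R(F)` is embedded in the ideal `I`, its image is the corner of `I` cut out by the `q`, and it
generates `I` (`IsCornerFamily.moritaEquivalent`). A ring `A` is Morita equivalent to a subring `B`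
with local units such that `B A B ⊆ B` and `A B A = A`
(`NonUnitalMorita.IsFullCorner.moritaEquivalent`): the functor `M ↦ B M` on nondegenerate modules
is fully faithful, and a `B`-module `N` is the image of the `A`-module that is generated by the
families `b ↦ (a' ↦ b a' a n)` inside `B → Hom(A, N)`, a torsion-free substitute for `A ⊗_B N`.
-/

/-! ### Elementary identities in the Leavitt path algebra -/

namespace DirGraph

variable {V : Type u} {E : Type v}

/-- The path `α e`, for an edge `e` whose source is the range of `α`. -/
def Path.snoc {G : DirGraph V E} : {a b : V} → G.Path a b → (e : E) → G.src e = b →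
    G.Path a (G.rng e)
  | _, _, .nil _, e, h => .cons e h (.nil _)
  | _, _, .cons f hf α, e, h => .cons f hf (α.snoc e h)

theorem Path.length_snoc {G : DirGraph V E} {a b : V} (α : G.Path a b) (e : E)
    (h : G.src e = b) : (α.snoc e h).length = α.length + 1 := by
  induction α with
  | nil v => rfl
  | cons f hf α ih => simp [Path.snoc, Path.length, ih]

end DirGraph

namespace Leavitt

open DirGraph

variable {V : Type u} {E : Type v} {R : Type w} [CommRing R] {G : DirGraph V E}

theorem LPA.induction {p : LPA R G → Prop} (hv : ∀ v, p (vert R G v)) (he : ∀ e, p (edge R G e))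
    (hg : ∀ e, p (ghost R G e)) (add : ∀ x y, p x → p y → p (x + y))
    (mul : ∀ x y, p x → p y → p (x * y)) (smul : ∀ (r : R) x, p x → p (r • x)) (zero : p 0)
    (x : LPA R G) : p x := by
  refine NonUnitalAlgebra.adjoin_induction (R := R) (s := Set.range (genEnv R G))
    (p := fun y hy => p ⟨y, hy⟩) ?_ (fun y z hy hz h1 h2 => add _ _ h1 h2) zero
    (fun y z hy hz h1 h2 => mul _ _ h1 h2) (fun r y hy h1 => smul r _ h1) x.2
  rintro _ ⟨y, rfl⟩
  cases y with
  | vertex v => exact hv v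
  | edge e => exact he e
  | ghost e => exact hg e

@[simp] theorem vert_mul_self (v : V) : vert R G v * vert R G v = vert R G v :=
  (lpa_isFamily R G).idem v

theorem vert_mul_of_ne {v v' : V} (h : v ≠ v') : vert R G v * vert R G v' = 0 :=
  (lpa_isFamily R G).orth v v' h

@[simp] theorem src_mul_edge (e : E) : vert R G (G.src e) * edge R G e = edge R G e :=
  (lpa_isFamily R G).src_edge e

@[simp] theorem edge_mul_rng (e : E) : edge R G e * vert R G (G.rng e) = edge R G e :=
  (lpa_isFamily R G).edge_rng e

@[simp] theorem rng_mul_ghost (e : E) : vert R G (G.rng e) * ghost R G e = ghost R G e :=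
  (lpa_isFamily R G).rng_ghost e

@[simp] theorem ghost_mul_src (e : E) : ghost R G e * vert R G (G.src e) = ghost R G e :=
  (lpa_isFamily R G).ghost_src e

@[simp] theorem ghost_mul_edge_self (e : E) : ghost R G e * edge R G e = vert R G (G.rng e) :=
  (lpa_isFamily R G).ghost_edge_same e

theorem ghost_mul_edge_of_ne {e f : E} (h : e ≠ f) : ghost R G e * edge R G f = 0 :=
  (lpa_isFamily R G).ghost_edge_ne e f h

theorem vert_mul_edge_of_ne {v : V} {e : E} (h : v ≠ G.src e) : vert R G v * edge R G e = 0 := by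
  rw [← src_mul_edge, ← mul_assoc, vert_mul_of_ne h, zero_mul]

theorem edge_mul_vert_of_ne {v : V} {e : E} (h : G.rng e ≠ v) : edge R G e * vert R G v = 0 := by
  rw [← edge_mul_rng, mul_assoc, vert_mul_of_ne h, mul_zero]

theorem vert_mul_ghost_of_ne {v : V} {e : E} (h : v ≠ G.rng e) :
    vert R G v * ghost R G e = 0 := by
  rw [← rng_mul_ghost, ← mul_assoc, vert_mul_of_ne h, zero_mul]

theorem ghost_mul_vert_of_ne {v : V} {e : E} (h : G.src e ≠ v) :
    ghost R G e * vert R G v = 0 := by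
  rw [← ghost_mul_src, mul_assoc, vert_mul_of_ne h, mul_zero]

@[simp] theorem vert_mul_pathElem {a b : V} (α : G.Path a b) :
    vert R G a * pathElem R α = pathElem R α := by
  cases α with
  | nil v => simp [pathElem]
  | cons e h α => subst h; simp [pathElem, ← mul_assoc]

@[simp] theorem pathElem_mul_vert {a b : V} (α : G.Path a b) :
    pathElem R α * vert R G b = pathElem R α := by
  induction α with
  | nil v => simp [pathElem]
  | cons e h α ih => simp [pathElem, mul_assoc, ih]

@[simp] theorem pathGhost_mul_vert {a b : V} (α : G.Path a b) :
    pathGhost R α * vert R G a = pathGhost R α := by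
  cases α with
  | nil v => simp [pathGhost]
  | cons e h α => subst h; simp [pathGhost, mul_assoc]

@[simp] theorem vert_mul_pathGhost {a b : V} (α : G.Path a b) :
    vert R G b * pathGhost R α = pathGhost R α := by
  induction α with
  | nil v => simp [pathGhost]
  | cons e h α ih => simp [pathGhost, ← mul_assoc, ih]

theorem pathGhost_snoc {a b : V} (α : G.Path a b) (e : E) (h : G.src e = b) :
    pathGhost R (α.snoc e h) = ghost R G e * pathGhost R α := by
  induction α with
  | nil v => subst h; simp [Path.snoc, pathGhost]
  | cons f hf α ih => simp [Path.snoc, pathGhost, ih, mul_assoc]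

/-! ### The grading -/

theorem pathElem_mul_pathGhost_mem {a b c : V} (α : G.Path a c) (β : G.Path b c) {k : ℤ}
    (hk : (α.length : ℤ) - β.length = k) : pathElem R α * pathGhost R β ∈ component R G k :=
  Submodule.subset_span ⟨a, b, c, α, β, hk, rfl⟩

theorem vert_mem_component (v : V) : vert R G v ∈ component R G 0 := by
  simpa [pathElem, pathGhost] using
    pathElem_mul_pathGhost_mem (R := R) (.nil v) (.nil v) (k := 0) (by simp)

theorem pathElem_mem_component {a b : V} (α : G.Path a b) :
    pathElem R α ∈ component R G α.length := by
  simpa [pathGhost] using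
    pathElem_mul_pathGhost_mem (R := R) α (.nil b) (k := α.length) (by simp [Path.length])

theorem pathGhost_mem_component {a b : V} (α : G.Path a b) :
    pathGhost R α ∈ component R G (-α.length) := by
  simpa [pathElem] using
    pathElem_mul_pathGhost_mem (R := R) (.nil b) α (k := -α.length) (by simp [Path.length])

theorem edge_mem_component (e : E) : edge R G e ∈ component R G 1 := by
  simpa [pathElem, Path.length] using
    pathElem_mem_component (R := R) (.cons e rfl (.nil (G.rng e)))

theorem ghost_mem_component (e : E) : ghost R G e ∈ component R G (-1) := by
  simpa [pathGhost, Path.length] using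
    pathGhost_mem_component (R := R) (.cons e rfl (.nil (G.rng e)))

theorem vert_mul_mem_component (v : V) {k : ℤ} {y : LPA R G} (hy : y ∈ component R G k) :
    vert R G v * y ∈ component R G k := by
  induction hy using Submodule.span_induction with
  | mem y hy =>
    obtain ⟨a, b, c, α, β, hk, rfl⟩ := hy
    rw [← mul_assoc]
    by_cases h : v = a
    · subst h
      rw [vert_mul_pathElem]
      exact pathElem_mul_pathGhost_mem α β hk
    · rw [← vert_mul_pathElem, ← mul_assoc, vert_mul_of_ne h, zero_mul, zero_mul]
      exact zero_mem _
  | zero => rw [mul_zero]; exact zero_mem _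
  | add x y _ _ hx hy => rw [mul_add]; exact add_mem hx hy
  | smul r x _ hx => rw [mul_smul_comm]; exact Submodule.smul_mem _ r hx

theorem edge_mul_mem_component (e : E) {k : ℤ} {y : LPA R G} (hy : y ∈ component R G k) :
    edge R G e * y ∈ component R G (k + 1) := by
  induction hy using Submodule.span_induction with
  | mem y hy =>
    obtain ⟨a, b, c, α, β, hk, rfl⟩ := hy
    rw [← mul_assoc]
    by_cases h : G.rng e = a
    · subst h
      exact pathElem_mul_pathGhost_mem (.cons e rfl α) β (by simp [Path.length]; omega)
    · rw [← vert_mul_pathElem, ← mul_assoc, edge_mul_vert_of_ne h, zero_mul, zero_mul]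
      exact zero_mem _
  | zero => rw [mul_zero]; exact zero_mem _
  | add x y _ _ hx hy => rw [mul_add]; exact add_mem hx hy
  | smul r x _ hx => rw [mul_smul_comm]; exact Submodule.smul_mem _ r hx

theorem ghost_mul_mem_component (e : E) {k : ℤ} {y : LPA R G} (hy : y ∈ component R G k) :
    ghost R G e * y ∈ component R G (k - 1) := by
  induction hy using Submodule.span_induction with
  | mem y hy =>
    obtain ⟨a, b, c, α, β, hk, rfl⟩ := hy
    cases α with
    | nil =>
      by_cases h : G.src e = a
      · have := pathElem_mul_pathGhost_mem (R := R) (.nil _) (β.snoc e h) (k := k - 1)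
          (by simp [Path.length, Path.length_snoc] at hk ⊢; omega)
        simpa [pathElem, pathGhost_snoc, ← mul_assoc] using this
      · rw [← vert_mul_pathElem, ← mul_assoc, ← mul_assoc, ghost_mul_vert_of_ne h, zero_mul,
          zero_mul]
        exact zero_mem _
    | cons f h α =>
      by_cases hef : e = f
      · subst hef
        rw [pathElem, ← mul_assoc, ← mul_assoc, ghost_mul_edge_self, vert_mul_pathElem]
        exact pathElem_mul_pathGhost_mem α β (by simp [Path.length] at hk; omega)
      · rw [pathElem, ← mul_assoc, ← mul_assoc, ghost_mul_edge_of_ne hef, zero_mul, zero_mul]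
        exact zero_mem _
  | zero => rw [mul_zero]; exact zero_mem _
  | add x y _ _ hx hy => rw [mul_add]; exact add_mem hx hy
  | smul r x _ hx => rw [mul_smul_comm]; exact Submodule.smul_mem _ r hx

theorem mul_mem_component {j k : ℤ} {x y : LPA R G} (hx : x ∈ component R G j)
    (hy : y ∈ component R G k) : x * y ∈ component R G (j + k) := by
  have hE : ∀ {a b : V} (α : G.Path a b) {k : ℤ} {y : LPA R G}, y ∈ component R G k →
      pathElem R α * y ∈ component R G (α.length + k) := by
    intro a b α
    induction α with
    | nil v => intro k y hy; simpa [Path.length, pathElem] using vert_mul_mem_component v hy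
    | cons e h α ih =>
      intro k y hy
      rw [pathElem, mul_assoc]
      convert edge_mul_mem_component e (ih hy) using 2
      simp [Path.length]; ring
  have hG : ∀ {a b : V} (α : G.Path a b) {k : ℤ} {y : LPA R G}, y ∈ component R G k →
      pathGhost R α * y ∈ component R G (-α.length + k) := by
    intro a b α
    induction α with
    | nil v => intro k y hy; simpa [Path.length, pathGhost] using vert_mul_mem_component v hy
    | cons e h α ih =>
      intro k y hy
      rw [pathGhost, mul_assoc]
      convert ih (ghost_mul_mem_component e hy) using 2
      simp [Path.length]; ring
  induction hx using Submodule.span_induction with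
  | mem x hx =>
    obtain ⟨a, b, c, α, β, hk, rfl⟩ := hx
    rw [mul_assoc]
    convert hE α (hG β hy) using 2
    omega
  | zero => rw [zero_mul]; exact zero_mem _
  | add x y _ _ hx hy => rw [add_mul]; exact add_mem hx hy
  | smul r x _ hx => rw [smul_mul_assoc]; exact Submodule.smul_mem _ r hx

theorem mul_mem_iSup_component {x y : LPA R G} (hx : x ∈ ⨆ k, component R G k)
    (hy : y ∈ ⨆ k, component R G k) : x * y ∈ ⨆ k, component R G k := by
  induction hx using Submodule.iSup_induction' with
  | zero => rw [zero_mul]; exact zero_mem _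
  | add a b _ _ ha hb => rw [add_mul]; exact add_mem ha hb
  | mem j x hx =>
    induction hy using Submodule.iSup_induction' with
    | zero => rw [mul_zero]; exact zero_mem _
    | add a b _ _ ha hb => rw [mul_add]; exact add_mem ha hb
    | mem k y hy => exact Submodule.mem_iSup_of_mem _ (mul_mem_component hx hy)

theorem mem_iSup_component (x : LPA R G) : x ∈ ⨆ k, component R G k := by
  induction x using LPA.induction with
  | hv v => exact Submodule.mem_iSup_of_mem _ (vert_mem_component v)
  | he e => exact Submodule.mem_iSup_of_mem _ (edge_mem_component e)
  | hg e => exact Submodule.mem_iSup_of_mem _ (ghost_mem_component e)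
  | add x y hx hy => exact add_mem hx hy
  | mul x y hx hy => exact mul_mem_iSup_component hx hy
  | smul r x hx => exact Submodule.smul_mem _ r hx
  | zero => exact zero_mem _

section degree

variable (R G)

/-- The inclusion of the Leavitt path algebra into the unital envelope. -/
noncomputable def toEnv : LPA R G →ₙₐ[R] UnitalEnvelope R G :=
  NonUnitalSubalgebraClass.subtype (NonUnitalAlgebra.adjoin R (Set.range (genEnv R G)))

theorem toEnv_injective : Function.Injective (toEnv R G) := Subtype.val_injective

variable {R G} in
theorem single_toEnv_mul (j k : ℤ) (x y : LPA R G) :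
    (AddMonoidAlgebra.single j (toEnv R G x) * AddMonoidAlgebra.single k (toEnv R G y) :
      AddMonoidAlgebra (UnitalEnvelope R G) ℤ) = .single (j + k) (toEnv R G (x * y)) := by
  rw [AddMonoidAlgebra.single_mul_single, map_mul]

/-- The elements `v`, `t e`, `t⁻¹ e*` of the Laurent polynomials in `t` over the unital envelope
form a Leavitt family. -/
theorem isFamily_laurent : IsFamily G
    (fun v => AddMonoidAlgebra.single (0 : ℤ) (toEnv R G (vert R G v)))
    (fun e => AddMonoidAlgebra.single (1 : ℤ) (toEnv R G (edge R G e)))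
    (fun e => AddMonoidAlgebra.single (-1 : ℤ) (toEnv R G (ghost R G e))) := by
  have hm := single_toEnv_mul (R := R) (G := G)
  constructor
  · intro v; rw [hm, vert_mul_self, add_zero]
  · intro v v' h; rw [hm, vert_mul_of_ne h, map_zero, AddMonoidAlgebra.single_zero]
  · intro e; rw [hm, src_mul_edge, zero_add]
  · intro e; rw [hm, edge_mul_rng, add_zero]
  · intro e; rw [hm, rng_mul_ghost, zero_add]
  · intro e; rw [hm, ghost_mul_src, add_zero]
  · intro e; rw [hm, ghost_mul_edge_self, neg_add_cancel]
  · intro e f h; rw [hm, ghost_mul_edge_of_ne h, map_zero, AddMonoidAlgebra.single_zero]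
  · intro v hfin hne
    simp only [hm, add_neg_cancel]
    rw [(lpa_isFamily R G).finite_emitter v hfin hne, map_sum]
    exact map_sum (AddMonoidAlgebra.singleAddHom (0 : ℤ)) _ _

/-- The homomorphism from the Leavitt path algebra to Laurent polynomials that multiplies an
element of degree `k` by the `k`-th power of the variable. -/
noncomputable def degHom : LPA R G →ₙₐ[R] AddMonoidAlgebra (UnitalEnvelope R G) ℤ :=
  (exists_lift R G (isFamily_laurent R G)).choose

variable {R G}

theorem degHom_vert (v : V) : degHom R G (vert R G v) = .single 0 (toEnv R G (vert R G v)) :=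
  (exists_lift R G (isFamily_laurent R G)).choose_spec.1.1 v

theorem degHom_edge (e : E) : degHom R G (edge R G e) = .single 1 (toEnv R G (edge R G e)) :=
  (exists_lift R G (isFamily_laurent R G)).choose_spec.1.2.1 e

theorem degHom_ghost (e : E) :
    degHom R G (ghost R G e) = .single (-1) (toEnv R G (ghost R G e)) :=
  (exists_lift R G (isFamily_laurent R G)).choose_spec.1.2.2 e

theorem degHom_pathElem {a b : V} (α : G.Path a b) :
    degHom R G (pathElem R α) = .single (α.length : ℤ) (toEnv R G (pathElem R α)) := by
  induction α with
  | nil v => simp [pathElem, degHom_vert, Path.length]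
  | cons e h α ih =>
    rw [pathElem, map_mul, degHom_edge, ih, single_toEnv_mul, Path.length, add_comm]
    push_cast; rfl

theorem degHom_pathGhost {a b : V} (α : G.Path a b) :
    degHom R G (pathGhost R α) = .single (-α.length : ℤ) (toEnv R G (pathGhost R α)) := by
  induction α with
  | nil v => simp [pathGhost, degHom_vert, Path.length]
  | cons e h α ih =>
    rw [pathGhost, map_mul, degHom_ghost, ih, single_toEnv_mul, Path.length]
    push_cast; rw [neg_add]

theorem degHom_of_mem_component {k : ℤ} {x : LPA R G} (hx : x ∈ component R G k) :
    degHom R G x = .single k (toEnv R G x) := by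
  induction hx using Submodule.span_induction with
  | mem x hx =>
    obtain ⟨a, b, c, α, β, hk, rfl⟩ := hx
    rw [map_mul, degHom_pathElem, degHom_pathGhost, single_toEnv_mul, ← hk, sub_eq_add_neg]
  | zero => simp
  | add x y _ _ hx hy => rw [map_add, hx, hy, map_add, AddMonoidAlgebra.single_add]
  | smul r x _ hx => rw [map_smul, hx, map_smul, AddMonoidAlgebra.smul_single]

/-- The homogeneous components of an element are determined by the element: they are the
coefficients of its image in the Laurent polynomials. -/
theorem coeff_degHom_sum {f : ℤ →₀ LPA R G} (hf : ∀ k, f k ∈ component R G k) (k : ℤ) :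
    (degHom R G (f.sum fun _ y => y)).coeff k = toEnv R G (f k) := by
  classical
  simp only [Finsupp.sum, map_sum, AddMonoidAlgebra.coeff_sum, Finsupp.finsetSum_apply]
  rw [Finset.sum_congr rfl fun j _ => by rw [degHom_of_mem_component (hf j)]]
  simp only [AddMonoidAlgebra.coeff_single, Finsupp.single_apply]
  rw [Finset.sum_ite_eq']
  split_ifs with h
  · rfl
  · rw [Finsupp.notMem_support_iff.1 h, map_zero]

theorem decomposition_unique {f g : ℤ →₀ LPA R G} (hf : ∀ k, f k ∈ component R G k)
    (hg : ∀ k, g k ∈ component R G k) (h : (f.sum fun _ y => y) = g.sum fun _ y => y) :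
    f = g := by
  ext k
  apply toEnv_injective R G
  rw [← coeff_degHom_sum hf, h, coeff_degHom_sum hg]

theorem exists_decomposition (x : LPA R G) :
    ∃ f : ℤ →₀ LPA R G, (∀ k, f k ∈ component R G k) ∧ (f.sum fun _ y => y) = x :=
  (Submodule.mem_iSup_iff_exists_finsupp _ x).1 (mem_iSup_component x)

theorem isGradedIdeal_iff {I : TwoSidedIdeal (LPA R G)} : IsGradedIdeal I ↔
    ∀ f : ℤ →₀ LPA R G, (∀ k, f k ∈ component R G k) → (f.sum fun _ y => y) ∈ I →
      ∀ k, f k ∈ I := by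
  constructor
  · intro h f hf hI k
    obtain ⟨g, ⟨hg, hsum⟩, -⟩ := h _ hI
    rw [decomposition_unique hf (fun k => (hg k).2) hsum.symm]
    exact (hg k).1
  · intro h x hx
    obtain ⟨f, hf, rfl⟩ := exists_decomposition x
    exact ⟨f, ⟨fun k => ⟨h f hf hx k, hf k⟩, rfl⟩,
      fun g hg => decomposition_unique (fun k => (hg.1 k).2) hf hg.2⟩

end degree

/-! ### Local units -/

variable (R G) in
/-- The idempotent `∑ v` over a finite set of vertices. -/
noncomputable def vertSum (F : Finset V) : LPA R G := ∑ v ∈ F, vert R G v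

theorem vertSum_mul_vert {F : Finset V} {v : V} (h : v ∈ F) :
    vertSum R G F * vert R G v = vert R G v := by
  rw [vertSum, Finset.sum_mul, Finset.sum_eq_single_of_mem v h
    fun w _ hw => vert_mul_of_ne hw, vert_mul_self]

theorem vert_mul_vertSum {F : Finset V} {v : V} (h : v ∈ F) :
    vert R G v * vertSum R G F = vert R G v := by
  rw [vertSum, Finset.mul_sum, Finset.sum_eq_single_of_mem v h
    fun w _ hw => vert_mul_of_ne hw.symm, vert_mul_self]

theorem exists_local_unit (x : LPA R G) : ∃ F₀ : Finset V, ∀ F, F₀ ⊆ F →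
    vertSum R G F * x = x ∧ x * vertSum R G F = x := by
  classical
  induction x using LPA.induction with
  | hv v => exact ⟨{v}, fun F hF => ⟨vertSum_mul_vert (by simpa using hF),
      vert_mul_vertSum (by simpa using hF)⟩⟩
  | he e =>
    refine ⟨{G.src e, G.rng e}, fun F hF => ⟨?_, ?_⟩⟩
    · rw [← src_mul_edge, ← mul_assoc, vertSum_mul_vert (hF (by simp))]
    · rw [← edge_mul_rng, mul_assoc, vert_mul_vertSum (hF (by simp))]
  | hg e =>
    refine ⟨{G.src e, G.rng e}, fun F hF => ⟨?_, ?_⟩⟩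
    · rw [← rng_mul_ghost, ← mul_assoc, vertSum_mul_vert (hF (by simp))]
    · rw [← ghost_mul_src, mul_assoc, vert_mul_vertSum (hF (by simp))]
  | add x y hx hy =>
    obtain ⟨F₁, h₁⟩ := hx
    obtain ⟨F₂, h₂⟩ := hy
    refine ⟨F₁ ∪ F₂, fun F hF => ?_⟩
    have h1 := h₁ F (Finset.union_subset_left hF)
    have h2 := h₂ F (Finset.union_subset_right hF)
    rw [mul_add, add_mul, h1.1, h1.2, h2.1, h2.2]
    exact ⟨rfl, rfl⟩
  | mul x y hx hy =>
    obtain ⟨F₁, h₁⟩ := hx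
    obtain ⟨F₂, h₂⟩ := hy
    refine ⟨F₁ ∪ F₂, fun F hF => ?_⟩
    have h1 := h₁ F (Finset.union_subset_left hF)
    have h2 := h₂ F (Finset.union_subset_right hF)
    rw [← mul_assoc, h1.1, mul_assoc, h2.2]
    exact ⟨rfl, rfl⟩
  | smul r x hx =>
    obtain ⟨F₁, h₁⟩ := hx
    refine ⟨F₁, fun F hF => ?_⟩
    rw [mul_smul_comm, smul_mul_assoc, (h₁ F hF).1, (h₁ F hF).2]
    exact ⟨rfl, rfl⟩
  | zero => exact ⟨∅, fun F _ => by simp⟩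

theorem exists_common_local_unit (s : Finset (LPA R G)) :
    ∃ u : LPA R G, ∀ x ∈ s, u * x = x ∧ x * u = x := by
  classical
  choose F hF using exists_local_unit (R := R) (G := G)
  exact ⟨vertSum R G (s.biUnion F), fun x hx => hF x _ (Finset.subset_biUnion_of_mem F hx)⟩

theorem eq_zero_of_vert_mul (x : LPA R G) (h : ∀ v, vert R G v * x = 0) : x = 0 := by
  obtain ⟨F, hF⟩ := exists_local_unit x
  rw [← (hF F subset_rfl).1, vertSum, Finset.sum_mul, Finset.sum_eq_zero fun v _ => h v]

/-- Ring ideals are stable under scalars because the algebra has local units. -/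
theorem smul_mem_ideal (I : TwoSidedIdeal (LPA R G)) (r : R) {x : LPA R G} (hx : x ∈ I) :
    r • x ∈ I := by
  obtain ⟨F, hF⟩ := exists_local_unit x
  rw [← (hF F subset_rfl).1, ← smul_mul_assoc]
  exact I.mul_mem_left _ _ hx

/-- An ideal generated by elements of degree zero is graded. -/
theorem isGradedIdeal_span {s : Set (LPA R G)} (hs : s ⊆ component R G 0) :
    IsGradedIdeal (TwoSidedIdeal.span s) := by
  let J : Submodule R (LPA R G) :=
    { carrier := TwoSidedIdeal.span s
      zero_mem' := zero_mem _
      add_mem' := add_mem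
      smul_mem' := fun r x hx => smul_mem_ideal _ r hx }
  let K : Submodule R (LPA R G) := ⨆ k, component R G k ⊓ J
  have hK : ∀ {k x}, x ∈ component R G k → x ∈ TwoSidedIdeal.span s → x ∈ K := fun hx hI =>
    Submodule.mem_iSup_of_mem (p := fun k => component R G k ⊓ J) _ ⟨hx, hI⟩
  have hl : ∀ a x : LPA R G, x ∈ K → a * x ∈ K := by
    intro a x hx
    induction hx using Submodule.iSup_induction' with
    | zero => rw [mul_zero]; exact zero_mem _
    | add x y _ _ hx hy => rw [mul_add]; exact add_mem hx hy
    | mem k x hx =>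
      have ha := mem_iSup_component a
      induction ha using Submodule.iSup_induction' with
      | zero => rw [zero_mul]; exact zero_mem _
      | add a b _ _ ha hb => rw [add_mul]; exact add_mem ha hb
      | mem j a ha =>
        exact hK (mul_mem_component ha hx.1) (TwoSidedIdeal.mul_mem_left _ _ _ hx.2)
  have hr : ∀ a x : LPA R G, x ∈ K → x * a ∈ K := by
    intro a x hx
    induction hx using Submodule.iSup_induction' with
    | zero => rw [zero_mul]; exact zero_mem _
    | add x y _ _ hx hy => rw [add_mul]; exact add_mem hx hy
    | mem k x hx =>
      have ha := mem_iSup_component a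
      induction ha using Submodule.iSup_induction' with
      | zero => rw [mul_zero]; exact zero_mem _
      | add a b _ _ ha hb => rw [mul_add]; exact add_mem ha hb
      | mem j a ha =>
        exact hK (mul_mem_component hx.1 ha) (TwoSidedIdeal.mul_mem_right _ _ _ hx.2)
  have key : ∀ x ∈ TwoSidedIdeal.span s, x ∈ K := by
    intro x hx
    induction hx using TwoSidedIdeal.span_induction with
    | mem x h => exact hK (hs h) (TwoSidedIdeal.subset_span h)
    | zero => exact zero_mem _
    | add x y _ _ hx hy => exact add_mem hx hy
    | neg x _ hx => exact neg_mem hx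
    | left_absorb a x _ hx => exact hl a x hx
    | right_absorb a x _ hx => exact hr a x hx
  intro x hx
  obtain ⟨f, hf, rfl⟩ := (Submodule.mem_iSup_iff_exists_finsupp _ x).1 (key x hx)
  exact ⟨f, ⟨fun k => ⟨(hf k).2, (hf k).1⟩, rfl⟩,
    fun g hg => decomposition_unique (fun k => (hg.1 k).2) (fun k => (hf k).1) hg.2⟩

end Leavitt

/-! ### Nonvanishing of the vertices -/

namespace Leavitt

open DirGraph

variable {V : Type u} {E : Type v} {R : Type w} [CommRing R] {G : DirGraph V E}

/-- Countability is what allows each vertex to carry a copy of `ℕ` that is the disjoint union of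
the copies carried by the ranges of the edges it emits. -/
theorem exists_branching [Countable E] (G : DirGraph V E) : ∃ j : E → ℕ → ℕ,
    (∀ e f m n, G.src e = G.src f → j e m = j f n → e = f ∧ m = n) ∧
    ∀ e n, ∃ f m, G.src f = G.src e ∧ j f m = n := by
  have h : ∀ e : E, Nonempty (G.emit (G.src e) × ℕ ≃ ℕ) := fun e =>
    haveI : Nonempty (G.emit (G.src e)) := ⟨⟨e, rfl⟩⟩
    nonempty_equiv_of_countable
  have h' : ∀ v : V, ∃ φ : G.emit v × ℕ → ℕ, (G.emit v).Nonempty → Function.Bijective φ := by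
    intro v
    by_cases hv : (G.emit v).Nonempty
    · obtain ⟨e, rfl⟩ := hv
      exact ⟨(h e).some, fun _ => (h e).some.bijective⟩
    · exact ⟨fun _ => 0, fun h => absurd h hv⟩
  choose φ hφ using h'
  have hφ' : ∀ (f : E) (v : V) (hf : G.src f = v) (m : ℕ),
      φ (G.src f) (⟨f, rfl⟩, m) = φ v (⟨f, hf⟩, m) := by
    rintro f _ rfl m; rfl
  refine ⟨fun e n => φ (G.src e) (⟨e, rfl⟩, n), fun e f m n hs hj => ?_, fun e n => ?_⟩
  · have h1 := (hφ (G.src e) ⟨e, rfl⟩).1 (hj.trans (hφ' f _ hs.symm n))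
    exact ⟨congrArg Subtype.val (Prod.ext_iff.1 h1).1, (Prod.ext_iff.1 h1).2⟩
  · obtain ⟨⟨⟨f, hf⟩, m⟩, hm⟩ := (hφ (G.src e) ⟨e, rfl⟩).2 n
    exact ⟨f, m, hf, (hφ' f _ hf m).trans hm⟩

section transfer

variable {ι κ X : Type*}

variable (R) in
/-- The partial isometry of a function space that moves the values at the points of the
family `t` to the corresponding points of the family `s`. -/
noncomputable def transfer (s t : ι → X) : Module.End R (X → R) :=
  Function.ExtendByZero.linearMap R s ∘ₗ LinearMap.funLeft R R t

theorem transfer_apply (s t : ι → X) (hs : s.Injective) (f : X → R) (i : ι) :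
    transfer R s t f (s i) = f (t i) := by
  simp [transfer, LinearMap.funLeft, hs.extend_apply]

theorem transfer_apply_of_notMem (s t : ι → X) (f : X → R) {x : X} (hx : ¬ ∃ i, s i = x) :
    transfer R s t f x = 0 := by
  simp [transfer, Function.extend_apply' _ _ _ hx]

theorem transfer_mul_transfer {r s t : ι → X} (hr : r.Injective) (hs : s.Injective) :
    transfer R r s * transfer R s t = transfer R r t := by
  ext1 f
  ext x
  by_cases hx : ∃ i, r i = x
  · obtain ⟨i, rfl⟩ := hx
    simp only [Module.End.mul_apply]
    rw [transfer_apply _ _ hr, transfer_apply _ _ hs, transfer_apply _ _ hr]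
  · simp only [Module.End.mul_apply]
    rw [transfer_apply_of_notMem _ _ _ hx, transfer_apply_of_notMem _ _ _ hx]

theorem transfer_mul_transfer_eq_zero {r s : ι → X} {s' t : κ → X} (hr : r.Injective)
    (h : ∀ i k, s i ≠ s' k) : transfer R r s * transfer R s' t = 0 := by
  ext1 f
  ext x
  by_cases hx : ∃ i, r i = x
  · obtain ⟨i, rfl⟩ := hx
    simp only [Module.End.mul_apply]
    rw [transfer_apply _ _ hr, transfer_apply_of_notMem _ _ _ fun ⟨k, hk⟩ => h i k hk.symm]
    rfl
  · simp only [Module.End.mul_apply]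
    rw [transfer_apply_of_notMem _ _ _ hx]
    rfl

theorem transfer_self_mul {s : ι → X} {r t : κ → X} (hs : s.Injective)
    (h : ∀ k, ∃ i, s i = r k) : transfer R s s * transfer R r t = transfer R r t := by
  ext1 f
  ext x
  simp only [Module.End.mul_apply]
  by_cases hx : ∃ i, s i = x
  · obtain ⟨i, rfl⟩ := hx
    rw [transfer_apply _ _ hs]
  · rw [transfer_apply_of_notMem _ _ _ hx, transfer_apply_of_notMem]
    rintro ⟨k, rfl⟩
    exact hx (h k)

theorem transfer_mul_self {s : ι → X} {r t : κ → X} (hs : s.Injective) (hr : r.Injective)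
    (h : ∀ k, ∃ i, s i = t k) : transfer R r t * transfer R s s = transfer R r t := by
  ext1 f
  ext x
  simp only [Module.End.mul_apply]
  by_cases hx : ∃ i, r i = x
  · obtain ⟨i, rfl⟩ := hx
    obtain ⟨k, hk⟩ := h i
    rw [transfer_apply _ _ hr, transfer_apply _ _ hr, ← hk, transfer_apply _ _ hs]
  · rw [transfer_apply_of_notMem _ _ _ hx, transfer_apply_of_notMem _ _ _ hx]

end transfer

/-- The algebra acts on the functions on `V × ℕ`: the vertex `v` is the projection to the functions
on `{v} × ℕ`, and an edge `e` moves the copy of `ℕ` at `r(e)` into the copy at `s(e)` along the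
branching `j`. In this representation no nonzero multiple of a vertex vanishes. -/
theorem smul_vert_ne_zero [Countable E] {r : R} (hr : r ≠ 0) (v : V) :
    r • vert R G v ≠ 0 := by
  classical
  obtain ⟨j, hj, hj'⟩ := exists_branching G
  let p : V → ℕ → V × ℕ := fun v n => (v, n)
  let q : E → ℕ → V × ℕ := fun e n => (G.src e, j e n)
  have hp : ∀ v, (p v).Injective := fun v m n h => (Prod.ext_iff.1 h).2
  have hq : ∀ e, (q e).Injective := fun e m n h => (hj e e m n rfl (Prod.ext_iff.1 h).2).2
  have hfam : IsFamily G (fun v => transfer R (p v) (p v))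
      (fun e => transfer R (q e) (p (G.rng e))) (fun e => transfer R (p (G.rng e)) (q e)) := by
    constructor
    · exact fun v => transfer_mul_transfer (hp v) (hp v)
    · exact fun v v' h => transfer_mul_transfer_eq_zero (hp v)
        fun i k hik => h (Prod.ext_iff.1 hik).1
    · exact fun e => transfer_self_mul (hp _) fun k => ⟨j e k, rfl⟩
    · exact fun e => transfer_mul_transfer (hq e) (hp _)
    · exact fun e => transfer_mul_transfer (hp _) (hp _)
    · exact fun e => transfer_mul_self (hp _) (hp _) fun k => ⟨j e k, rfl⟩
    · exact fun e => transfer_mul_transfer (hp _) (hq e)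
    · exact fun e f h => transfer_mul_transfer_eq_zero (hp _) fun i k hik =>
        h (hj e f i k (Prod.ext_iff.1 hik).1 (Prod.ext_iff.1 hik).2).1
    · intro v hfin hne
      simp only [transfer_mul_transfer (hq _) (hp _)]
      ext1 f
      ext ⟨w, n⟩
      simp only [LinearMap.sum_apply, Finset.sum_apply]
      by_cases hw : v = w
      · subst hw
        obtain ⟨e, rfl⟩ := hne
        obtain ⟨g, m, hg, rfl⟩ := hj' e n
        have hgm : (G.src e, j g m) = q g m := Prod.ext hg.symm rfl
        rw [Finset.sum_eq_single g]
        · rw [show (G.src e, j g m) = p (G.src e) (j g m) from rfl, transfer_apply _ _ (hp _),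
            show p (G.src e) (j g m) = q g m from hgm, transfer_apply _ _ (hq _)]
        · intro g' _ hne
          refine transfer_apply_of_notMem _ _ _ ?_
          rintro ⟨i, hi⟩
          rw [hgm] at hi
          exact hne (hj g' g i m (Prod.ext_iff.1 hi).1 (Prod.ext_iff.1 hi).2).1
        · intro h
          exact absurd ((Set.Finite.mem_toFinset hfin).2 hg) h
      · rw [transfer_apply_of_notMem _ _ _ fun ⟨i, hi⟩ => hw (Prod.ext_iff.1 hi).1,
          Finset.sum_eq_zero]
        intro e he
        rw [Set.Finite.mem_toFinset] at he
        exact transfer_apply_of_notMem _ _ _ fun ⟨i, hi⟩ =>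
          hw ((show G.src e = v from he).symm.trans (Prod.ext_iff.1 hi).1)
  obtain ⟨φ, hφ, -⟩ := exists_lift R G hfam
  intro h
  have h1 := congrArg (fun T : Module.End R (V × ℕ → R) => T (fun _ => 1) (p v 0)) (congrArg φ h)
  simp only [map_smul, hφ.1, map_zero, LinearMap.smul_apply, Pi.smul_apply,
    transfer_apply _ _ (hp v)] at h1
  exact hr (by simpa using h1)

/-! ### Reduction of homogeneous elements to vertices -/

variable (R G) in
/-- The right ideal of sums `∑ e xₑ`. -/
noncomputable def edgeLeft : Submodule R (LPA R G) :=
  LinearMap.range (Finsupp.lsum R fun e : E => LinearMap.mulLeft R (edge R G e))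

variable (R G) in
/-- The left ideal of sums `∑ xₑ e*`. -/
noncomputable def ghostRight : Submodule R (LPA R G) :=
  LinearMap.range (Finsupp.lsum R fun e : E => LinearMap.mulRight R (ghost R G e))

theorem edge_mul_mem_edgeLeft (e : E) (x : LPA R G) : edge R G e * x ∈ edgeLeft R G :=
  ⟨Finsupp.single e x, by simp⟩

theorem mul_ghost_mem_ghostRight (e : E) (x : LPA R G) : x * ghost R G e ∈ ghostRight R G :=
  ⟨Finsupp.single e x, by simp⟩

theorem ghost_mul_lsum (e : E) (y : E →₀ LPA R G) :
    ghost R G e * Finsupp.lsum R (fun e : E => LinearMap.mulLeft R (edge R G e)) y =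
      vert R G (G.rng e) * y e := by
  simp only [Finsupp.lsum_apply, Finsupp.sum, Finset.mul_sum, LinearMap.mulLeft_apply,
    ← mul_assoc]
  by_cases he : e ∈ y.support
  · rw [Finset.sum_eq_single_of_mem e he fun f _ hf => by
      rw [ghost_mul_edge_of_ne hf.symm, zero_mul], ghost_mul_edge_self]
  · rw [Finsupp.notMem_support_iff.1 he, mul_zero]
    refine Finset.sum_eq_zero fun f hf => ?_
    rw [ghost_mul_edge_of_ne (by rintro rfl; exact he hf), zero_mul]

theorem eq_zero_of_ghost_mul {x : LPA R G} (hx : x ∈ edgeLeft R G)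
    (h : ∀ e, ghost R G e * x = 0) : x = 0 := by
  obtain ⟨y, rfl⟩ := hx
  simp only [Finsupp.lsum_apply, Finsupp.sum, LinearMap.mulLeft_apply]
  refine Finset.sum_eq_zero fun e _ => ?_
  rw [← edge_mul_rng, mul_assoc, ← ghost_mul_lsum, h, mul_zero]

theorem exists_finset_ghost_mul {x : LPA R G} (hx : x ∈ edgeLeft R G) :
    ∃ F : Finset E, ∀ e ∉ F, ghost R G e * x = 0 := by
  obtain ⟨y, rfl⟩ := hx
  refine ⟨y.support, fun e he => ?_⟩
  rw [ghost_mul_lsum, Finsupp.notMem_support_iff.1 he, mul_zero]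

theorem vert_mul_mem_edgeLeft (v : V) {x : LPA R G} (hx : x ∈ edgeLeft R G) :
    vert R G v * x ∈ edgeLeft R G := by
  obtain ⟨y, rfl⟩ := hx
  simp only [Finsupp.lsum_apply, Finsupp.sum, LinearMap.mulLeft_apply, Finset.mul_sum]
  refine sum_mem fun e _ => ?_
  by_cases h : v = G.src e
  · subst h
    rw [← mul_assoc, src_mul_edge]
    exact edge_mul_mem_edgeLeft _ _
  · rw [← mul_assoc, vert_mul_edge_of_ne h, zero_mul]
    exact zero_mem _

theorem vert_mul_eq_zero_of_emit_empty {v : V} (hv : ¬ (G.emit v).Nonempty) {x : LPA R G}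
    (hx : x ∈ edgeLeft R G) : vert R G v * x = 0 := by
  obtain ⟨y, rfl⟩ := hx
  simp only [Finsupp.lsum_apply, Finsupp.sum, LinearMap.mulLeft_apply, Finset.mul_sum]
  refine Finset.sum_eq_zero fun e _ => ?_
  rw [← mul_assoc, vert_mul_edge_of_ne (fun h => hv ⟨e, h.symm⟩), zero_mul]

theorem eq_zero_of_mul_edge {x : LPA R G} (hx : x ∈ ghostRight R G)
    (h : ∀ e, x * edge R G e = 0) : x = 0 := by
  obtain ⟨y, rfl⟩ := hx
  have key : ∀ e ∈ y.support,
      Finsupp.lsum R (fun e : E => LinearMap.mulRight R (ghost R G e)) y * edge R G e =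
        y e * vert R G (G.rng e) := by
    intro e he
    simp only [Finsupp.lsum_apply, Finsupp.sum, Finset.sum_mul, LinearMap.mulRight_apply,
      mul_assoc]
    rw [Finset.sum_eq_single_of_mem e he fun f _ hf => by
      rw [ghost_mul_edge_of_ne hf, mul_zero], ghost_mul_edge_self]
  simp only [Finsupp.lsum_apply, Finsupp.sum, LinearMap.mulRight_apply]
  refine Finset.sum_eq_zero fun e he => ?_
  rw [← rng_mul_ghost, ← mul_assoc, ← key e he, h, zero_mul]

variable (R G) in
/-- The span of the elements `αβ*` of degree `a - b` with `|α| ≤ a` and `|β| ≤ b`. -/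
noncomputable def boundedComponent (a b : ℕ) : Submodule R (LPA R G) :=
  Submodule.span R {x | ∃ (p q c : V) (α : G.Path p c) (β : G.Path q c),
    α.length ≤ a ∧ α.length + b = β.length + a ∧ x = pathElem R α * pathGhost R β}

theorem mem_boundedComponent {a b : ℕ} {p q c : V} (α : G.Path p c) (β : G.Path q c)
    (ha : α.length ≤ a) (hb : α.length + b = β.length + a) :
    pathElem R α * pathGhost R β ∈ boundedComponent R G a b :=
  Submodule.subset_span ⟨p, q, c, α, β, ha, hb, rfl⟩

theorem boundedComponent_mono {a b a' b' : ℕ} (ha : a ≤ a') (hab : a + b' = a' + b) :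
    boundedComponent R G a b ≤ boundedComponent R G a' b' := by
  refine Submodule.span_mono ?_
  rintro _ ⟨p, q, c, α, β, h1, h2, rfl⟩
  exact ⟨p, q, c, α, β, by omega, by omega, rfl⟩

theorem exists_mem_boundedComponent {k : ℤ} {x : LPA R G} (hx : x ∈ component R G k) :
    ∃ a b : ℕ, (a : ℤ) - b = k ∧ x ∈ boundedComponent R G a b := by
  induction hx using Submodule.span_induction with
  | mem x hx =>
    obtain ⟨p, q, c, α, β, hk, rfl⟩ := hx
    exact ⟨α.length, β.length, hk, mem_boundedComponent α β le_rfl (by omega)⟩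
  | zero => exact ⟨k.toNat, (-k).toNat, by omega, zero_mem _⟩
  | add x y _ _ hx hy =>
    obtain ⟨a, b, h, hx⟩ := hx
    obtain ⟨a', b', h', hy⟩ := hy
    exact ⟨a + a', b + a', by omega, add_mem
      (boundedComponent_mono (by omega) (by omega) hx)
      (boundedComponent_mono (by omega) (by omega) hy)⟩
  | smul r x _ hx =>
    obtain ⟨a, b, h, hx⟩ := hx
    exact ⟨a, b, h, Submodule.smul_mem _ r hx⟩

theorem vert_mul_mem_boundedComponent {a b : ℕ} {x : LPA R G} (v : V)
    (hx : x ∈ boundedComponent R G a b) : vert R G v * x ∈ boundedComponent R G a b := by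
  induction hx using Submodule.span_induction with
  | mem x hx =>
    obtain ⟨p, q, c, α, β, h1, h2, rfl⟩ := hx
    rw [← mul_assoc]
    by_cases h : v = p
    · subst h
      rw [vert_mul_pathElem]
      exact mem_boundedComponent α β h1 h2
    · rw [← vert_mul_pathElem, ← mul_assoc, vert_mul_of_ne h, zero_mul, zero_mul]
      exact zero_mem _
  | zero => rw [mul_zero]; exact zero_mem _
  | add x y _ _ hx hy => rw [mul_add]; exact add_mem hx hy
  | smul r x _ hx => rw [mul_smul_comm]; exact Submodule.smul_mem _ r hx

theorem ghost_mul_mem_boundedComponent {a b : ℕ} (hab : b ≤ a + 1) {x : LPA R G} (e : E)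
    (hx : x ∈ boundedComponent R G (a + 1) b) : ghost R G e * x ∈ boundedComponent R G a b := by
  induction hx using Submodule.span_induction with
  | mem x hx =>
    obtain ⟨p, q, c, α, β, h1, h2, rfl⟩ := hx
    cases α with
    | nil =>
      simp only [Path.length] at h2
      -- a vertex times `β*` with `|β| ≤ 0`, so that `β` is a vertex too
      cases β with
      | nil =>
        by_cases h : G.src e = p
        · subst h
          simpa [pathElem, pathGhost] using mem_boundedComponent (R := R) (a := a) (b := b)
            (.nil _) (.cons e rfl (.nil _)) (by simp [Path.length])
            (by simp [Path.length] at h2 ⊢; omega)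
        · simp only [pathElem, pathGhost, vert_mul_self, ghost_mul_vert_of_ne h]
          exact zero_mem _
      | cons f hf β => simp only [Path.length] at h2; omega
    | cons f h α =>
      simp only [Path.length] at h1 h2
      by_cases hef : e = f
      · subst hef
        rw [pathElem, ← mul_assoc, ← mul_assoc, ghost_mul_edge_self, vert_mul_pathElem]
        exact mem_boundedComponent α β (by omega) (by omega)
      · rw [pathElem, ← mul_assoc, ← mul_assoc, ghost_mul_edge_of_ne hef, zero_mul, zero_mul]
        exact zero_mem _
  | zero => rw [mul_zero]; exact zero_mem _
  | add x y _ _ hx hy => rw [mul_add]; exact add_mem hx hy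
  | smul r x _ hx => rw [mul_smul_comm]; exact Submodule.smul_mem _ r hx

theorem mul_edge_mem_boundedComponent {a b : ℕ} (hab : a ≤ b) {x : LPA R G} (e : E)
    (hx : x ∈ boundedComponent R G a (b + 1)) : x * edge R G e ∈ boundedComponent R G a b := by
  induction hx using Submodule.span_induction with
  | mem x hx =>
    obtain ⟨p, q, c, α, β, h1, h2, rfl⟩ := hx
    cases β with
    | nil => simp only [Path.length] at h2; omega
    | cons f h β =>
      simp only [Path.length] at h2
      by_cases hef : f = e
      · subst hef
        rw [pathGhost, mul_assoc, mul_assoc, ghost_mul_edge_self, pathGhost_mul_vert]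
        exact mem_boundedComponent α β (by omega) (by omega)
      · rw [pathGhost, mul_assoc, mul_assoc, ghost_mul_edge_of_ne hef, mul_zero, mul_zero]
        exact zero_mem _
  | zero => rw [zero_mul]; exact zero_mem _
  | add x y _ _ hx hy => rw [add_mul]; exact add_mem hx hy
  | smul r x _ hx => rw [smul_mul_assoc]; exact Submodule.smul_mem _ r hx

theorem boundedComponent_le_edgeLeft {a b : ℕ} (hab : b < a) :
    boundedComponent R G a b ≤ edgeLeft R G := by
  refine Submodule.span_le.2 ?_
  rintro _ ⟨p, q, c, α, β, h1, h2, rfl⟩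
  cases α with
  | nil => simp only [Path.length] at h2; omega
  | cons e h α =>
    rw [pathElem, mul_assoc]
    exact edge_mul_mem_edgeLeft _ _

theorem boundedComponent_le_ghostRight {a b : ℕ} (hab : a < b) :
    boundedComponent R G a b ≤ ghostRight R G := by
  refine Submodule.span_le.2 ?_
  rintro _ ⟨p, q, c, α, β, h1, h2, rfl⟩
  cases β with
  | nil => simp only [Path.length] at h2; omega
  | cons e h β =>
    rw [pathGhost, ← mul_assoc]
    exact mul_ghost_mem_ghostRight _ _

theorem boundedComponent_zero_le :
    boundedComponent R G 0 0 ≤ Submodule.span R (Set.range (vert R G)) := by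
  refine Submodule.span_le.2 ?_
  rintro _ ⟨p, q, c, α, β, h1, h2, rfl⟩
  cases α with
  | cons e h α => simp only [Path.length] at h1; omega
  | nil =>
    cases β with
    | cons e h α => simp only [Path.length] at h2; omega
    | nil => exact Submodule.subset_span ⟨p, by simp [pathElem, pathGhost]⟩

theorem boundedComponent_self_le (a : ℕ) : boundedComponent R G a a ≤
    Submodule.span R (Set.range (vert R G)) ⊔ edgeLeft R G := by
  refine Submodule.span_le.2 ?_
  rintro _ ⟨p, q, c, α, β, h1, h2, rfl⟩
  cases α with
  | nil =>
    cases β with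
    | nil =>
      exact Submodule.mem_sup_left (Submodule.subset_span ⟨p, by simp [pathElem, pathGhost]⟩)
    | cons e h β => simp only [Path.length] at h2; omega
  | cons e h α =>
    rw [pathElem, mul_assoc]
    exact Submodule.mem_sup_right (edge_mul_mem_edgeLeft _ _)

theorem exists_vert_mul_eq_smul (v : V) {x : LPA R G}
    (hx : x ∈ Submodule.span R (Set.range (vert R G))) :
    ∃ r : R, vert R G v * x = r • vert R G v := by
  induction hx using Submodule.span_induction with
  | mem x hx =>
    obtain ⟨w, rfl⟩ := hx
    by_cases h : v = w
    · subst h; exact ⟨1, by simp⟩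
    · exact ⟨0, by simp [vert_mul_of_ne h]⟩
  | zero => exact ⟨0, by simp⟩
  | add x y _ _ hx hy =>
    obtain ⟨r, hr⟩ := hx
    obtain ⟨s, hs⟩ := hy
    exact ⟨r + s, by rw [mul_add, hr, hs, add_smul]⟩
  | smul t x _ hx =>
    obtain ⟨r, hr⟩ := hx
    exact ⟨t * r, by rw [mul_smul_comm, hr, mul_smul]⟩

/-- Multiplication by suitable elements from both sides turns a nonzero homogeneous element into
a nonzero multiple of a vertex. The induction strips edges from the longer side; in degree zero,
an edge can be stripped except at a singular vertex that occurs with a nonzero coefficient, where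
the emission of no edge or of infinitely many edges isolates this coefficient. -/
theorem exists_mul_mul_eq_smul_vert_of_bounded (n : ℕ) : ∀ (a b : ℕ), a + b = n →
    ∀ x ∈ boundedComponent R G a b, x ≠ 0 →
      ∃ (μ ν : LPA R G) (r : R) (v : V), r ≠ 0 ∧ μ * x * ν = r • vert R G v := by
  induction n with
  | zero =>
    intro a b hab x hx hx0
    obtain ⟨rfl, rfl⟩ : a = 0 ∧ b = 0 := by omega
    obtain ⟨v, hv⟩ : ∃ v, vert R G v * x ≠ 0 := by
      by_contra! h; exact hx0 (eq_zero_of_vert_mul x h)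
    obtain ⟨r, hr⟩ := exists_vert_mul_eq_smul v (boundedComponent_zero_le hx)
    refine ⟨vert R G v, vert R G v, r, v, ?_, ?_⟩
    · rintro rfl; rw [hr, zero_smul] at hv; exact hv rfl
    · rw [hr, smul_mul_assoc, vert_mul_self]
  | succ n ih =>
    -- after a multiplication that keeps `x` nonzero and shortens the paths, induction applies
    have stepL : ∀ (a b : ℕ), a + 1 + b = n + 1 → b ≤ a + 1 →
        ∀ z ∈ boundedComponent R G (a + 1) b, z ∈ edgeLeft R G → z ≠ 0 →
        ∃ (μ ν : LPA R G) (r : R) (v : V), r ≠ 0 ∧ μ * z * ν = r • vert R G v := by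
      intro a b hab hba z hz hz' hz0
      obtain ⟨e, he⟩ : ∃ e, ghost R G e * z ≠ 0 := by
        by_contra! h; exact hz0 (eq_zero_of_ghost_mul hz' h)
      obtain ⟨μ, ν, r, v, hr, h⟩ := ih a b (by omega) _
        (ghost_mul_mem_boundedComponent hba e hz) he
      exact ⟨μ * ghost R G e, ν, r, v, hr, by rw [← h]; simp only [mul_assoc]⟩
    intro a b hab x hx hx0
    rcases lt_trichotomy a b with hlt | rfl | hlt
    · obtain ⟨b, rfl⟩ : ∃ c, b = c + 1 := ⟨b - 1, by omega⟩
      obtain ⟨e, he⟩ : ∃ e, x * edge R G e ≠ 0 := by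
        by_contra! h
        exact hx0 (eq_zero_of_mul_edge (boundedComponent_le_ghostRight hlt hx) h)
      obtain ⟨μ, ν, r, v, hr, h⟩ := ih a b (by omega) _
        (mul_edge_mem_boundedComponent (by omega) e hx) he
      exact ⟨μ, edge R G e * ν, r, v, hr, by rw [← h]; simp only [mul_assoc]⟩
    · obtain ⟨a, rfl⟩ : ∃ c, a = c + 1 := ⟨a - 1, by omega⟩
      obtain ⟨v, hv⟩ : ∃ v, vert R G v * x ≠ 0 := by
        by_contra! h; exact hx0 (eq_zero_of_vert_mul x h)
      obtain ⟨w, hw, y, hy, hwy⟩ := Submodule.mem_sup.1 (boundedComponent_self_le _ hx)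
      obtain ⟨r, hr⟩ := exists_vert_mul_eq_smul v hw
      have hz : vert R G v * x = r • vert R G v + vert R G v * y := by
        rw [← hwy, mul_add, hr]
      have hy' := vert_mul_mem_edgeLeft v hy
      by_cases hcase : vert R G v * x ∈ edgeLeft R G
      · obtain ⟨μ, ν, r, u, hr, h⟩ := stepL a (a + 1) (by omega) le_rfl _
          (vert_mul_mem_boundedComponent v hx) hcase hv
        exact ⟨μ * vert R G v, ν, r, u, hr, by rw [← h]; simp only [mul_assoc]⟩
      have hr0 : r ≠ 0 := by
        rintro rfl; rw [hz, zero_smul, zero_add] at hcase; exact hcase hy'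
      by_cases hne : (G.emit v).Nonempty
      · have hinf : (G.emit v).Infinite := by
          intro hfin
          apply hcase
          rw [hz]
          refine add_mem (Submodule.smul_mem _ r ?_) hy'
          rw [(lpa_isFamily R G).finite_emitter v hfin hne]
          exact sum_mem fun e _ => edge_mul_mem_edgeLeft _ _
        obtain ⟨F, hF⟩ := exists_finset_ghost_mul hy'
        obtain ⟨e, he, heF⟩ := hinf.exists_notMem_finset F
        obtain rfl : G.src e = v := he
        refine ⟨ghost R G e * vert R G (G.src e), edge R G e, r, G.rng e, hr0, ?_⟩
        rw [mul_assoc (ghost R G e), hz, mul_add, hF e heF, add_zero, mul_smul_comm,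
          ghost_mul_src, smul_mul_assoc, ghost_mul_edge_self]
      · rw [vert_mul_eq_zero_of_emit_empty hne hy, add_zero] at hz
        exact ⟨vert R G v, vert R G v, r, v, hr0, by rw [hz, smul_mul_assoc, vert_mul_self]⟩
    · obtain ⟨a, rfl⟩ : ∃ c, a = c + 1 := ⟨a - 1, by omega⟩
      exact stepL a b hab (by omega) x hx (boundedComponent_le_edgeLeft hlt hx) hx0

theorem exists_mul_mul_eq_smul_vert {k : ℤ} {x : LPA R G} (hx : x ∈ component R G k)
    (hx0 : x ≠ 0) :
    ∃ (μ ν : LPA R G) (r : R) (v : V), r ≠ 0 ∧ μ * x * ν = r • vert R G v := by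
  obtain ⟨a, b, -, h⟩ := exists_mem_boundedComponent hx
  exact exists_mul_mul_eq_smul_vert_of_bounded _ a b rfl x h hx0

/-- The graded uniqueness theorem, for ideals. -/
theorem eq_zero_of_mem_graded {I : TwoSidedIdeal (LPA R G)} (hI : IsGradedIdeal I)
    (hv : ∀ (r : R) (v : V), r ≠ 0 → r • vert R G v ∉ I) {x : LPA R G} (hx : x ∈ I) : x = 0 := by
  obtain ⟨f, hf, rfl⟩ := exists_decomposition x
  have h := isGradedIdeal_iff.1 hI f hf hx
  refine Finset.sum_eq_zero fun k _ => ?_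
  by_contra hk
  obtain ⟨μ, ν, r, v, hr, hμ⟩ := exists_mul_mul_eq_smul_vert (hf k) hk
  exact hv r v hr (hμ ▸ I.mul_mem_right _ _ (I.mul_mem_left _ _ (h k)))

/-- The graded uniqueness theorem, for homomorphisms between Leavitt path algebras. -/
theorem injective_of_graded {V' : Type*} {E' : Type*} {G' : DirGraph V' E'}
    (ψ : LPA R G →ₙₐ[R] LPA R G') (hψ : ∀ k, ∀ x ∈ component R G k, ψ x ∈ component R G' k)
    (hv : ∀ (r : R) (v : V), r ≠ 0 → r • ψ (vert R G v) ≠ 0) : Function.Injective ψ := by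
  rw [← TwoSidedIdeal.ker_eq_bot, eq_bot_iff]
  intro x hx
  refine (TwoSidedIdeal.mem_bot _).2 (eq_zero_of_mem_graded (I := TwoSidedIdeal.ker ψ) ?_ ?_ hx)
  · refine isGradedIdeal_iff.2 fun f hf hI k => ?_
    rw [TwoSidedIdeal.mem_ker] at hI ⊢
    have hI' : ((f.mapRange ψ (map_zero ψ)).sum fun _ y => y) = (0 : ℤ →₀ _).sum fun _ y => y := by
      rw [Finsupp.sum_mapRange_index (by simp), Finsupp.sum_zero_index, ← hI]
      exact (map_sum ψ _ _).symm
    have := decomposition_unique (fun k => by simpa using hψ k _ (hf k))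
      (fun k => by simp) hI'
    simpa using DFunLike.congr_fun this k
  · intro r v hr h
    rw [TwoSidedIdeal.mem_ker, map_smul] at h
    exact hv r v hr h

theorem map_mem_component {V' : Type*} {E' : Type*} {G' : DirGraph V' E'}
    (ψ : LPA R G →ₙₐ[R] LPA R G') (h0 : ∀ v, ψ (vert R G v) ∈ component R G' 0)
    (h1 : ∀ e, ψ (edge R G e) ∈ component R G' 1)
    (h2 : ∀ e, ψ (ghost R G e) ∈ component R G' (-1)) (k : ℤ) (x : LPA R G)
    (hx : x ∈ component R G k) : ψ x ∈ component R G' k := by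
  have hE : ∀ {a b : V} (α : G.Path a b), ψ (pathElem R α) ∈ component R G' α.length := by
    intro a b α
    induction α with
    | nil v => simpa [pathElem, Path.length] using h0 v
    | cons e h α ih =>
      rw [pathElem, map_mul, Path.length]
      convert mul_mem_component (h1 e) ih using 2
      push_cast; ring
  have hG : ∀ {a b : V} (α : G.Path a b), ψ (pathGhost R α) ∈ component R G' (-α.length) := by
    intro a b α
    induction α with
    | nil v => simpa [pathGhost, Path.length] using h0 v
    | cons e h α ih =>
      rw [pathGhost, map_mul, Path.length]
      convert mul_mem_component ih (h2 e) using 2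
      push_cast; ring
  induction hx using Submodule.span_induction with
  | mem x hx =>
    obtain ⟨a, b, c, α, β, hk, rfl⟩ := hx
    rw [map_mul, ← hk, sub_eq_add_neg]
    exact mul_mem_component (hE α) (hG β)
  | zero => rw [map_zero]; exact zero_mem _
  | add x y _ _ hx hy => rw [map_add]; exact add_mem hx hy
  | smul r x _ hx => rw [map_smul]; exact Submodule.smul_mem _ r hx

end Leavitt

/-! ### The quotient by the ideal of an admissible pair -/

namespace Leavitt

open DirGraph

variable {V : Type u} {E : Type v} {R : Type w} [CommRing R] {G : DirGraph V E}

section quotientModule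

variable (I : TwoSidedIdeal (LPA R G))

/-- The `R`-module structure of the quotient by a ring ideal, which exists because such an ideal
is stable under scalars. -/
noncomputable instance : SMul R I.ringCon.Quotient where
  smul r := Quotient.map' (r • ·) fun x y h => by
    have h' : x - y ∈ I := (I.rel_iff x y).1 h
    refine (I.rel_iff _ _).2 ?_
    rw [← smul_sub]
    exact smul_mem_ideal I r h'

/-- The quotient map by a ring ideal. -/
noncomputable def mkQ : LPA R G →ₙ+* I.ringCon.Quotient where
  toFun := fun x => (x : I.ringCon.Quotient)
  map_zero' := rfl
  map_add' _ _ := rfl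
  map_mul' _ _ := rfl

theorem mkQ_surjective : Function.Surjective (mkQ I) := fun x => Quotient.exists_rep x

theorem mkQ_smul (r : R) (x : LPA R G) : mkQ I (r • x) = r • mkQ I x := rfl

theorem mkQ_eq_zero {x : LPA R G} : mkQ I x = 0 ↔ x ∈ I := by
  rw [← map_zero (mkQ I)]
  exact (RingCon.eq I.ringCon).trans (I.mem_iff x).symm

noncomputable instance : Module R I.ringCon.Quotient :=
  Function.Surjective.module R (mkQ I).toAddMonoidHom (mkQ_surjective I) (mkQ_smul I)

instance : IsScalarTower R I.ringCon.Quotient I.ringCon.Quotient where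
  smul_assoc r x y := by
    obtain ⟨x, rfl⟩ := mkQ_surjective I x
    obtain ⟨y, rfl⟩ := mkQ_surjective I y
    simp only [smul_eq_mul, ← mkQ_smul, ← map_mul, smul_mul_assoc]

instance : SMulCommClass R I.ringCon.Quotient I.ringCon.Quotient where
  smul_comm r x y := by
    obtain ⟨x, rfl⟩ := mkQ_surjective I x
    obtain ⟨y, rfl⟩ := mkQ_surjective I y
    simp only [smul_eq_mul, ← mkQ_smul, ← map_mul, mul_smul_comm]

end quotientModule

variable {p : G.AdmissiblePair}

/-- The vertex of the graph that a vertex of the quotient graph lies over. -/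
def baseVertex : G.QuotVertex p → V := Sum.elim Subtype.val Subtype.val

/-- The edge of the graph that an edge of the quotient graph lies over. -/
def baseEdge : G.QuotEdge p → E := Sum.elim Subtype.val Subtype.val

theorem baseVertex_src (x : G.QuotEdge p) :
    baseVertex ((G.quotGraph p).src x) = G.src (baseEdge x) := by
  cases x <;> rfl

theorem baseVertex_rng (x : G.QuotEdge p) :
    baseVertex ((G.quotGraph p).rng x) = G.rng (baseEdge x) := by
  cases x <;> rfl

theorem src_eq_inl (x : G.QuotEdge p) : ∃ h : G.src (baseEdge x) ∉ p.H,
    (G.quotGraph p).src x = Sum.inl ⟨G.src (baseEdge x), h⟩ := by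
  cases x with
  | inl e => exact ⟨_, rfl⟩
  | inr e => exact ⟨_, rfl⟩

theorem rng_baseEdge_notMem (x : G.QuotEdge p) : G.rng (baseEdge x) ∉ p.H := by
  cases x with
  | inl e => exact e.2
  | inr e => exact e.2.1.1

theorem src_eq_inl_iff (x : G.QuotEdge p) {v : V} (hv : v ∉ p.H) :
    (G.quotGraph p).src x = Sum.inl ⟨v, hv⟩ ↔ G.src (baseEdge x) = v := by
  obtain ⟨h, h'⟩ := src_eq_inl x
  simp [h']

open scoped Classical in
/-- The finite set of edges of the quotient graph that lie over a finite set of edges. -/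
noncomputable def liftEdges (p : G.AdmissiblePair) (F : Finset E) : Finset (G.QuotEdge p) :=
  (F.subtype _).disjSum (F.subtype _)

theorem mem_liftEdges {F : Finset E} {x : G.QuotEdge p} :
    x ∈ liftEdges p F ↔ baseEdge x ∈ F := by
  cases x <;> simp [liftEdges, baseEdge]

open scoped Classical in
theorem sum_liftEdges {M : Type*} [AddCommMonoid M] (F : Finset E) (g : G.QuotEdge p → M) :
    ∑ x ∈ liftEdges p F, g x = ∑ e ∈ F,
      ((if h : G.rng e ∉ p.H then g (.inl ⟨e, h⟩) else 0) +
        (if h : G.rng e ∈ G.breaking p.H \ p.S then g (.inr ⟨e, h⟩) else 0)) := by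
  have key : ∀ (P : E → Prop) [DecidablePred P] (g : {e // P e} → M),
      ∑ x ∈ F.subtype P, g x = ∑ e ∈ F, if h : P e then g ⟨e, h⟩ else 0 := by
    intro P _ g
    rw [← Finset.sum_filter_of_ne (p := P), ← Finset.sum_subtype_eq_sum_filter]
    · exact Finset.sum_congr rfl fun x _ => by rw [dif_pos x.2]
    · intro x _ hx
      by_contra h
      exact hx (dif_neg h)
  rw [liftEdges, Finset.sum_disjSum, key, key, ← Finset.sum_add_distrib]

theorem quotVert_of_mem {v : V} (h : v ∈ G.breaking p.H \ p.S) : quotVert R p v =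
    vert R (G.quotGraph p) (.inl ⟨v, h.1.1⟩) + vert R (G.quotGraph p) (.inr ⟨v, h⟩) := by
  rw [quotVert, dif_pos h.1.1, dif_pos h]

theorem quotVert_of_notMem {v : V} (hv : v ∉ p.H) (h : v ∉ G.breaking p.H \ p.S) :
    quotVert R p v = vert R (G.quotGraph p) (.inl ⟨v, hv⟩) := by
  rw [quotVert, dif_pos hv, dif_neg h, add_zero]

theorem quotEdge_of_mem {e : E} (h : G.rng e ∈ G.breaking p.H \ p.S) : quotEdge R p e =
    edge R (G.quotGraph p) (.inl ⟨e, h.1.1⟩) + edge R (G.quotGraph p) (.inr ⟨e, h⟩) := by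
  rw [quotEdge, dif_pos h.1.1, dif_pos h]

theorem quotEdge_of_notMem {e : E} (he : G.rng e ∉ p.H) (h : G.rng e ∉ G.breaking p.H \ p.S) :
    quotEdge R p e = edge R (G.quotGraph p) (.inl ⟨e, he⟩) := by
  rw [quotEdge, dif_pos he, dif_neg h, add_zero]

theorem quotVert_mul_vert_self (y : G.QuotVertex p) :
    quotVert R p (baseVertex y) * vert R (G.quotGraph p) y = vert R (G.quotGraph p) y := by
  rcases y with ⟨v, hv⟩ | ⟨v, hv⟩
  · change quotVert R p v * _ = _
    by_cases h : v ∈ G.breaking p.H \ p.S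
    · rw [quotVert_of_mem h, add_mul, vert_mul_self, vert_mul_of_ne Sum.inr_ne_inl, add_zero]
    · rw [quotVert_of_notMem hv h, vert_mul_self]
  · change quotVert R p v * _ = _
    rw [quotVert_of_mem hv, add_mul, vert_mul_self, vert_mul_of_ne Sum.inl_ne_inr, zero_add]

theorem vert_mul_quotVert_self (y : G.QuotVertex p) :
    vert R (G.quotGraph p) y * quotVert R p (baseVertex y) = vert R (G.quotGraph p) y := by
  rcases y with ⟨v, hv⟩ | ⟨v, hv⟩
  · change _ * quotVert R p v = _
    by_cases h : v ∈ G.breaking p.H \ p.S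
    · rw [quotVert_of_mem h, mul_add, vert_mul_self, vert_mul_of_ne Sum.inl_ne_inr, add_zero]
    · rw [quotVert_of_notMem hv h, vert_mul_self]
  · change _ * quotVert R p v = _
    rw [quotVert_of_mem hv, mul_add, vert_mul_self, vert_mul_of_ne Sum.inr_ne_inl, zero_add]

theorem quotVert_induction {P : LPA R (G.quotGraph p) → Prop} (v : V) (zero : P 0)
    (add : ∀ x y, P x → P y → P (x + y))
    (h : ∀ y : G.QuotVertex p, baseVertex y = v → P (vert R _ y)) : P (quotVert R p v) := by
  refine add _ _ ?_ ?_
  all_goals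
    split
    · exact h _ rfl
    · exact zero

theorem quotEdge_induction {P : LPA R (G.quotGraph p) → Prop} (e : E) (zero : P 0)
    (add : ∀ x y, P x → P y → P (x + y))
    (h : ∀ x : G.QuotEdge p, baseEdge x = e → P (edge R _ x)) : P (quotEdge R p e) := by
  refine add _ _ ?_ ?_
  all_goals
    split
    · exact h _ rfl
    · exact zero

theorem quotGhost_induction {P : LPA R (G.quotGraph p) → Prop} (e : E) (zero : P 0)
    (add : ∀ x y, P x → P y → P (x + y))
    (h : ∀ x : G.QuotEdge p, baseEdge x = e → P (ghost R _ x)) : P (quotGhost R p e) := by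
  refine add _ _ ?_ ?_
  all_goals
    split
    · exact h _ rfl
    · exact zero

theorem quotEdge_eq_zero {e : E} (h : G.rng e ∈ p.H) : quotEdge R p e = 0 := by
  rw [quotEdge, dif_neg (not_not.2 h), dif_neg (fun h' => h'.1.1 h), add_zero]

theorem quotVert_eq_zero {v : V} (h : v ∈ p.H) : quotVert R p v = 0 := by
  rw [quotVert, dif_neg (not_not.2 h), dif_neg (fun h' => h'.1.1 h), add_zero]

theorem quotEdge_mul_quotGhost (e : E) : quotEdge R p e * quotGhost R p e =
    open scoped Classical in
    ((if h : G.rng e ∉ p.H then edge R (G.quotGraph p) (.inl ⟨e, h⟩) * ghost R _ (.inl ⟨e, h⟩)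
      else 0) + (if h : G.rng e ∈ G.breaking p.H \ p.S then
        edge R (G.quotGraph p) (.inr ⟨e, h⟩) * ghost R _ (.inr ⟨e, h⟩) else 0)) := by
  have hne : ∀ x y : G.QuotEdge p, (G.quotGraph p).rng x ≠ (G.quotGraph p).rng y →
      edge R (G.quotGraph p) x * ghost R _ y = 0 := by
    intro x y h
    rw [← rng_mul_ghost, ← mul_assoc, edge_mul_vert_of_ne h, zero_mul]
  rw [quotEdge, quotGhost]
  by_cases h : G.rng e ∉ p.H
  · by_cases h' : G.rng e ∈ G.breaking p.H \ p.S
    · simp only [dif_pos h, dif_pos h', add_mul, mul_add]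
      rw [hne (.inl _) (.inr _) Sum.inl_ne_inr, hne (.inr _) (.inl _) Sum.inr_ne_inl, add_zero,
        zero_add]
    · simp only [dif_pos h, dif_neg h', add_zero]
  · have h' : ¬ G.rng e ∈ G.breaking p.H \ p.S := fun h' => h h'.1.1
    simp only [dif_neg h, dif_neg h', add_zero, zero_mul]

theorem sum_quotEdge_mul_quotGhost (F : Finset E) :
    ∑ e ∈ F, quotEdge R p e * quotGhost R p e =
      ∑ x ∈ liftEdges p F, edge R (G.quotGraph p) x * ghost R _ x := by
  rw [sum_liftEdges]
  exact Finset.sum_congr rfl fun e _ => quotEdge_mul_quotGhost e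

/-- A vertex outside `H` that emits finitely many, but not zero, edges with range outside `H`
becomes a finite emitter in the quotient graph. -/
theorem vert_inl_eq_sum {v : V} (hv : v ∉ p.H) (F : Finset E) (hF : ∀ e ∈ F, G.src e = v)
    (hsub : ∀ e ∈ G.emitOutside p.H v, e ∈ F) (hne : (G.emitOutside p.H v).Nonempty) :
    vert R (G.quotGraph p) (.inl ⟨v, hv⟩) = ∑ e ∈ F, quotEdge R p e * quotGhost R p e := by
  have hemit : ∀ x, x ∈ (G.quotGraph p).emit (.inl ⟨v, hv⟩) ↔ x ∈ liftEdges p F := by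
    intro x
    rw [mem_liftEdges]
    refine (src_eq_inl_iff x hv).trans ⟨fun h => hsub _ ⟨h, rng_baseEdge_notMem x⟩, hF _⟩
  have hfin : ((G.quotGraph p).emit (.inl ⟨v, hv⟩)).Finite :=
    (liftEdges p F).finite_toSet.subset fun x hx => (hemit x).1 hx
  obtain ⟨e, he⟩ := hne
  rw [(lpa_isFamily R _).finite_emitter _ hfin ⟨.inl ⟨e, he.2⟩, (src_eq_inl_iff _ hv).2 he.1⟩,
    sum_quotEdge_mul_quotGhost]
  refine Finset.sum_congr (Finset.ext fun x => ?_) fun _ _ => rfl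
  rw [Set.Finite.mem_toFinset, hemit]

variable (R p) in
theorem isFamily_quot : IsFamily G (quotVert R p) (quotEdge R p) (quotGhost R p) := by
  have hadd : ∀ (a : LPA R (G.quotGraph p)) (x y), a * x = x → a * y = y →
      a * (x + y) = x + y := fun a x y hx hy => by rw [mul_add, hx, hy]
  have hadd' : ∀ (a : LPA R (G.quotGraph p)) (x y), x * a = x → y * a = y →
      (x + y) * a = x + y := fun a x y hx hy => by rw [add_mul, hx, hy]
  have hz : ∀ (a : LPA R (G.quotGraph p)) (x y), a * x = 0 → a * y = 0 →
      a * (x + y) = 0 := fun a x y hx hy => by rw [mul_add, hx, hy, add_zero]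
  have hz' : ∀ (a : LPA R (G.quotGraph p)) (x y), x * a = 0 → y * a = 0 →
      (x + y) * a = 0 := fun a x y hx hy => by rw [add_mul, hx, hy, add_zero]
  constructor
  · intro v
    refine quotVert_induction (P := fun x => quotVert R p v * x = x) v (mul_zero _) (hadd _) ?_
    rintro y rfl
    exact quotVert_mul_vert_self y
  · intro v v' h
    refine quotVert_induction (P := fun x => x * quotVert R p v' = 0) v (zero_mul _) (hz' _) ?_
    rintro y rfl
    refine quotVert_induction (P := fun x => vert R _ y * x = 0) v' (mul_zero _) (hz _) ?_
    rintro y' rfl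
    exact vert_mul_of_ne fun h' => h (congrArg baseVertex h')
  · intro e
    refine quotEdge_induction (P := fun x => quotVert R p (G.src e) * x = x) e (mul_zero _)
      (hadd _) ?_
    rintro x rfl
    rw [← src_mul_edge, ← mul_assoc, ← baseVertex_src, quotVert_mul_vert_self]
  · intro e
    refine quotEdge_induction (P := fun x => x * quotVert R p (G.rng e) = x) e (zero_mul _)
      (hadd' _) ?_
    rintro x rfl
    rw [← edge_mul_rng, mul_assoc, ← baseVertex_rng, vert_mul_quotVert_self]
  · intro e
    refine quotGhost_induction (P := fun x => quotVert R p (G.rng e) * x = x) e (mul_zero _)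
      (hadd _) ?_
    rintro x rfl
    rw [← rng_mul_ghost, ← mul_assoc, ← baseVertex_rng, quotVert_mul_vert_self]
  · intro e
    refine quotGhost_induction (P := fun x => x * quotVert R p (G.src e) = x) e (zero_mul _)
      (hadd' _) ?_
    rintro x rfl
    rw [← ghost_mul_src, mul_assoc, ← baseVertex_src, vert_mul_quotVert_self]
  · intro e
    rw [quotEdge, quotGhost, quotVert]
    by_cases h : G.rng e ∉ p.H
    · by_cases h' : G.rng e ∈ G.breaking p.H \ p.S
      · simp only [dif_pos h, dif_pos h', add_mul, mul_add, ghost_mul_edge_self]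
        rw [ghost_mul_edge_of_ne (by simp), ghost_mul_edge_of_ne (by simp), add_zero, zero_add]
        rfl
      · simp only [dif_pos h, dif_neg h', add_zero, ghost_mul_edge_self]
        rfl
    · have h' : ¬ G.rng e ∈ G.breaking p.H \ p.S := fun h' => h h'.1.1
      simp only [dif_neg h, dif_neg h', add_zero, zero_mul]
  · intro e f h
    refine quotGhost_induction (P := fun x => x * quotEdge R p f = 0) e (zero_mul _) (hz' _) ?_
    rintro x rfl
    refine quotEdge_induction (P := fun y => ghost R _ x * y = 0) f (mul_zero _) (hz _) ?_
    rintro y rfl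
    exact ghost_mul_edge_of_ne fun h' => h (congrArg baseEdge h')
  · intro v hfin hne
    by_cases hv : v ∈ p.H
    · rw [quotVert_eq_zero hv, Finset.sum_eq_zero]
      intro e he
      rw [Set.Finite.mem_toFinset] at he
      rw [quotEdge_eq_zero (p.hereditary e (by rw [show G.src e = v from he]; exact hv)), zero_mul]
    · rw [← vert_inl_eq_sum hv hfin.toFinset (fun e he => (Set.Finite.mem_toFinset hfin).1 he)
        (fun e he => (Set.Finite.mem_toFinset hfin).2 he.1), quotVert, dif_pos hv,
        dif_neg fun h => h.1.2.1 hfin, add_zero]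
      by_contra hcon
      refine hv (p.saturated v hfin hne fun e he => ?_)
      by_contra her
      exact hcon ⟨e, he, her⟩

variable (R p) in
/-- The homomorphism from the Leavitt path algebra to that of the quotient graph. -/
noncomputable def toQuot : LPA R G →ₙₐ[R] LPA R (G.quotGraph p) :=
  (exists_lift R G (isFamily_quot R p)).choose

theorem toQuot_vert (v : V) : toQuot R p (vert R G v) = quotVert R p v :=
  (exists_lift R G (isFamily_quot R p)).choose_spec.1.1 v

theorem toQuot_edge (e : E) : toQuot R p (edge R G e) = quotEdge R p e :=
  (exists_lift R G (isFamily_quot R p)).choose_spec.1.2.1 e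

theorem toQuot_ghost (e : E) : toQuot R p (ghost R G e) = quotGhost R p e :=
  (exists_lift R G (isFamily_quot R p)).choose_spec.1.2.2 e

theorem toQuot_sum {v : V} (hv : v ∈ G.breaking p.H) :
    toQuot R p (∑ e ∈ hv.2.2.2.toFinset, edge R G e * ghost R G e) =
      vert R (G.quotGraph p) (.inl ⟨v, hv.1⟩) := by
  rw [map_sum, vert_inl_eq_sum hv.1 hv.2.2.2.toFinset
    (fun e he => ((Set.Finite.mem_toFinset _).1 he).1)
    (fun e he => (Set.Finite.mem_toFinset _).2 he) hv.2.2.1]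
  exact Finset.sum_congr rfl fun e _ => by rw [map_mul, toQuot_edge, toQuot_ghost]

theorem toQuot_breakElem_of_mem {v : V} (hv : v ∈ p.S) :
    toQuot R p (breakElem R (p.subset_breaking hv)) = 0 := by
  rw [breakElem, map_sub, toQuot_sum (p.subset_breaking hv), toQuot_vert, quotVert,
    dif_pos (p.subset_breaking hv).1, dif_neg fun h => h.2 hv, add_zero, sub_self]

theorem toQuot_breakElem_of_notMem {v : V} (hv : v ∈ G.breaking p.H \ p.S) :
    toQuot R p (breakElem R hv.1) = vert R (G.quotGraph p) (.inr ⟨v, hv⟩) := by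
  rw [breakElem, map_sub, toQuot_sum hv.1, toQuot_vert, quotVert, dif_pos hv.1.1, dif_pos hv,
    add_sub_cancel_left]

theorem pairIdeal_le_ker : pairIdeal R p ≤ TwoSidedIdeal.ker (toQuot R p) := by
  refine TwoSidedIdeal.span_le.2 ?_
  rintro x (⟨v, hv, rfl⟩ | ⟨v, hv, rfl⟩)
  · exact (TwoSidedIdeal.mem_ker _).2 (by rw [toQuot_vert, quotVert_eq_zero hv])
  · exact (TwoSidedIdeal.mem_ker _).2 (toQuot_breakElem_of_mem hv)

end Leavitt

namespace Leavitt

open DirGraph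

variable {V : Type u} {E : Type v} {R : Type w} [CommRing R] {G : DirGraph V E}

/-! ### The idempotents `∑ e e*` and `v - ∑ e e*` -/

theorem sum_mul_edge {F : Finset E} {e : E} (he : e ∈ F) :
    (∑ f ∈ F, edge R G f * ghost R G f) * edge R G e = edge R G e := by
  rw [Finset.sum_mul, Finset.sum_eq_single_of_mem e he fun f _ hf => by
    rw [mul_assoc, ghost_mul_edge_of_ne hf, mul_zero], mul_assoc, ghost_mul_edge_self,
    edge_mul_rng]

theorem sum_mul_edge_of_notMem {F : Finset E} {e : E} (he : e ∉ F) :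
    (∑ f ∈ F, edge R G f * ghost R G f) * edge R G e = 0 := by
  rw [Finset.sum_mul]
  refine Finset.sum_eq_zero fun f hf => ?_
  rw [mul_assoc, ghost_mul_edge_of_ne (by rintro rfl; exact he hf), mul_zero]

theorem ghost_mul_sum {F : Finset E} {e : E} (he : e ∈ F) :
    ghost R G e * (∑ f ∈ F, edge R G f * ghost R G f) = ghost R G e := by
  rw [Finset.mul_sum, Finset.sum_eq_single_of_mem e he fun f _ hf => by
    rw [← mul_assoc, ghost_mul_edge_of_ne hf.symm, zero_mul], ← mul_assoc, ghost_mul_edge_self,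
    rng_mul_ghost]

theorem ghost_mul_sum_of_notMem {F : Finset E} {e : E} (he : e ∉ F) :
    ghost R G e * (∑ f ∈ F, edge R G f * ghost R G f) = 0 := by
  rw [Finset.mul_sum]
  refine Finset.sum_eq_zero fun f hf => ?_
  rw [← mul_assoc, ghost_mul_edge_of_ne (by rintro rfl; exact he hf), zero_mul]

theorem sum_mul_sum_self (F : Finset E) :
    (∑ f ∈ F, edge R G f * ghost R G f) * (∑ f ∈ F, edge R G f * ghost R G f) =
      ∑ f ∈ F, edge R G f * ghost R G f := by
  rw [Finset.mul_sum]
  exact Finset.sum_congr rfl fun e he => by rw [← mul_assoc, sum_mul_edge he]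

theorem vert_mul_sum {v : V} {F : Finset E} (hF : ∀ e ∈ F, G.src e = v) :
    vert R G v * (∑ f ∈ F, edge R G f * ghost R G f) = ∑ f ∈ F, edge R G f * ghost R G f := by
  rw [Finset.mul_sum]
  exact Finset.sum_congr rfl fun e he => by rw [← hF e he, ← mul_assoc, src_mul_edge]

theorem sum_mul_vert {v : V} {F : Finset E} (hF : ∀ e ∈ F, G.src e = v) :
    (∑ f ∈ F, edge R G f * ghost R G f) * vert R G v = ∑ f ∈ F, edge R G f * ghost R G f := by
  rw [Finset.sum_mul]
  exact Finset.sum_congr rfl fun e he => by rw [← hF e he, mul_assoc, ghost_mul_src]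

section breakElem

variable {H : Set V} {v : V} (hv : v ∈ G.breaking H)

theorem src_of_mem_toFinset (e : E) (he : e ∈ hv.2.2.2.toFinset) : G.src e = v :=
  ((Set.Finite.mem_toFinset _).1 he).1

theorem vert_mul_breakElem : vert R G v * breakElem R hv = breakElem R hv := by
  rw [breakElem, mul_sub, vert_mul_self, vert_mul_sum (src_of_mem_toFinset hv)]

theorem breakElem_mul_vert : breakElem R hv * vert R G v = breakElem R hv := by
  rw [breakElem, sub_mul, vert_mul_self, sum_mul_vert (src_of_mem_toFinset hv)]

theorem sum_mul_breakElem :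
    (∑ e ∈ hv.2.2.2.toFinset, edge R G e * ghost R G e) * breakElem R hv = 0 := by
  rw [breakElem, mul_sub, sum_mul_vert (src_of_mem_toFinset hv), sum_mul_sum_self, sub_self]

theorem breakElem_mul_sum :
    breakElem R hv * (∑ e ∈ hv.2.2.2.toFinset, edge R G e * ghost R G e) = 0 := by
  rw [breakElem, sub_mul, vert_mul_sum (src_of_mem_toFinset hv), sum_mul_sum_self, sub_self]

theorem breakElem_mul_self : breakElem R hv * breakElem R hv = breakElem R hv := by
  conv_lhs => enter [1]; rw [breakElem]
  rw [sub_mul, vert_mul_breakElem, sum_mul_breakElem, sub_zero]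

theorem breakElem_mul_edge {e : E} (he : G.src e = v) (hr : G.rng e ∈ H) :
    breakElem R hv * edge R G e = edge R G e := by
  rw [breakElem, sub_mul, sum_mul_edge_of_notMem fun h => ((Set.Finite.mem_toFinset _).1 h).2 hr,
    sub_zero, ← he, src_mul_edge]

theorem breakElem_mul_edge_eq_zero {e : E} (h : G.src e = v → G.rng e ∉ H) :
    breakElem R hv * edge R G e = 0 := by
  by_cases he : G.src e = v
  · rw [breakElem, sub_mul, sum_mul_edge (hv.2.2.2.mem_toFinset.2 ⟨he, h he⟩), ← he,
      src_mul_edge, sub_self]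
  · rw [← breakElem_mul_vert, mul_assoc, vert_mul_edge_of_ne (Ne.symm he), mul_zero]

theorem ghost_mul_breakElem {e : E} (he : G.src e = v) (hr : G.rng e ∈ H) :
    ghost R G e * breakElem R hv = ghost R G e := by
  rw [breakElem, mul_sub, ghost_mul_sum_of_notMem fun h => ((Set.Finite.mem_toFinset _).1 h).2 hr,
    sub_zero, ← he, ghost_mul_src]

theorem ghost_mul_breakElem_eq_zero {e : E} (h : G.src e = v → G.rng e ∉ H) :
    ghost R G e * breakElem R hv = 0 := by
  by_cases he : G.src e = v
  · rw [breakElem, mul_sub, ghost_mul_sum (hv.2.2.2.mem_toFinset.2 ⟨he, h he⟩), ← he,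
      ghost_mul_src, sub_self]
  · rw [← vert_mul_breakElem, ← mul_assoc, ghost_mul_vert_of_ne he, zero_mul]

theorem breakElem_mem_component : breakElem R hv ∈ component R G 0 := by
  refine sub_mem (vert_mem_component v) (sum_mem fun e _ => ?_)
  simpa using mul_mem_component (edge_mem_component e) (ghost_mem_component (R := R) e)

end breakElem

/-! ### The isomorphism with the algebra of the quotient graph -/

variable {p : G.AdmissiblePair}

open scoped Classical in
variable (R) in
/-- The idempotent that represents a vertex of the quotient graph: for `v ∈ B_H \ S`, the vertex
`v` is represented by `∑ e e*`, over the edges `e` from `v` with range outside `H`, and `v'` by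
`v^H`; the other vertices represent themselves. -/
noncomputable def liftVert : G.QuotVertex p → LPA R G :=
  Sum.elim (fun v => if h : v.1 ∈ G.breaking p.H \ p.S then
      ∑ e ∈ h.1.2.2.2.toFinset, edge R G e * ghost R G e else vert R G v.1)
    (fun v => breakElem R v.2.1)

theorem liftVert_inl_of_mem {v : V} (hv : v ∉ p.H) (h : v ∈ G.breaking p.H \ p.S) :
    liftVert R (p := p) (.inl ⟨v, hv⟩) = ∑ e ∈ h.1.2.2.2.toFinset, edge R G e * ghost R G e :=
  dif_pos h

theorem liftVert_inl_of_notMem {v : V} (hv : v ∉ p.H) (h : v ∉ G.breaking p.H \ p.S) :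
    liftVert R (p := p) (.inl ⟨v, hv⟩) = vert R G v :=
  dif_neg h

theorem liftVert_inr {v : V} (h : v ∈ G.breaking p.H \ p.S) :
    liftVert R (p := p) (.inr ⟨v, h⟩) = breakElem R h.1 := rfl

theorem liftVert_inl_add_liftVert_inr {v : V} (h : v ∈ G.breaking p.H \ p.S) :
    liftVert R (p := p) (.inl ⟨v, h.1.1⟩) + liftVert R (p := p) (.inr ⟨v, h⟩) = vert R G v := by
  rw [liftVert_inl_of_mem _ h, liftVert_inr, breakElem, add_sub_cancel]

theorem vert_mul_liftVert (y : G.QuotVertex p) :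
    vert R G (baseVertex y) * liftVert R y = liftVert R y := by
  rcases y with ⟨v, hv⟩ | ⟨v, hv⟩
  · change vert R G v * _ = _
    by_cases h : v ∈ G.breaking p.H \ p.S
    · rw [liftVert_inl_of_mem hv h, vert_mul_sum (src_of_mem_toFinset h.1)]
    · rw [liftVert_inl_of_notMem hv h, vert_mul_self]
  · exact vert_mul_breakElem hv.1

theorem liftVert_mul_vert (y : G.QuotVertex p) :
    liftVert R y * vert R G (baseVertex y) = liftVert R y := by
  rcases y with ⟨v, hv⟩ | ⟨v, hv⟩
  · change _ * vert R G v = _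
    by_cases h : v ∈ G.breaking p.H \ p.S
    · rw [liftVert_inl_of_mem hv h, sum_mul_vert (src_of_mem_toFinset h.1)]
    · rw [liftVert_inl_of_notMem hv h, vert_mul_self]
  · exact breakElem_mul_vert hv.1

theorem liftVert_mul_self (y : G.QuotVertex p) : liftVert R y * liftVert R y = liftVert R y := by
  rcases y with ⟨v, hv⟩ | ⟨v, hv⟩
  · by_cases h : v ∈ G.breaking p.H \ p.S
    · rw [liftVert_inl_of_mem hv h, sum_mul_sum_self]
    · rw [liftVert_inl_of_notMem hv h, vert_mul_self]
  · exact breakElem_mul_self hv.1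

theorem liftVert_mul_of_ne {y z : G.QuotVertex p} (hyz : y ≠ z) :
    liftVert R y * liftVert R z = 0 := by
  by_cases hb : baseVertex y = baseVertex z
  · rcases y with ⟨v, hv⟩ | ⟨v, hv⟩ <;> rcases z with ⟨w, hw⟩ | ⟨w, hw⟩ <;>
      obtain rfl : v = w := hb
    · exact absurd rfl hyz
    · rw [liftVert_inl_of_mem hv hw, liftVert_inr, sum_mul_breakElem]
    · rw [liftVert_inl_of_mem hw hv, liftVert_inr, breakElem_mul_sum]
    · exact absurd rfl hyz
  · rw [← liftVert_mul_vert, ← vert_mul_liftVert z, mul_assoc, ← mul_assoc (vert R G _),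
      vert_mul_of_ne hb, zero_mul, mul_zero]

theorem liftVert_src_mul_edge (x : G.QuotEdge p) :
    liftVert R ((G.quotGraph p).src x) * edge R G (baseEdge x) = edge R G (baseEdge x) := by
  obtain ⟨hs, hx⟩ := src_eq_inl x
  rw [hx]
  by_cases h : G.src (baseEdge x) ∈ G.breaking p.H \ p.S
  · rw [liftVert_inl_of_mem hs h, sum_mul_edge]
    exact (Set.Finite.mem_toFinset _).2 ⟨rfl, rng_baseEdge_notMem x⟩
  · rw [liftVert_inl_of_notMem hs h, src_mul_edge]

theorem ghost_mul_liftVert_src (x : G.QuotEdge p) :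
    ghost R G (baseEdge x) * liftVert R ((G.quotGraph p).src x) = ghost R G (baseEdge x) := by
  obtain ⟨hs, hx⟩ := src_eq_inl x
  rw [hx]
  by_cases h : G.src (baseEdge x) ∈ G.breaking p.H \ p.S
  · rw [liftVert_inl_of_mem hs h, ghost_mul_sum]
    exact (Set.Finite.mem_toFinset _).2 ⟨rfl, rng_baseEdge_notMem x⟩
  · rw [liftVert_inl_of_notMem hs h, ghost_mul_src]

theorem vert_mem_pairIdeal {v : V} (hv : v ∈ p.H) : vert R G v ∈ pairIdeal R p :=
  TwoSidedIdeal.subset_span (Or.inl ⟨v, hv, rfl⟩)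

theorem breakElem_mem_pairIdeal {v : V} (hv : v ∈ p.S) :
    breakElem R (p.subset_breaking hv) ∈ pairIdeal R p :=
  TwoSidedIdeal.subset_span (Or.inr ⟨v, hv, rfl⟩)

theorem edge_mem_pairIdeal {e : E} (he : G.rng e ∈ p.H) : edge R G e ∈ pairIdeal R p := by
  rw [← edge_mul_rng]
  exact TwoSidedIdeal.mul_mem_left _ _ _ (vert_mem_pairIdeal he)

theorem ghost_mem_pairIdeal {e : E} (he : G.rng e ∈ p.H) : ghost R G e ∈ pairIdeal R p := by
  rw [← rng_mul_ghost]
  exact TwoSidedIdeal.mul_mem_right _ _ _ (vert_mem_pairIdeal he)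

theorem mkQ_liftVert_eq_sum {v : V} (hv : v ∉ p.H) (hfin : (G.emitOutside p.H v).Finite)
    (hne : (G.emitOutside p.H v).Nonempty) :
    mkQ (pairIdeal R p) (liftVert R (.inl ⟨v, hv⟩)) =
      mkQ (pairIdeal R p) (∑ e ∈ hfin.toFinset, edge R G e * ghost R G e) := by
  by_cases h : v ∈ G.breaking p.H \ p.S
  · rw [liftVert_inl_of_mem hv h]
  rw [liftVert_inl_of_notMem hv h, ← sub_eq_zero, ← map_sub, mkQ_eq_zero]
  by_cases hinf : (G.emit v).Infinite
  · have hS : v ∈ p.S := by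
      by_contra hS
      exact h ⟨⟨hv, hinf, hne, hfin⟩, hS⟩
    exact breakElem_mem_pairIdeal hS
  · rw [Set.not_infinite] at hinf
    obtain ⟨e₀, he₀⟩ := hne
    classical
    have hsub : hfin.toFinset ⊆ hinf.toFinset := by
      intro e he
      rw [Set.Finite.mem_toFinset] at he ⊢
      exact he.1
    rw [(lpa_isFamily R G).finite_emitter v hinf ⟨e₀, he₀.1⟩, ← Finset.sum_sdiff hsub,
      add_sub_cancel_right]
    refine sum_mem fun e he => TwoSidedIdeal.mul_mem_right _ _ _ (edge_mem_pairIdeal ?_)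
    rw [Finset.mem_sdiff, Set.Finite.mem_toFinset, Set.Finite.mem_toFinset] at he
    by_contra hr
    exact he.2 ⟨he.1, hr⟩

open scoped Classical in
theorem edge_mul_sum_liftVert_mul_ghost {e : E} (he : G.rng e ∉ p.H) :
    ((if h : G.rng e ∉ p.H then edge R G e * liftVert R (p := p) (.inl ⟨G.rng e, h⟩) * ghost R G e
      else 0) + (if h : G.rng e ∈ G.breaking p.H \ p.S then
        edge R G e * liftVert R (p := p) (.inr ⟨G.rng e, h⟩) * ghost R G e else 0)) =
      edge R G e * ghost R G e := by
  rw [dif_pos he]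
  by_cases h : G.rng e ∈ G.breaking p.H \ p.S
  · rw [dif_pos h, ← add_mul, ← mul_add, liftVert_inl_add_liftVert_inr, edge_mul_rng]
  · rw [dif_neg h, add_zero, liftVert_inl_of_notMem he h, edge_mul_rng]

variable (R p) in
theorem isFamily_lift : IsFamily (G.quotGraph p)
    (fun y => mkQ (pairIdeal R p) (liftVert R y))
    (fun x => mkQ (pairIdeal R p)
      (edge R G (baseEdge x) * liftVert R ((G.quotGraph p).rng x)))
    (fun x => mkQ (pairIdeal R p)
      (liftVert R ((G.quotGraph p).rng x) * ghost R G (baseEdge x))) := by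
  constructor
  · intro y; rw [← map_mul, liftVert_mul_self]
  · intro y z h; rw [← map_mul, liftVert_mul_of_ne h, map_zero]
  · intro x; rw [← map_mul, ← mul_assoc, liftVert_src_mul_edge]
  · intro x; rw [← map_mul, mul_assoc, liftVert_mul_self]
  · intro x; rw [← map_mul, ← mul_assoc, liftVert_mul_self]
  · intro x; rw [← map_mul, mul_assoc, ghost_mul_liftVert_src]
  · intro x
    rw [← map_mul, mul_assoc, ← mul_assoc (ghost R G _), ghost_mul_edge_self, ← baseVertex_rng,
      vert_mul_liftVert, liftVert_mul_self]
  · intro x y h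
    rw [← map_mul, mul_assoc, ← mul_assoc (ghost R G _)]
    by_cases hb : baseEdge x = baseEdge y
    · rw [hb, ghost_mul_edge_self, ← baseVertex_rng, vert_mul_liftVert, liftVert_mul_of_ne,
        map_zero]
      intro hr
      apply h
      rcases x with ⟨e, he⟩ | ⟨e, he⟩ <;> rcases y with ⟨f, hf⟩ | ⟨f, hf⟩ <;>
        obtain rfl : e = f := hb
      · rfl
      · exact absurd hr Sum.inl_ne_inr
      · exact absurd hr Sum.inr_ne_inl
      · rfl
    · rw [ghost_mul_edge_of_ne hb, zero_mul, mul_zero, map_zero]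
  · intro y hfin hne
    classical
    rcases y with ⟨v, hv⟩ | ⟨v, hv⟩
    · have himg : G.emitOutside p.H v ⊆
          baseEdge '' ((G.quotGraph p).emit (.inl ⟨v, hv⟩)) := fun e he =>
        ⟨.inl ⟨e, he.2⟩, (src_eq_inl_iff _ hv).2 he.1, rfl⟩
      have hfin' : (G.emitOutside p.H v).Finite := (hfin.image _).subset himg
      have hne' : (G.emitOutside p.H v).Nonempty := by
        obtain ⟨x, hx⟩ := hne
        exact ⟨baseEdge x, (src_eq_inl_iff _ hv).1 hx, rng_baseEdge_notMem x⟩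
      have hset : hfin.toFinset = liftEdges p hfin'.toFinset := by
        ext x
        rw [Set.Finite.mem_toFinset, mem_liftEdges, Set.Finite.mem_toFinset]
        exact (src_eq_inl_iff _ hv).trans ⟨fun h => ⟨h, rng_baseEdge_notMem x⟩, fun h => h.1⟩
      rw [mkQ_liftVert_eq_sum hv hfin' hne', hset]
      simp only [← map_mul, mul_assoc]
      simp only [← mul_assoc (liftVert R _), liftVert_mul_self]
      rw [← map_sum, sum_liftEdges]
      congr 1
      refine Finset.sum_congr rfl fun e he => ?_
      rw [← edge_mul_sum_liftVert_mul_ghost ((Set.Finite.mem_toFinset _).1 he).2]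
      simp only [mul_assoc]
      rfl
    · obtain ⟨x, hx⟩ := hne
      obtain ⟨h, hs⟩ := src_eq_inl x
      exact absurd (hs.symm.trans hx) Sum.inl_ne_inr

variable (R p) in
/-- The homomorphism from the algebra of the quotient graph to the quotient algebra. -/
noncomputable def ofQuot : LPA R (G.quotGraph p) →ₙₐ[R] (pairIdeal R p).ringCon.Quotient :=
  (exists_lift R _ (isFamily_lift R p)).choose

theorem ofQuot_vert (y : G.QuotVertex p) :
    ofQuot R p (vert R _ y) = mkQ (pairIdeal R p) (liftVert R y) :=
  (exists_lift R _ (isFamily_lift R p)).choose_spec.1.1 y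

theorem ofQuot_edge (x : G.QuotEdge p) : ofQuot R p (edge R _ x) = mkQ (pairIdeal R p)
    (edge R G (baseEdge x) * liftVert R ((G.quotGraph p).rng x)) :=
  (exists_lift R _ (isFamily_lift R p)).choose_spec.1.2.1 x

theorem ofQuot_ghost (x : G.QuotEdge p) : ofQuot R p (ghost R _ x) = mkQ (pairIdeal R p)
    (liftVert R ((G.quotGraph p).rng x) * ghost R G (baseEdge x)) :=
  (exists_lift R _ (isFamily_lift R p)).choose_spec.1.2.2 x

theorem ofQuot_toQuot (x : LPA R G) :
    ofQuot R p (toQuot R p x) = mkQ (pairIdeal R p) x := by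
  induction x using LPA.induction with
  | hv v =>
    rw [toQuot_vert]
    by_cases hv : v ∈ p.H
    · rw [quotVert_eq_zero hv, map_zero, (mkQ_eq_zero _).2 (vert_mem_pairIdeal hv)]
    · by_cases h : v ∈ G.breaking p.H \ p.S
      · rw [quotVert_of_mem h, map_add, ofQuot_vert, ofQuot_vert, ← map_add,
          liftVert_inl_add_liftVert_inr]
      · rw [quotVert_of_notMem hv h, ofQuot_vert, liftVert_inl_of_notMem hv h]
  | he e =>
    rw [toQuot_edge]
    by_cases he : G.rng e ∈ p.H
    · rw [quotEdge_eq_zero he, map_zero, (mkQ_eq_zero _).2 (edge_mem_pairIdeal he)]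
    · by_cases h : G.rng e ∈ G.breaking p.H \ p.S
      · rw [quotEdge_of_mem h, map_add, ofQuot_edge, ofQuot_edge, ← map_add]
        change mkQ _ (edge R G e * liftVert R (.inl ⟨G.rng e, _⟩) +
          edge R G e * liftVert R (.inr ⟨G.rng e, _⟩)) = _
        rw [← mul_add, liftVert_inl_add_liftVert_inr, edge_mul_rng]
      · rw [quotEdge_of_notMem he h, ofQuot_edge]
        change mkQ _ (edge R G e * liftVert R (.inl ⟨G.rng e, _⟩)) = _
        rw [liftVert_inl_of_notMem he h, edge_mul_rng]
  | hg e =>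
    rw [toQuot_ghost]
    by_cases he : G.rng e ∈ p.H
    · rw [quotGhost, dif_neg (not_not.2 he), dif_neg (fun h' => h'.1.1 he), add_zero, map_zero,
        (mkQ_eq_zero _).2 (ghost_mem_pairIdeal he)]
    · by_cases h : G.rng e ∈ G.breaking p.H \ p.S
      · rw [quotGhost, dif_pos he, dif_pos h, map_add, ofQuot_ghost, ofQuot_ghost, ← map_add]
        change mkQ _ (liftVert R (.inl ⟨G.rng e, _⟩) * ghost R G e +
          liftVert R (.inr ⟨G.rng e, _⟩) * ghost R G e) = _
        rw [← add_mul, liftVert_inl_add_liftVert_inr h, rng_mul_ghost]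
      · rw [quotGhost, dif_pos he, dif_neg h, add_zero, ofQuot_ghost]
        change mkQ _ (liftVert R (.inl ⟨G.rng e, _⟩) * ghost R G e) = _
        rw [liftVert_inl_of_notMem he h, rng_mul_ghost]
  | add x y hx hy => rw [map_add, map_add, map_add, hx, hy]
  | mul x y hx hy => rw [map_mul, map_mul, map_mul, hx, hy]
  | smul r x hx => rw [map_smul, map_smul, mkQ_smul, hx]
  | zero => rw [map_zero, map_zero, map_zero]

theorem toQuot_eq_zero {x : LPA R G} : toQuot R p x = 0 ↔ x ∈ pairIdeal R p := by
  refine ⟨fun h => ?_, fun h => (TwoSidedIdeal.mem_ker _).1 (pairIdeal_le_ker h)⟩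
  rw [← mkQ_eq_zero, ← ofQuot_toQuot, h, map_zero]

theorem toQuot_liftVert (y : G.QuotVertex p) : toQuot R p (liftVert R y) = vert R _ y := by
  rcases y with ⟨v, hv⟩ | ⟨v, hv⟩
  · by_cases h : v ∈ G.breaking p.H \ p.S
    · rw [liftVert_inl_of_mem hv h, toQuot_sum h.1]
    · rw [liftVert_inl_of_notMem hv h, toQuot_vert, quotVert_of_notMem hv h]
  · exact toQuot_breakElem_of_notMem hv

theorem toQuot_edge_mul_liftVert (x : G.QuotEdge p) :
    toQuot R p (edge R G (baseEdge x) * liftVert R ((G.quotGraph p).rng x)) = edge R _ x := by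
  rw [map_mul, toQuot_liftVert, toQuot_edge]
  rcases x with ⟨e, he⟩ | ⟨e, he⟩
  · change quotEdge R p e * _ = _
    by_cases h : G.rng e ∈ G.breaking p.H \ p.S
    · rw [quotEdge_of_mem h, add_mul, edge_mul_rng, edge_mul_vert_of_ne, add_zero]
      exact Sum.inr_ne_inl
    · rw [quotEdge_of_notMem he h, edge_mul_rng]
  · change quotEdge R p e * _ = _
    rw [quotEdge_of_mem he, add_mul, edge_mul_rng, edge_mul_vert_of_ne, zero_add]
    exact Sum.inl_ne_inr

theorem toQuot_liftVert_mul_ghost (x : G.QuotEdge p) :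
    toQuot R p (liftVert R ((G.quotGraph p).rng x) * ghost R G (baseEdge x)) = ghost R _ x := by
  rw [map_mul, toQuot_liftVert, toQuot_ghost]
  rcases x with ⟨e, he⟩ | ⟨e, he⟩
  · change _ * quotGhost R p e = _
    by_cases h : G.rng e ∈ G.breaking p.H \ p.S
    · rw [quotGhost, dif_pos he, dif_pos h, mul_add, rng_mul_ghost, vert_mul_ghost_of_ne, add_zero]
      exact Sum.inl_ne_inr
    · rw [quotGhost, dif_pos he, dif_neg h, add_zero, rng_mul_ghost]
  · change _ * quotGhost R p e = _
    rw [quotGhost, dif_pos he.1.1, dif_pos he, mul_add, rng_mul_ghost, vert_mul_ghost_of_ne,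
      zero_add]
    exact Sum.inr_ne_inl

variable (R p) in
theorem toQuot_surjective : Function.Surjective (toQuot R p) := by
  intro x
  induction x using LPA.induction with
  | hv y => exact ⟨_, toQuot_liftVert y⟩
  | he x => exact ⟨_, toQuot_edge_mul_liftVert x⟩
  | hg x => exact ⟨_, toQuot_liftVert_mul_ghost x⟩
  | add x y hx hy =>
    obtain ⟨a, rfl⟩ := hx
    obtain ⟨b, rfl⟩ := hy
    exact ⟨a + b, map_add _ _ _⟩
  | mul x y hx hy =>
    obtain ⟨a, rfl⟩ := hx
    obtain ⟨b, rfl⟩ := hy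
    exact ⟨a * b, map_mul _ _ _⟩
  | smul r x hx =>
    obtain ⟨a, rfl⟩ := hx
    exact ⟨r • a, map_smul _ _ _⟩
  | zero => exact ⟨0, map_zero _⟩

variable (R p) in
/-- The canonical isomorphism of the quotient by the ideal of an admissible pair with the algebra
of the quotient graph; it is inverse to `ofQuot`. -/
theorem exists_quotEquiv : ∃ Φ : (pairIdeal R p).ringCon.Quotient ≃+* LPA R (G.quotGraph p),
    ∀ x : LPA R G, Φ (x : (pairIdeal R p).ringCon.Quotient) = toQuot R p x := by
  have hinj : Function.Injective (ofQuot R p) := by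
    rw [injective_iff_map_eq_zero]
    intro y hy
    obtain ⟨x, rfl⟩ := toQuot_surjective R p y
    rw [ofQuot_toQuot, mkQ_eq_zero] at hy
    exact toQuot_eq_zero.2 hy
  have hsurj : Function.Surjective (ofQuot R p) := by
    intro y
    obtain ⟨x, rfl⟩ := mkQ_surjective _ y
    exact ⟨_, ofQuot_toQuot x⟩
  let Ψ := RingEquiv.ofBijective (ofQuot R p) ⟨hinj, hsurj⟩
  refine ⟨Ψ.symm, fun x => ?_⟩
  rw [RingEquiv.symm_apply_eq]
  exact (ofQuot_toQuot x).symm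

end Leavitt

/-! ### Graded basic ideals -/

namespace Leavitt

open DirGraph

variable {V : Type u} {E : Type v} {R : Type w} [CommRing R] {G : DirGraph V E}

theorem rng_vert_mem_of_smul_edge_mem {I : TwoSidedIdeal (LPA R G)} {r : R} {e : E}
    (h : r • edge R G e ∈ I) : r • vert R G (G.rng e) ∈ I := by
  rw [← ghost_mul_edge_self, ← mul_smul_comm]
  exact I.mul_mem_left _ _ h

section

variable {p : G.AdmissiblePair}

theorem mem_of_smul_vert_mem [Countable E] {r : R} (hr : r ≠ 0) {v : V}
    (h : r • vert R G v ∈ pairIdeal R p) : v ∈ p.H := by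
  by_contra hv
  rw [← toQuot_eq_zero, map_smul, toQuot_vert] at h
  refine smul_vert_ne_zero (G := G.quotGraph p) hr (.inl ⟨v, hv⟩) ?_
  rw [← quotVert_mul_vert_self, ← smul_mul_assoc]
  change r • quotVert R p v * _ = 0
  rw [h, zero_mul]

theorem breakElem_mem_iff [Countable E] [Nontrivial R] {v : V} (hv : v ∈ G.breaking p.H) :
    breakElem R hv ∈ pairIdeal R p ↔ v ∈ p.S := by
  refine ⟨fun h => ?_, breakElem_mem_pairIdeal⟩
  by_contra hS
  rw [← toQuot_eq_zero, toQuot_breakElem_of_notMem ⟨hv, hS⟩] at h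
  exact smul_vert_ne_zero (R := R) one_ne_zero _ ((one_smul R _).trans h)

variable (R p) in
theorem isGradedIdeal_pairIdeal : IsGradedIdeal (pairIdeal R p) := by
  refine isGradedIdeal_span ?_
  rintro x (⟨v, hv, rfl⟩ | ⟨v, hv, rfl⟩)
  · exact vert_mem_component v
  · exact breakElem_mem_component _

variable (R p) in
theorem isBasicIdeal_pairIdeal [Countable E] : IsBasicIdeal (pairIdeal R p) := by
  refine ⟨fun r v hr h => vert_mem_pairIdeal (mem_of_smul_vert_mem hr h), ?_⟩
  intro r v F hr hF h
  by_cases hv : v ∈ p.H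
  · exact sub_mem (vert_mem_pairIdeal hv) (sum_mem fun e he => TwoSidedIdeal.mul_mem_right _ _ _
      (edge_mem_pairIdeal (p.hereditary e (by rwa [hF e he]))))
  have hsub : ∀ e ∈ G.emitOutside p.H v, e ∈ F := by
    intro e he
    by_contra heF
    refine he.2 (mem_of_smul_vert_mem hr (rng_vert_mem_of_smul_edge_mem (e := e) ?_))
    have := TwoSidedIdeal.mul_mem_right _ _ (edge R G e) h
    rwa [smul_mul_assoc, sub_mul, sum_mul_edge_of_notMem heF, sub_zero, ← he.1,
      src_mul_edge] at this
  by_cases hne : (G.emitOutside p.H v).Nonempty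
  · rw [← toQuot_eq_zero] at h ⊢
    have hq : toQuot R p (vert R G v - ∑ e ∈ F, edge R G e * ghost R G e) =
        quotVert R p v - vert R _ (.inl ⟨v, hv⟩) := by
      rw [map_sub, toQuot_vert, map_sum, vert_inl_eq_sum hv F hF hsub hne]
      simp only [map_mul, toQuot_edge, toQuot_ghost]
    by_cases hS : v ∈ G.breaking p.H \ p.S
    · rw [map_smul, hq, quotVert_of_mem hS, add_sub_cancel_left] at h
      exact absurd h (smul_vert_ne_zero hr _)
    · rw [hq, quotVert_of_notMem hv hS, sub_self]
  · have hsum : ∑ e ∈ F, edge R G e * ghost R G e ∈ pairIdeal R p := by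
      refine sum_mem fun e he => TwoSidedIdeal.mul_mem_right _ _ _ (edge_mem_pairIdeal ?_)
      by_contra her
      exact hne ⟨e, hF e he, her⟩
    refine absurd (mem_of_smul_vert_mem hr ?_) hv
    have := add_mem h (smul_mem_ideal _ r hsum)
    rwa [← smul_add, sub_add_cancel] at this

variable (G) in
theorem pairIdeal_injective [Countable E] [Nontrivial R] :
    Function.Injective (fun p : G.AdmissiblePair => pairIdeal R p) := by
  intro p q hpq
  have hmem : ∀ x, x ∈ pairIdeal R p ↔ x ∈ pairIdeal R q := fun x => by
    change pairIdeal R p = pairIdeal R q at hpq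
    rw [hpq]
  have hH : p.H = q.H := by
    have key : ∀ (p : G.AdmissiblePair) v, v ∈ p.H ↔ vert R G v ∈ pairIdeal R p := fun p v =>
      ⟨vert_mem_pairIdeal, fun h =>
        mem_of_smul_vert_mem (r := (1 : R)) one_ne_zero (by rwa [one_smul])⟩
    ext v
    rw [key, hmem, ← key]
  obtain ⟨H, S, h1, h2, h3⟩ := p
  obtain ⟨H', S', h1', h2', h3'⟩ := q
  obtain rfl : H = H' := hH
  congr
  ext v
  constructor
  · intro hv
    exact (breakElem_mem_iff (p := ⟨H, S', h1', h2', h3'⟩) (h3 hv)).1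
      ((hmem _).1 (breakElem_mem_pairIdeal (p := ⟨H, S, h1, h2, h3⟩) hv))
  · intro hv
    exact (breakElem_mem_iff (p := ⟨H, S, h1, h2, h3⟩) (h3' hv)).1
      ((hmem _).2 (breakElem_mem_pairIdeal (p := ⟨H, S', h1', h2', h3'⟩) hv))

theorem toQuot_mem_component (k : ℤ) (x : LPA R G) (hx : x ∈ component R G k) :
    toQuot R p x ∈ component R (G.quotGraph p) k := by
  refine map_mem_component _ (fun v => ?_) (fun e => ?_) (fun e => ?_) k x hx
  · rw [toQuot_vert]
    exact quotVert_induction (P := (· ∈ component R (G.quotGraph p) 0)) v (zero_mem _)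
      (fun _ _ => add_mem) fun y _ => vert_mem_component y
  · rw [toQuot_edge]
    exact quotEdge_induction (P := (· ∈ component R (G.quotGraph p) 1)) e (zero_mem _)
      (fun _ _ => add_mem) fun y _ => edge_mem_component y
  · rw [toQuot_ghost]
    exact quotGhost_induction (P := (· ∈ component R (G.quotGraph p) (-1))) e (zero_mem _)
      (fun _ _ => add_mem) fun y _ => ghost_mem_component y

end

/-- The admissible pair of an ideal: the vertices in the ideal, and the breaking vertices `v` with
`v^H` in the ideal. -/
def admissiblePairOf (I : TwoSidedIdeal (LPA R G)) : G.AdmissiblePair where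
  H := {v | vert R G v ∈ I}
  S := {v | ∃ hv : v ∈ G.breaking {v | vert R G v ∈ I}, breakElem R hv ∈ I}
  hereditary e he := by
    change vert R G (G.rng e) ∈ I
    rw [← ghost_mul_edge_self, ← ghost_mul_src]
    exact I.mul_mem_right _ _ (I.mul_mem_left _ _ he)
  saturated v hfin hne h := by
    change vert R G v ∈ I
    rw [(lpa_isFamily R G).finite_emitter v hfin hne]
    refine sum_mem fun e he => I.mul_mem_right _ _ ?_
    rw [← edge_mul_rng]
    exact I.mul_mem_left _ _ (h e ((Set.Finite.mem_toFinset _).1 he))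
  subset_breaking v hv := hv.1

theorem pairIdeal_admissiblePairOf_le (I : TwoSidedIdeal (LPA R G)) :
    pairIdeal R (admissiblePairOf I) ≤ I := by
  refine TwoSidedIdeal.span_le.2 ?_
  rintro x (⟨v, hv, rfl⟩ | ⟨v, hv, rfl⟩)
  · exact hv
  · exact hv.2

/-- A graded basic ideal is the ideal of its admissible pair `p`: modulo `I(p)`, the ideal is
graded and, being basic, contains no nonzero multiple of a vertex of the quotient graph, so that
it vanishes by the graded uniqueness theorem. -/
theorem pairIdeal_admissiblePairOf {I : TwoSidedIdeal (LPA R G)} (hI : IsGradedIdeal I)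
    (hb : IsBasicIdeal I) : pairIdeal R (admissiblePairOf I) = I := by
  refine le_antisymm (pairIdeal_admissiblePairOf_le I) fun x hx => ?_
  set p := admissiblePairOf I with hp
  let J : TwoSidedIdeal (LPA R (G.quotGraph p)) := .mk' {y | ∃ x ∈ I, toQuot R p x = y}
    ⟨0, zero_mem _, map_zero _⟩
    (by rintro _ _ ⟨x, hx, rfl⟩ ⟨y, hy, rfl⟩; exact ⟨x + y, add_mem hx hy, map_add _ _ _⟩)
    (by rintro _ ⟨x, hx, rfl⟩; exact ⟨-x, neg_mem hx, map_neg _ _⟩)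
    (by
      rintro a _ ⟨x, hx, rfl⟩
      obtain ⟨b, rfl⟩ := toQuot_surjective R p a
      exact ⟨b * x, I.mul_mem_left _ _ hx, map_mul _ _ _⟩)
    (by
      rintro _ a ⟨x, hx, rfl⟩
      obtain ⟨b, rfl⟩ := toQuot_surjective R p a
      exact ⟨x * b, I.mul_mem_right _ _ hx, map_mul _ _ _⟩)
  have hJ : ∀ y, y ∈ J ↔ ∃ x ∈ I, toQuot R p x = y := fun y => TwoSidedIdeal.mem_mk' ..
  have hker : ∀ y : LPA R G, toQuot R p y ∈ J → y ∈ I := by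
    intro y hy
    obtain ⟨z, hz, hzy⟩ := (hJ _).1 hy
    have : y - z ∈ pairIdeal R p := by rw [← toQuot_eq_zero, map_sub, hzy, sub_self]
    simpa using add_mem (pairIdeal_admissiblePairOf_le I this) hz
  have hgr : IsGradedIdeal J := by
    refine isGradedIdeal_iff.2 fun f hf hfJ k => ?_
    obtain ⟨y, hy, hyf⟩ := (hJ _).1 hfJ
    obtain ⟨g, hg, rfl⟩ := exists_decomposition y
    have hg' : f = g.mapRange (toQuot R p) (map_zero _) := by
      refine decomposition_unique hf (fun k => toQuot_mem_component k _ (hg k)) ?_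
      rw [Finsupp.sum_mapRange_index (by simp), ← hyf]
      exact map_sum _ _ _
    rw [hg', Finsupp.mapRange_apply]
    exact (hJ _).2 ⟨g k, isGradedIdeal_iff.1 hI g hg hy k, rfl⟩
  have hvert : ∀ (r : R) (y : G.QuotVertex p), r ≠ 0 → r • vert R _ y ∉ J := by
    intro r y hr h
    rw [← toQuot_liftVert, ← map_smul] at h
    replace h := hker _ h
    rcases y with ⟨v, hv⟩ | ⟨v, hv⟩
    · by_cases hS : v ∈ G.breaking p.H \ p.S
      · rw [liftVert_inl_of_mem hv hS] at h
        obtain ⟨e, he⟩ := hS.1.2.2.1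
        refine he.2 (hb.1 r _ hr (rng_vert_mem_of_smul_edge_mem ?_))
        have := I.mul_mem_right _ (edge R G e) h
        rwa [smul_mul_assoc, sum_mul_edge (hS.1.2.2.2.mem_toFinset.2 he)] at this
      · rw [liftVert_inl_of_notMem hv hS] at h
        exact hv (hb.1 r v hr h)
    · rw [liftVert_inr] at h
      exact hv.2 ⟨hv.1, hb.2 r v _ hr (src_of_mem_toFinset hv.1) h⟩
  exact toQuot_eq_zero.1 (eq_zero_of_mem_graded hgr hvert ((hJ _).2 ⟨x, hx, rfl⟩))

end Leavitt

/-! ### Modules over a ring without identity -/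

/-- The unitization `ℤ ⊕ A` of a ring `A`, with its ring structure as the only instance. -/
def Hull (A : Type*) [NonUnitalRing A] : Type _ := Unitization ℤ A

namespace Hull

variable {A B : Type*} [NonUnitalRing A] [NonUnitalRing B]

noncomputable instance : Ring (Hull A) := inferInstanceAs (Ring (Unitization ℤ A))

variable (A) in
/-- The inclusion of a ring in its unitization. -/
def inr : A →ₙ+* Hull A where
  toFun a := (a : Unitization ℤ A)
  map_zero' := Unitization.inr_zero ℤ
  map_add' := Unitization.inr_add ℤ
  map_mul' := Unitization.inr_mul ℤ

theorem exists_eq (x : Hull A) : ∃ (n : ℤ) (a : A), x = (n : Hull A) + inr A a := by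
  let y : Unitization ℤ A := x
  refine ⟨y.fst, y.snd, ?_⟩
  have h : ((y.fst : ℤ) : Unitization ℤ A) = Unitization.inl y.fst :=
    (map_intCast (Unitization.inlRingHom ℤ A) y.fst).symm
  exact (Unitization.inl_fst_add_inr_snd_eq y).symm.trans
    (congrArg (· + (y.snd : Unitization ℤ A)) h.symm)

theorem exists_lift {S : Type*} [Ring S] (ρ : A →ₙ+* S) :
    ∃ φ : Hull A →+* S, ∀ a, φ (inr A a) = ρ a := by
  let ρ' : A →ₙₐ[ℤ] S :=
    { ρ with map_smul' := fun n a => map_zsmul ρ n a }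
  exact ⟨{
    toFun := fun x => Unitization.lift (R := ℤ) ρ' x
    map_one' := (Unitization.lift (R := ℤ) ρ').map_one'
    map_mul' := (Unitization.lift (R := ℤ) ρ').map_mul'
    map_zero' := (Unitization.lift (R := ℤ) ρ').map_zero'
    map_add' := (Unitization.lift (R := ℤ) ρ').map_add' },
    fun a => DFunLike.congr_fun (Unitization.lift.symm_apply_apply ρ') a⟩

/-- The homomorphism from the unitization to a unital ring that extends a given one. -/
noncomputable def lift {S : Type*} [Ring S] (ρ : A →ₙ+* S) : Hull A →+* S :=
  (exists_lift ρ).choose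

@[simp] theorem lift_inr {S : Type*} [Ring S] (ρ : A →ₙ+* S) (a : A) : lift ρ (inr A a) = ρ a :=
  (exists_lift ρ).choose_spec a

end Hull

namespace NonUnitalMorita

section action

variable {A : Type*} [NonUnitalRing A]
variable {M : Type*} [AddCommGroup M] [Module (Hull A) M]
variable {N : Type*} [AddCommGroup N] [Module (Hull A) N]

/-- The action of an element of a ring without identity on a module over its unitization. -/
noncomputable def act (a : A) (m : M) : M := Hull.inr A a • m

@[simp] theorem act_zero (a : A) : act a (0 : M) = 0 := smul_zero (Hull.inr A a)

theorem act_add (a : A) (x y : M) : act a (x + y) = act a x + act a y :=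
  smul_add (Hull.inr A a) x y

theorem act_neg (a : A) (x : M) : act a (-x) = -act a x := smul_neg (Hull.inr A a) x

theorem act_sub (a : A) (x y : M) : act a (x - y) = act a x - act a y :=
  smul_sub (Hull.inr A a) x y

@[simp] theorem zero_act (x : M) : act (0 : A) x = 0 := by rw [act, map_zero, zero_smul]

theorem add_act (a b : A) (x : M) : act (a + b) x = act a x + act b x := by
  rw [act, map_add, add_smul]; rfl

theorem neg_act (a : A) (x : M) : act (-a) x = -act a x := by
  rw [act, map_neg, neg_smul]; rfl

theorem mul_act (a b : A) (x : M) : act (a * b) x = act a (act b x) := by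
  rw [act, map_mul, mul_smul]; rfl

theorem map_act (g : M →ₗ[Hull A] N) (a : A) (m : M) : g (act a m) = act a (g m) :=
  map_smul g _ _

/-- Additive maps that commute with the action of the ring are linear over the unitization. -/
def linearOfAct (φ : M →+ N) (h : ∀ (a : A) m, φ (act a m) = act a (φ m)) :
    M →ₗ[Hull A] N where
  toFun := φ
  map_add' := map_add φ
  map_smul' x m := by
    obtain ⟨n, a, rfl⟩ := Hull.exists_eq x
    rw [RingHom.id_apply, add_smul, add_smul, map_add, Int.cast_smul_eq_zsmul, map_zsmul,
      Int.cast_smul_eq_zsmul]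
    exact congrArg _ (h a m)

/-- Subgroups that are stable under the ring are submodules over the unitization. -/
def submoduleOfAct (S : AddSubgroup M) (h : ∀ (a : A), ∀ m ∈ S, act a m ∈ S) :
    Submodule (Hull A) M where
  carrier := S
  zero_mem' := S.zero_mem
  add_mem' := S.add_mem
  smul_mem' x m hm := by
    obtain ⟨n, a, rfl⟩ := Hull.exists_eq x
    rw [add_smul, Int.cast_smul_eq_zsmul]
    exact S.add_mem (S.zsmul_mem hm _) (h _ _ hm)

theorem act_eq_zero_of_closure {s : Set A} {m : M} (h : ∀ a ∈ s, act a m = 0) {a : A}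
    (ha : a ∈ AddSubgroup.closure s) : act a m = 0 := by
  induction ha using AddSubgroup.closure_induction with
  | mem a ha => exact h a ha
  | zero => exact zero_act m
  | add a b _ _ ha hb => rw [add_act, ha, hb, add_zero]
  | neg a _ ha => rw [neg_act, ha, neg_zero]

variable (A M) in
/-- The modules over a ring without identity that Morita equivalence is about. -/
def IsNondegenerate : Prop :=
  (∀ m : M, m ∈ AddSubgroup.closure {x : M | ∃ (a : A) (y : M), x = act a y}) ∧
    ∀ m : M, (∀ a : A, act a m = 0) → m = 0

/-- An additive, equivariant relation that is bijective on zero classes is an isomorphism. -/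
theorem nonempty_linearEquiv_of_rel (r : M → N → Prop)
    (add : ∀ m m' n n', r m n → r m' n' → r (m + m') (n + n'))
    (neg : ∀ m n, r m n → r (-m) (-n)) (smul : ∀ (a : A) m n, r m n → r (act a m) (act a n))
    (left : ∀ m, ∃ n, r m n) (right : ∀ n, ∃ m, r m n) (inj : ∀ m, r m 0 → m = 0)
    (fn : ∀ n, r 0 n → n = 0) : Nonempty (M ≃ₗ[Hull A] N) := by
  choose f hf using left
  have huniq : ∀ m n n', r m n → r m n' → n = n' := fun m n n' h h' => by
    have := add _ _ _ _ h (neg _ _ h')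
    rw [add_neg_cancel] at this
    exact add_neg_eq_zero.1 (fn _ this)
  let φ : M →+ N := AddMonoidHom.mk' f fun m m' => huniq _ _ _ (hf _) (add _ _ _ _ (hf m) (hf m'))
  refine ⟨LinearEquiv.ofBijective
    (linearOfAct φ fun a m => huniq _ _ _ (hf _) (smul a _ _ (hf m))) ⟨?_, ?_⟩⟩
  · rw [injective_iff_map_eq_zero]
    intro m hm
    refine inj m ?_
    rw [← show f m = 0 from hm]
    exact hf m
  · intro n
    obtain ⟨m, hm⟩ := right n
    exact ⟨m, huniq _ _ _ (hf m) hm⟩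

end action

/-! ### Restriction of modules to a full corner -/

/-- A homomorphism `ψ : B → A` is a full corner if it is an isomorphism onto a subring with
`ψ(B) A ψ(B) ⊆ ψ(B)` and `A = A ψ(B) A`, and if `B` has local left units. -/
structure IsFullCorner {A B : Type*} [NonUnitalRing A] [NonUnitalRing B] (ψ : B →ₙ+* A) :
    Prop where
  injective : Function.Injective ψ
  units : ∀ b b' : B, ∃ u : B, u * b = b ∧ u * b' = b'
  corner : ∀ b a b', ∃ c, ψ c = ψ b * a * ψ b'
  full : ∀ a, a ∈ AddSubgroup.closure {x | ∃ a₁ b a₂, x = a₁ * ψ b * a₂}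

section corner

variable {A B : Type*} [NonUnitalRing A] [NonUnitalRing B] {ψ : B →ₙ+* A}

/-- Over a ring with local left units, nondegeneracy means that each element of the module is
fixed by an element of the ring. -/
theorem isNondegenerate_iff (hu : ∀ b b' : B, ∃ u : B, u * b = b ∧ u * b' = b') {N : Type*}
    [AddCommGroup N] [Module (Hull B) N] :
    IsNondegenerate B N ↔ ∀ n : N, ∃ u : B, act u n = n := by
  constructor
  · intro h n
    refine AddSubgroup.closure_induction (p := fun n _ => ∃ u : B, act u n = n) ?_ ?_ ?_ ?_ (h.1 n)
    · rintro _ ⟨b, y, rfl⟩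
      obtain ⟨u, hu, -⟩ := hu b b
      exact ⟨u, by rw [← mul_act, hu]⟩
    · exact ⟨0, act_zero _⟩
    · rintro x y _ _ ⟨b, hb⟩ ⟨b', hb'⟩
      obtain ⟨u, h1, h2⟩ := hu b b'
      refine ⟨u, ?_⟩
      rw [act_add, ← hb, ← hb', ← mul_act, ← mul_act, h1, h2]
    · rintro x _ ⟨b, hb⟩
      exact ⟨b, by rw [act_neg, hb]⟩
  · intro h
    refine ⟨fun n => ?_, fun n hn => ?_⟩
    · obtain ⟨u, hu⟩ := h n
      exact AddSubgroup.subset_closure ⟨u, n, hu.symm⟩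
    · obtain ⟨u, hu⟩ := h n
      rw [← hu, hn]

section modules

variable (hψ : IsFullCorner ψ)
variable (M : Type*) [AddCommGroup M] [Module (Hull A) M]
variable (M' : Type*) [AddCommGroup M'] [Module (Hull A) M']

/-- The part `ψ(B) M` of a module: the elements that are fixed by an element of `ψ(B)`. -/
def cornerPart : AddSubgroup M where
  carrier := {m | ∃ u : B, act (ψ u) m = m}
  zero_mem' := ⟨0, act_zero _⟩
  add_mem' := by
    rintro x y ⟨b, hb⟩ ⟨b', hb'⟩
    obtain ⟨u, h1, h2⟩ := hψ.units b b'
    refine ⟨u, ?_⟩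
    rw [act_add, ← hb, ← hb', ← mul_act, ← mul_act, ← map_mul, ← map_mul, h1, h2]
  neg_mem' := by
    rintro x ⟨b, hb⟩
    exact ⟨b, by rw [act_neg, hb]⟩

variable {M M'}

theorem act_mem_cornerPart (b : B) (m : M) : act (ψ b) m ∈ cornerPart hψ M := by
  obtain ⟨u, hu, -⟩ := hψ.units b b
  exact ⟨u, by rw [← mul_act, ← map_mul, hu]⟩

variable (M) in
/-- The action of `B` on the part `ψ(B) M` of a module. -/
noncomputable def cornerAct : B →ₙ+* AddMonoid.End (cornerPart hψ M) where
  toFun b := AddMonoidHom.mk' (fun m => ⟨act (ψ b) m.1, act_mem_cornerPart hψ b m.1⟩)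
    fun x y => Subtype.ext (act_add _ _ _)
  map_zero' := by
    ext x
    change act (ψ 0) x.1 = 0
    rw [map_zero, zero_act]
  map_add' b b' := by
    ext x
    change act (ψ (b + b')) x.1 = act (ψ b) x.1 + act (ψ b') x.1
    rw [map_add, add_act]
  map_mul' b b' := by
    ext x
    change act (ψ (b * b')) x.1 = act (ψ b) (act (ψ b') x.1)
    rw [map_mul, mul_act]

noncomputable instance cornerModule : Module (Hull B) (cornerPart hψ M) :=
  Module.compHom _ (Hull.lift (cornerAct hψ M))

theorem coe_act_cornerPart (b : B) (m : cornerPart hψ M) :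
    ((act b m : cornerPart hψ M) : M) = act (ψ b) (m : M) := by
  change ((Hull.lift (cornerAct hψ M) (Hull.inr B b)) m : M) = _
  rw [Hull.lift_inr]
  rfl

variable (M) in
theorem isNondegenerate_cornerPart : IsNondegenerate B (cornerPart hψ M) := by
  refine (isNondegenerate_iff hψ.units).2 fun m => ?_
  obtain ⟨u, hu⟩ := m.2
  exact ⟨u, Subtype.ext (by rw [coe_act_cornerPart, hu])⟩

/-- The map that a homomorphism of `A`-modules induces on the parts that belong to `B`. -/
noncomputable def cornerMap (g : M →ₗ[Hull A] M') :
    cornerPart hψ M →ₗ[Hull B] cornerPart hψ M' :=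
  linearOfAct (AddMonoidHom.mk' (fun m => ⟨g m.1, by
      obtain ⟨u, hu⟩ := m.2
      exact ⟨u, by rw [← map_act, hu]⟩⟩) fun x y => Subtype.ext (map_add g _ _))
    fun b m => Subtype.ext (by
      rw [coe_act_cornerPart]
      change g (act b m : cornerPart hψ M).1 = _
      rw [coe_act_cornerPart, map_act]
      rfl)

/-- A nondegenerate module is generated by its part `ψ(B) M`, because `A = A ψ(B) A`. -/
theorem nondegenerate_induction (hM : IsNondegenerate A M) {P : M → Prop}
    (h : ∀ (a : A), ∀ m ∈ cornerPart hψ M, P (act a m)) (zero : P 0)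
    (add : ∀ x y, P x → P y → P (x + y)) (neg : ∀ x, P x → P (-x)) (m : M) : P m := by
  refine AddSubgroup.closure_induction (p := fun m _ => P m) ?_ zero
    (fun x y _ _ => add x y) (fun x _ => neg x) (hM.1 m)
  rintro _ ⟨a, y, rfl⟩
  refine AddSubgroup.closure_induction (p := fun a _ => P (act a y)) ?_ ?_ ?_ ?_ (hψ.full a)
  · rintro _ ⟨a₁, b, a₂, rfl⟩
    rw [mul_act, mul_act]
    exact h _ _ (act_mem_cornerPart hψ b _)
  · rwa [zero_act]
  · intro a b _ _ ha hb
    rw [add_act]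
    exact add _ _ ha hb
  · intro a _ ha
    rw [neg_act]
    exact neg _ ha

theorem cornerMap_injective (hM : IsNondegenerate A M) {g g' : M →ₗ[Hull A] M'}
    (h : cornerMap hψ g = cornerMap hψ g') : g = g' := by
  ext m
  induction m using nondegenerate_induction hψ hM with
  | h a m hm =>
    rw [map_act, map_act]
    exact congrArg (act a) (congrArg Subtype.val (LinearMap.congr_fun h ⟨m, hm⟩))
  | zero => rw [map_zero, map_zero]
  | add x y hx hy => rw [map_add, map_add, hx, hy]
  | neg x hx => rw [map_neg, map_neg, hx]

theorem eq_zero_of_act_corner (hψ : IsFullCorner ψ) (hM : IsNondegenerate A M) {m : M}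
    (h : ∀ (b : B) (a : A), act (ψ b * a) m = 0) : m = 0 := by
  refine hM.2 m fun a => act_eq_zero_of_closure ?_ (hψ.full a)
  rintro _ ⟨a₁, b, a₂, rfl⟩
  rw [mul_assoc, mul_act, h, act_zero]

/-- A `B`-linear map `h : ψ(B) M → ψ(B) M'` extends to an `A`-linear map by
`∑ aᵢ mᵢ ↦ ∑ aᵢ h(mᵢ)`: the image of `m` is the unique `m'` with `h (ψ(b) a m) = ψ(b) a m'` for all
`a` and `b`. -/
theorem cornerMap_surjective (hM : IsNondegenerate A M) (hM' : IsNondegenerate A M')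
    (h : cornerPart hψ M →ₗ[Hull B] cornerPart hψ M') : ∃ g, cornerMap hψ g = h := by
  have hmem : ∀ (b : B) (a : A) (m : M), act (ψ b * a) m ∈ cornerPart hψ M := fun b a m => by
    rw [mul_act]; exact act_mem_cornerPart hψ b _
  let r : M → M' → Prop := fun m m' => ∀ (b : B) (a : A),
    (h ⟨act (ψ b * a) m, hmem b a m⟩ : M') = act (ψ b * a) m'
  have hadd : ∀ m₁ m₂ n₁ n₂, r m₁ n₁ → r m₂ n₂ → r (m₁ + m₂) (n₁ + n₂) := by
    intro m₁ m₂ n₁ n₂ h₁ h₂ b a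
    rw [act_add (ψ b * a) n₁ n₂, ← h₁, ← h₂, ← AddSubgroup.coe_add, ← map_add]
    congr 2
    exact Subtype.ext (act_add _ _ _)
  have hneg : ∀ m n, r m n → r (-m) (-n) := by
    intro m n h₁ b a
    rw [act_neg (ψ b * a) n, ← h₁, ← AddSubgroup.coe_neg, ← map_neg]
    congr 2
    exact Subtype.ext (act_neg _ _)
  have hzero : r 0 0 := by
    intro b a
    have : (⟨act (ψ b * a) 0, hmem b a 0⟩ : cornerPart hψ M) = 0 := Subtype.ext (act_zero _)
    rw [this, map_zero, act_zero]
    rfl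
  have hact : ∀ (a : A) m n, r m n → r (act a m) (act a n) := by
    intro a m n h₁ b a'
    rw [← mul_act (ψ b * a') a n, mul_assoc, ← h₁]
    congr 2
    exact Subtype.ext ((mul_act (ψ b * a') a m).symm.trans (by rw [mul_assoc]))
  have hcorner : ∀ m : cornerPart hψ M, r m (h m) := by
    intro m b a
    obtain ⟨u, hu⟩ := m.2
    obtain ⟨c, hc⟩ := hψ.corner b a u
    have hum : act u m = m := Subtype.ext (by rw [coe_act_cornerPart, hu])
    have h1 : (⟨act (ψ b * a) m.1, hmem b a m.1⟩ : cornerPart hψ M) = act c m :=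
      Subtype.ext (by
        rw [coe_act_cornerPart, hc, mul_act (ψ b * a), hu])
    rw [h1, map_act, coe_act_cornerPart, hc, mul_act (ψ b * a), ← coe_act_cornerPart, ← map_act,
      hum]
  have hex : ∀ m, ∃ n, r m n := by
    intro m
    induction m using nondegenerate_induction hψ hM with
    | h a m hm => exact ⟨_, hact a _ _ (hcorner ⟨m, hm⟩)⟩
    | zero => exact ⟨0, hzero⟩
    | add x y hx hy =>
      obtain ⟨n, hn⟩ := hx
      obtain ⟨n', hn'⟩ := hy
      exact ⟨_, hadd _ _ _ _ hn hn'⟩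
    | neg x hx =>
      obtain ⟨n, hn⟩ := hx
      exact ⟨_, hneg _ _ hn⟩
  have huniq : ∀ m n n', r m n → r m n' → n = n' := by
    intro m n n' h₁ h₂
    rw [← sub_eq_zero]
    refine eq_zero_of_act_corner hψ hM' fun b a => ?_
    rw [act_sub, ← h₁ b a, ← h₂ b a, sub_self]
  choose f hf using hex
  refine ⟨linearOfAct (AddMonoidHom.mk' f fun x y =>
    huniq _ _ _ (hf _) (hadd _ _ _ _ (hf x) (hf y))) fun a m =>
      huniq _ _ _ (hf _) (hact a _ _ (hf m)), ?_⟩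
  ext m
  exact huniq _ _ _ (hf m) (hcorner m)

end modules

end corner

end NonUnitalMorita

namespace NonUnitalMorita

/-! ### Coinduction of modules from a full corner -/

section coinduction

variable {A B : Type*} [NonUnitalRing A]

/-- The families `(f b)` of additive maps `A → N` indexed by `B`. The family that corresponds to an
element `m` of an `A`-module with `ψ(B)`-part `N` is `f b a = ψ(b) a m`. -/
def Coind (A B N : Type*) [NonUnitalRing A] [AddCommGroup N] : Type _ := B → A →+ N

variable {N : Type*} [AddCommGroup N]

noncomputable instance : AddCommGroup (Coind A B N) := inferInstanceAs (AddCommGroup (B → A →+ N))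

variable (A B N) in
/-- The ring `A` acts on families of additive maps through its right multiplication. -/
noncomputable def coindAct : A →ₙ+* AddMonoid.End (Coind A B N) where
  toFun a := AddMonoidHom.mk' (fun f b => (f b).comp (AddMonoidHom.mulRight a)) fun _ _ => rfl
  map_zero' := by
    ext f
    funext b
    ext x
    change f b (x * 0) = 0
    rw [mul_zero, map_zero]
  map_add' a a' := by
    ext f
    funext b
    ext x
    change f b (x * (a + a')) = f b (x * a) + f b (x * a')
    rw [mul_add, map_add]
  map_mul' a a' := by
    ext f
    funext b
    ext x
    change f b (x * (a * a')) = f b (x * a * a')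
    rw [mul_assoc]

noncomputable instance : Module (Hull A) (Coind A B N) :=
  Module.compHom _ (Hull.lift (coindAct A B N))

theorem act_coind (a : A) (f : Coind A B N) (b : B) (x : A) : (act a f) b x = f b (x * a) := by
  change (Hull.lift (coindAct A B N) (Hull.inr A a)) f b x = _
  rw [Hull.lift_inr]
  rfl

theorem coind_add (f g : Coind A B N) (b : B) (x : A) : (f + g) b x = f b x + g b x := rfl

theorem coind_neg (f : Coind A B N) (b : B) (x : A) : (-f) b x = -f b x := rfl

variable [NonUnitalRing B] {ψ : B →ₙ+* A} (hψ : IsFullCorner ψ)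

/-- The element `ψ(b) a ψ(b')` of the corner as an element of `B`. -/
noncomputable def cornerElem (b : B) (a : A) (b' : B) : B := (hψ.corner b a b').choose

theorem map_cornerElem (b : B) (a : A) (b' : B) : ψ (cornerElem hψ b a b') = ψ b * a * ψ b' :=
  (hψ.corner b a b').choose_spec

variable [Module (Hull B) N]

/-- The family that stands for the element `a n`, where `n = b n` is an element of the `B`-module
`N`: its value at `b'` and `a'` is `ψ(b') a' a n = (ψ(b') a' a ψ(b)) n`. -/
noncomputable def coindGen (a : A) (b : B) (n : N) : Coind A B N := fun b' =>
  AddMonoidHom.mk' (fun a' => act (cornerElem hψ b' (a' * a) b) n) fun x y => by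
    rw [← add_act]
    congr 1
    apply hψ.injective
    rw [map_add, map_cornerElem, map_cornerElem, map_cornerElem, add_mul, mul_add, add_mul]

theorem coindGen_apply (a : A) (b : B) (n : N) (b' : B) (a' : A) :
    coindGen hψ a b n b' a' = act (cornerElem hψ b' (a' * a) b) n := rfl

theorem act_coindGen (c a : A) (b : B) (n : N) :
    act c (coindGen hψ a b n) = coindGen hψ (c * a) b n := by
  funext b'
  ext x
  rw [act_coind, coindGen_apply, coindGen_apply, mul_assoc]

theorem coindGen_add (a a' : A) (b : B) (n : N) :
    coindGen hψ (a + a') b n = coindGen hψ a b n + coindGen hψ a' b n := by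
  funext b'
  ext x
  rw [coind_add, coindGen_apply, coindGen_apply, coindGen_apply, ← add_act]
  congr 1
  apply hψ.injective
  rw [map_add, map_cornerElem, map_cornerElem, map_cornerElem, mul_add, mul_add, add_mul]

theorem coindGen_zero (b : B) (n : N) : coindGen hψ 0 b n = 0 := by
  have := coindGen_add hψ 0 0 b n
  rwa [add_zero, left_eq_add] at this

theorem coindGen_neg (a : A) (b : B) (n : N) :
    coindGen hψ (-a) b n = -coindGen hψ a b n := by
  rw [eq_neg_iff_add_eq_zero, ← coindGen_add, neg_add_cancel, coindGen_zero]

variable (N) in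
/-- The `A`-module induced from a `B`-module `N`. It plays the role of `A ⊗_B N`, and is realized
inside the coinduced module so that it is torsion free. -/
noncomputable def induced : Submodule (Hull A) (Coind A B N) :=
  submoduleOfAct (AddSubgroup.closure {f | ∃ a b n, f = coindGen hψ a b n}) fun c f hf => by
    induction hf using AddSubgroup.closure_induction with
    | mem f hf =>
      obtain ⟨a, b, n, rfl⟩ := hf
      exact AddSubgroup.subset_closure ⟨c * a, b, n, act_coindGen hψ c a b n⟩
    | zero => rw [act_zero]; exact zero_mem _
    | add f g _ _ hf hg => rw [act_add]; exact add_mem hf hg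
    | neg f _ hf => rw [act_neg]; exact neg_mem hf

theorem coindGen_mem_induced (a : A) (b : B) (n : N) : coindGen hψ a b n ∈ induced N hψ :=
  AddSubgroup.subset_closure ⟨a, b, n, rfl⟩

theorem induced_induction {P : (f : Coind A B N) → f ∈ induced N hψ → Prop}
    (gen : ∀ a b n, P (coindGen hψ a b n) (coindGen_mem_induced hψ a b n))
    (zero : P 0 (zero_mem _)) (add : ∀ x y hx hy, P x hx → P y hy → P (x + y) (add_mem hx hy))
    (neg : ∀ x hx, P x hx → P (-x) (neg_mem hx)) {f : Coind A B N} (hf : f ∈ induced N hψ) :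
    P f hf := by
  refine AddSubgroup.closure_induction (p := P) ?_ zero add neg hf
  rintro _ ⟨a, b, n, rfl⟩
  exact gen a b n

/-- The values of an element of the induced module depend only on the product `ψ(b) a`. -/
theorem induced_apply_congr {f : Coind A B N} (hf : f ∈ induced N hψ) {b₁ b₂ : B} {a₁ a₂ : A}
    (h : ψ b₁ * a₁ = ψ b₂ * a₂) : f b₁ a₁ = f b₂ a₂ := by
  induction hf using induced_induction hψ with
  | gen a b n =>
    rw [coindGen_apply, coindGen_apply]
    congr 1
    apply hψ.injective
    rw [map_cornerElem, map_cornerElem, ← mul_assoc, ← mul_assoc, h]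
  | zero => rfl
  | add x y _ _ hx hy => rw [coind_add, coind_add, hx, hy]
  | neg x _ hx => rw [coind_neg, coind_neg, hx]

theorem coe_act_induced (a : A) (f : induced N hψ) :
    ((act a f : induced N hψ) : Coind A B N) = act a (f : Coind A B N) := rfl

variable (N) in
theorem isNondegenerate_induced : IsNondegenerate A (induced N hψ) := by
  constructor
  · rintro ⟨f, hf⟩
    suffices h : f ∈ (AddSubgroup.closure
        {x : induced N hψ | ∃ (a : A) (y : induced N hψ), x = act a y}).map
          (induced N hψ).subtype.toAddMonoidHom by
      obtain ⟨g, hg, rfl⟩ := h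
      exact hg
    induction hf using induced_induction hψ with
    | gen a b n =>
      refine AddSubgroup.closure_induction (p := fun a _ => coindGen hψ a b n ∈ _) ?_ ?_ ?_ ?_
        (hψ.full a)
      · rintro _ ⟨a₁, b₀, a₂, rfl⟩
        refine ⟨act a₁ ⟨_, coindGen_mem_induced hψ (ψ b₀ * a₂) b n⟩,
          AddSubgroup.subset_closure ⟨_, _, rfl⟩, ?_⟩
        rw [mul_assoc]
        exact act_coindGen hψ _ _ b n
      · rw [coindGen_zero]
        exact zero_mem _
      · intro x y _ _ hx hy
        rw [coindGen_add]
        exact add_mem hx hy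
      · intro x _ hx
        rw [coindGen_neg]
        exact neg_mem hx
    | zero => exact zero_mem _
    | add x y _ _ hx hy => exact add_mem hx hy
    | neg x _ hx => exact neg_mem hx
  · rintro ⟨f, hf⟩ h
    have h' : ∀ a b x, f b (x * a) = 0 := fun a b x => by
      have := congrArg (fun g : induced N hψ => (g : Coind A B N) b x) (h a)
      rwa [coe_act_induced, act_coind] at this
    refine Subtype.ext (funext fun b => AddMonoidHom.ext fun x => ?_)
    change f b x = 0
    refine AddSubgroup.closure_induction (p := fun x _ => f b x = 0) ?_ (map_zero _) ?_ ?_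
      (hψ.full x)
    · rintro _ ⟨a₁, b₀, a₂, rfl⟩
      exact h' a₂ b _
    · intro x y _ _ hx hy
      rw [map_add, hx, hy, add_zero]
    · intro x _ hx
      rw [map_neg, hx, neg_zero]

/-- The `ψ(B)`-part of the induced module is the module one started from: the family `f` belongs
to `n` if `f b ψ(b') = b b' n`. -/
theorem nonempty_cornerPart_induced (hN : IsNondegenerate B N) :
    Nonempty (cornerPart hψ (induced N hψ) ≃ₗ[Hull B] N) := by
  rw [isNondegenerate_iff hψ.units] at hN
  have hfix : ∀ (f : induced N hψ) (u : B), act (ψ u) f = f → ∀ b x,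
      (f : Coind A B N) b x = (f : Coind A B N) b (x * ψ u) := fun f u hu b x => by
    rw [← act_coind, ← coe_act_induced, hu]
  refine nonempty_linearEquiv_of_rel
    (fun f n => ∀ b b' : B, (f : induced N hψ).1 b (ψ b') = act (b * b') n) ?_ ?_ ?_ ?_ ?_ ?_ ?_
  · intro f f' n n' h h' b b'
    rw [act_add, ← h, ← h']
    rfl
  · intro f n h b b'
    rw [act_neg, ← h]
    rfl
  · intro c f n h b b'
    rw [← mul_act, mul_assoc, ← h, map_mul, coe_act_cornerPart, coe_act_induced, act_coind]
  · rintro ⟨f, u, hu⟩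
    have key : ∃ n : N, ∀ b b' : B, (f : Coind A B N) b (ψ b' * ψ u) = act (b * b') n := by
      obtain ⟨f, hf⟩ := f
      clear hu
      change ∃ n : N, ∀ b b' : B, f b (ψ b' * ψ u) = act (b * b') n
      induction hf using induced_induction hψ with
      | gen a b₀ n₀ =>
        refine ⟨act (cornerElem hψ u a b₀) n₀, fun b b' => ?_⟩
        rw [coindGen_apply, ← mul_act]
        congr 1
        apply hψ.injective
        simp only [map_cornerElem, map_mul, mul_assoc]
      | zero => exact ⟨0, fun b b' => (act_zero _).symm⟩
      | add x y _ _ hx hy =>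
        obtain ⟨n, hn⟩ := hx
        obtain ⟨n', hn'⟩ := hy
        exact ⟨n + n', fun b b' => by rw [act_add, ← hn, ← hn', coind_add]⟩
      | neg x _ hx =>
        obtain ⟨n, hn⟩ := hx
        exact ⟨-n, fun b b' => by rw [act_neg, ← hn, coind_neg]⟩
    obtain ⟨n, hn⟩ := key
    exact ⟨n, fun b b' => (hfix f u hu b (ψ b')).trans (hn b b')⟩
  · intro n
    obtain ⟨u, hu⟩ := hN n
    obtain ⟨w, hw, -⟩ := hψ.units u u
    refine ⟨⟨⟨_, coindGen_mem_induced hψ (ψ u) u n⟩, w, Subtype.ext ?_⟩, fun b b' => ?_⟩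
    · rw [coe_act_induced, act_coindGen, ← map_mul, hw]
    · change coindGen hψ (ψ u) u n b (ψ b') = _
      have : cornerElem hψ b (ψ b' * ψ u) u = b * b' * u * u := by
        apply hψ.injective
        simp only [map_cornerElem, map_mul, mul_assoc]
      rw [coindGen_apply, this, mul_act _ u, hu, mul_act _ u, hu]
  · rintro ⟨f, u, hu⟩ h
    refine Subtype.ext (Subtype.ext (funext fun b => AddMonoidHom.ext fun a => ?_))
    obtain ⟨w, hw, -⟩ := hψ.units (cornerElem hψ b a u) (cornerElem hψ b a u)
    refine (hfix f u hu b a).trans ?_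
    have : ψ b * (a * ψ u) = ψ w * ψ (cornerElem hψ b a u) := by
      rw [← map_mul, hw, map_cornerElem, mul_assoc]
    rw [induced_apply_congr hψ f.2 this]
    exact (h w _).trans (act_zero _)
  · intro n h
    obtain ⟨u, hu⟩ := hN n
    obtain ⟨w, hw, -⟩ := hψ.units u u
    have := h w u
    rw [hw, hu] at this
    exact this.symm

end coinduction

/-! ### The equivalence of categories -/

section category

universe t

open CategoryTheory

variable {A B : Type t} [NonUnitalRing A] [NonUnitalRing B] {ψ : B →ₙ+* A}

/-- The nondegenerate modules over a ring, as a property of the modules over its unitization. -/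
def nondegenerateObj (A : Type t) [NonUnitalRing A] : ObjectProperty (ModuleCat.{t} (Hull A)) :=
  fun M => IsNondegenerate A M

/-- The functor `M ↦ ψ(B) M` from nondegenerate `A`-modules to nondegenerate `B`-modules. -/
noncomputable def cornerFunctor (hψ : IsFullCorner ψ) :
    (nondegenerateObj A).FullSubcategory ⥤ (nondegenerateObj B).FullSubcategory where
  obj M := ⟨ModuleCat.of (Hull B) (cornerPart hψ M.obj), isNondegenerate_cornerPart hψ M.obj⟩
  map g := ObjectProperty.homMk (ModuleCat.ofHom (cornerMap hψ g.hom.hom))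
  map_id _ := rfl
  map_comp _ _ := rfl

instance (hψ : IsFullCorner ψ) : (cornerFunctor hψ).Additive where
  map_add := rfl

instance (hψ : IsFullCorner ψ) : (cornerFunctor hψ).Faithful where
  map_injective {M _} g g' h := by
    have : cornerMap hψ g.hom.hom = cornerMap hψ g'.hom.hom :=
      congrArg (fun k => k.hom.hom) h
    exact ObjectProperty.hom_ext _ (ModuleCat.hom_ext (cornerMap_injective hψ M.property this))

instance (hψ : IsFullCorner ψ) : (cornerFunctor hψ).Full where
  map_surjective {M M'} h := by
    obtain ⟨g, hg⟩ := cornerMap_surjective hψ M.property M'.property h.hom.hom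
    exact ⟨ObjectProperty.homMk (ModuleCat.ofHom g),
      ObjectProperty.hom_ext _ (ModuleCat.hom_ext hg)⟩

instance (hψ : IsFullCorner ψ) : (cornerFunctor hψ).EssSurj where
  mem_essImage N := by
    obtain ⟨e⟩ := nonempty_cornerPart_induced hψ N.property
    exact ⟨⟨ModuleCat.of (Hull A) (induced N.obj hψ), isNondegenerate_induced N.obj hψ⟩,
      ⟨(nondegenerateObj B).isoMk e.toModuleIso⟩⟩

/-- A ring is Morita equivalent to each of its full corners. -/
theorem IsFullCorner.moritaEquivalent (hψ : IsFullCorner ψ) : RingsMoritaEquivalent A B := by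
  have : (cornerFunctor hψ).IsEquivalence := {}
  exact ⟨(cornerFunctor hψ).asEquivalence, inferInstanceAs (cornerFunctor hψ).Additive⟩

end category

end NonUnitalMorita

namespace Leavitt

open DirGraph NonUnitalMorita

/-! ### Corners of the Leavitt path algebra -/

section corner

variable {V V' : Type u} {E E' : Type v} {R : Type w} [CommRing R]
variable {F : DirGraph V' E'} {G : DirGraph V E}

/-- If the image of `ψ : L_R(F) → L_R(E)` is the corner that is cut out by the idempotents `ψ(v)`,
then `L_R(F)` is Morita equivalent to the ideal that these idempotents generate. -/
theorem moritaEquivalent_of_range (ψ : LPA R F →ₙₐ[R] LPA R G) (hψ : Function.Injective ψ)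
    (hl : ∀ v {a b : V} (α : G.Path a b), ψ (vert R F v) * pathElem R α ∈ NonUnitalAlgHom.range ψ)
    (hr : ∀ v {a b : V} (α : G.Path a b),
      pathGhost R α * ψ (vert R F v) ∈ NonUnitalAlgHom.range ψ) :
    RingsMoritaEquivalent (TwoSidedIdeal.span (Set.range fun v => ψ (vert R F v))) (LPA R F) := by
  set I := TwoSidedIdeal.span (Set.range fun v => ψ (vert R F v)) with hI
  have hvert : ∀ v, ψ (vert R F v) ∈ I := fun v => TwoSidedIdeal.subset_span ⟨v, rfl⟩
  have hmem : ∀ b, ψ b ∈ I := by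
    intro b
    obtain ⟨s, hs⟩ := exists_local_unit b
    rw [← (hs s subset_rfl).1, map_mul, vertSum, map_sum]
    exact I.mul_mem_right _ _ (sum_mem fun v _ => hvert v)
  have hcorner : ∀ v a v', ψ (vert R F v) * a * ψ (vert R F v') ∈ NonUnitalAlgHom.range ψ := by
    intro v a v'
    have ha := mem_iSup_component a
    induction ha using Submodule.iSup_induction' with
    | zero => rw [mul_zero, zero_mul]; exact zero_mem _
    | add x y _ _ hx hy => rw [mul_add, add_mul]; exact add_mem hx hy
    | mem k x hx =>
      induction hx using Submodule.span_induction with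
      | mem x hx =>
        obtain ⟨a, b, c, α, β, -, rfl⟩ := hx
        rw [← mul_assoc, mul_assoc]
        exact mul_mem (hl v α) (hr v' β)
      | zero => rw [mul_zero, zero_mul]; exact zero_mem _
      | add x y _ _ hx hy => rw [mul_add, add_mul]; exact add_mem hx hy
      | smul r x _ hx => rw [mul_smul_comm, smul_mul_assoc]; exact SMulMemClass.smul_mem r hx
  let φ : LPA R F →ₙ+* I :=
    { toFun := fun b => ⟨ψ b, hmem b⟩
      map_zero' := Subtype.ext (map_zero ψ)
      map_add' := fun x y => Subtype.ext (map_add ψ x y)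
      map_mul' := fun x y => Subtype.ext (map_mul ψ x y) }
  have hφ : IsFullCorner φ := by
    refine ⟨fun x y h => hψ (congrArg Subtype.val h), fun b b' => ?_, fun b a b' => ?_, fun a => ?_⟩
    · classical
      obtain ⟨u, hu⟩ := exists_common_local_unit {b, b'}
      exact ⟨u, (hu b (by simp)).1, (hu b' (by simp)).1⟩
    · suffices h : ψ b * a.1 * ψ b' ∈ NonUnitalAlgHom.range ψ by
        obtain ⟨c, hc⟩ := h
        exact ⟨c, Subtype.ext hc⟩
      obtain ⟨s, hs⟩ := exists_local_unit b
      obtain ⟨s', hs'⟩ := exists_local_unit b'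
      have h1 := (hs s subset_rfl).2
      have h2 := (hs' s' subset_rfl).1
      have : ψ b * a.1 * ψ b' =
          ψ b * (∑ v ∈ s, ∑ v' ∈ s', ψ (vert R F v) * a.1 * ψ (vert R F v')) * ψ b' := by
        conv_lhs => rw [← h1, ← h2]
        simp only [vertSum, map_mul, map_sum, ← Finset.mul_sum, ← Finset.sum_mul, mul_assoc]
      rw [this]
      exact mul_mem (mul_mem ⟨b, rfl⟩ (sum_mem fun v _ => sum_mem fun v' _ => hcorner v _ v'))
        ⟨b', rfl⟩
    · let S : AddSubgroup I := AddSubgroup.closure {x | ∃ a₁ b a₂, x = a₁ * φ b * a₂}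
      suffices h : ∀ x ∈ I, ∃ y ∈ S, (y : LPA R G) = x by
        obtain ⟨y, hy, h⟩ := h a.1 a.2
        rwa [← Subtype.ext h]
      intro x hx
      rw [hI] at hx
      induction hx using TwoSidedIdeal.span_induction with
      | mem x h =>
        obtain ⟨v, rfl⟩ := h
        refine ⟨φ (vert R F v) * φ (vert R F v) * φ (vert R F v),
          AddSubgroup.subset_closure ⟨_, _, _, rfl⟩, ?_⟩
        rw [← map_mul, ← map_mul, vert_mul_self, vert_mul_self]
        rfl
      | zero => exact ⟨0, zero_mem _, rfl⟩
      | add x y _ _ hx hy =>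
        obtain ⟨x, hx, rfl⟩ := hx
        obtain ⟨y, hy, rfl⟩ := hy
        exact ⟨x + y, add_mem hx hy, rfl⟩
      | neg x _ hx =>
        obtain ⟨x, hx, rfl⟩ := hx
        exact ⟨-x, neg_mem hx, rfl⟩
      | left_absorb c x hxI hx =>
        clear hxI
        obtain ⟨x, hx, rfl⟩ := hx
        induction hx using AddSubgroup.closure_induction with
        | mem x hx =>
          obtain ⟨a₁, b, a₂, rfl⟩ := hx
          refine ⟨⟨c * a₁.1, I.mul_mem_left _ _ a₁.2⟩ * φ b * a₂,
            AddSubgroup.subset_closure ⟨_, _, _, rfl⟩, ?_⟩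
          change c * a₁.1 * ψ b * a₂.1 = c * (a₁.1 * ψ b * a₂.1)
          simp only [mul_assoc]
        | zero => exact ⟨0, zero_mem _, (mul_zero c).symm⟩
        | add x y _ _ hx hy =>
          obtain ⟨x', hx', hx⟩ := hx
          obtain ⟨y', hy', hy⟩ := hy
          refine ⟨x' + y', add_mem hx' hy', ?_⟩
          change x'.1 + y'.1 = c * (x.1 + y.1)
          rw [hx, hy, mul_add]
        | neg x _ hx =>
          obtain ⟨x', hx', hx⟩ := hx
          refine ⟨-x', neg_mem hx', ?_⟩
          change -x'.1 = c * -x.1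
          rw [hx, mul_neg]
      | right_absorb c x hxI hx =>
        clear hxI
        obtain ⟨x, hx, rfl⟩ := hx
        induction hx using AddSubgroup.closure_induction with
        | mem x hx =>
          obtain ⟨a₁, b, a₂, rfl⟩ := hx
          refine ⟨a₁ * φ b * ⟨a₂.1 * c, I.mul_mem_right _ _ a₂.2⟩,
            AddSubgroup.subset_closure ⟨_, _, _, rfl⟩, ?_⟩
          change a₁.1 * ψ b * (a₂.1 * c) = a₁.1 * ψ b * a₂.1 * c
          simp only [mul_assoc]
        | zero => exact ⟨0, zero_mem _, (zero_mul c).symm⟩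
        | add x y _ _ hx hy =>
          obtain ⟨x', hx', hx⟩ := hx
          obtain ⟨y', hy', hy⟩ := hy
          refine ⟨x' + y', add_mem hx' hy', ?_⟩
          change x'.1 + y'.1 = (x.1 + y.1) * c
          rw [hx, hy, add_mul]
        | neg x _ hx =>
          obtain ⟨x', hx', hx⟩ := hx
          refine ⟨-x', neg_mem hx', ?_⟩
          change -x'.1 = -x.1 * c
          rw [hx, neg_mul]
  exact hφ.moritaEquivalent

/-- A realization of a graph `F` in the Leavitt path algebra of a graph `G`: vertices `x` of `F` are
sent to homogeneous idempotents `q x ≤ π x` and edges of `F` to edges of `G`, such that each edge of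
`G` that is not killed by `q x` comes from an edge of `F` with source `x`. -/
structure IsCornerFamily (F : DirGraph V' E') (G : DirGraph V E) (q : V' → LPA R G)
    (π : V' → V) (j : E' → E) : Prop where
  vert_injective : π.Injective
  edge_injective : j.Injective
  idem : ∀ x, q x * q x = q x
  vert_mul : ∀ x, vert R G (π x) * q x = q x
  mul_vert : ∀ x, q x * vert R G (π x) = q x
  rng : ∀ e, q (F.rng e) = vert R G (G.rng (j e))
  src_mul_edge : ∀ e, q (F.src e) * edge R G (j e) = edge R G (j e)
  ghost_mul_src : ∀ e, ghost R G (j e) * q (F.src e) = ghost R G (j e)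
  edge_or : ∀ x e, (∃ e', F.src e' = x ∧ j e' = e) ∨
    (q x * edge R G e = 0 ∧ ghost R G e * q x = 0)
  emit : ∀ x, (F.emit x).Finite → (F.emit x).Nonempty →
    q x = vert R G (π x) ∧ G.emit (π x) = j '' F.emit x
  degree : ∀ x, q x ∈ component R G 0
  smul_ne_zero : ∀ (r : R) x, r ≠ 0 → r • q x ≠ 0

variable {q : V' → LPA R G} {π : V' → V} {j : E' → E}

theorem IsCornerFamily.isFamily (h : IsCornerFamily F G q π j) :
    IsFamily F q (fun e => edge R G (j e)) (fun e => ghost R G (j e)) where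
  idem := h.idem
  orth x y hxy := by
    rw [← h.mul_vert x, ← h.vert_mul y, mul_assoc, ← mul_assoc (vert R G _),
      vert_mul_of_ne (h.vert_injective.ne hxy), zero_mul, mul_zero]
  src_edge := h.src_mul_edge
  edge_rng e := by rw [h.rng, edge_mul_rng]
  rng_ghost e := by rw [h.rng, rng_mul_ghost]
  ghost_src := h.ghost_mul_src
  ghost_edge_same e := by rw [h.rng, ghost_mul_edge_self]
  ghost_edge_ne e f hef := ghost_mul_edge_of_ne (h.edge_injective.ne hef)
  finite_emitter x hfin hne := by
    obtain ⟨hq, hemit⟩ := h.emit x hfin hne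
    have hfin' : (G.emit (π x)).Finite := hemit ▸ hfin.image j
    have : hfin'.toFinset = hfin.toFinset.map ⟨j, h.edge_injective⟩ := by
      ext e
      simp [hemit]
    rw [hq, (lpa_isFamily R G).finite_emitter _ hfin' (hemit ▸ hne.image j), this, Finset.sum_map]
    rfl

theorem IsCornerFamily.moritaEquivalent (h : IsCornerFamily F G q π j) :
    RingsMoritaEquivalent (TwoSidedIdeal.span (Set.range q)) (LPA R F) := by
  obtain ⟨ψ, ⟨hv, he, hg⟩, -⟩ := exists_lift R F h.isFamily
  have hinj : Function.Injective ψ := by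
    refine injective_of_graded ψ (map_mem_component ψ ?_ ?_ ?_) ?_
    · intro x; rw [hv]; exact h.degree x
    · intro e; rw [he]; exact edge_mem_component _
    · intro e; rw [hg]; exact ghost_mem_component _
    · intro r x hr; rw [hv]; exact h.smul_ne_zero r x hr
  have hq : q = fun x => ψ (vert R F x) := funext fun x => (hv x).symm
  rw [hq]
  refine moritaEquivalent_of_range ψ hinj ?_ ?_
  · intro x a b α
    induction α generalizing x with
    | nil v =>
      by_cases hx : π x = v
      · rw [pathElem, hv, ← hx, h.mul_vert]
        exact ⟨_, hv x⟩
      · rw [pathElem, hv, ← h.mul_vert, mul_assoc, vert_mul_of_ne hx, mul_zero]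
        exact zero_mem _
    | cons e _ α ih =>
      rw [pathElem, ← mul_assoc, hv]
      obtain ⟨e', rfl, rfl⟩ | h0 := h.edge_or x e
      · rw [h.src_mul_edge, ← edge_mul_rng, ← h.rng, ← hv, ← he, mul_assoc]
        exact mul_mem ⟨_, rfl⟩ (ih _)
      · rw [h0.1, zero_mul]
        exact zero_mem _
  · intro x a b α
    induction α generalizing x with
    | nil v =>
      by_cases hx : v = π x
      · rw [pathGhost, hv, hx, h.vert_mul]
        exact ⟨_, hv x⟩
      · rw [pathGhost, hv, ← h.vert_mul, ← mul_assoc, vert_mul_of_ne hx, zero_mul]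
        exact zero_mem _
    | cons e _ α ih =>
      rw [pathGhost, mul_assoc, hv]
      obtain ⟨e', rfl, rfl⟩ | h0 := h.edge_or x e
      · rw [h.ghost_mul_src, ← rng_mul_ghost, ← h.rng, ← hv, ← hg, ← mul_assoc]
        exact mul_mem (ih _) ⟨_, rfl⟩
      · rw [h0.2, mul_zero]
        exact zero_mem _

end corner

/-! ### The ideals of hereditary sets and admissible pairs -/

variable {V : Type u} {E : Type v} (R : Type w) [CommRing R]

theorem isCornerFamily_restrict [Countable E] (G : DirGraph V E) (X : Set V) (hX : G.IsHereditary X) :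
    IsCornerFamily (G.restrict X hX) G (fun x => vert R G x.1) Subtype.val Subtype.val where
  vert_injective := Subtype.val_injective
  edge_injective := Subtype.val_injective
  idem x := vert_mul_self _
  vert_mul x := vert_mul_self _
  mul_vert x := vert_mul_self _
  rng _ := rfl
  src_mul_edge e := src_mul_edge e.1
  ghost_mul_src e := ghost_mul_src e.1
  edge_or x e := by
    by_cases h : G.src e = x.1
    · exact .inl ⟨⟨e, h ▸ x.2⟩, Subtype.ext h, rfl⟩
    · exact .inr ⟨vert_mul_edge_of_ne (Ne.symm h), ghost_mul_vert_of_ne h⟩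
  emit x _ _ := by
    refine ⟨rfl, Set.ext fun e => ⟨fun h => ?_, ?_⟩⟩
    · exact ⟨⟨e, (show G.src e = x.1 from h) ▸ x.2⟩, Subtype.ext h, rfl⟩
    · rintro ⟨e, h, rfl⟩
      exact congrArg Subtype.val h
  degree x := vert_mem_component _
  smul_ne_zero r x hr := smul_vert_ne_zero hr _

theorem moritaEquivalent_vertexIdeal [Countable E] (G : DirGraph V E) (X : Set V) (hX : G.IsHereditary X) :
    RingsMoritaEquivalent (vertexIdeal R G X) (LPA R (G.restrict X hX)) := by
  have h := (isCornerFamily_restrict R G X hX).moritaEquivalent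
  have hs : (Set.range fun x : {v : V // v ∈ X} => vert R G x.1) = {x | ∃ v ∈ X, x = vert R G v} :=
    Set.ext fun x => ⟨fun ⟨v, hv⟩ => ⟨v.1, v.2, hv.symm⟩, fun ⟨v, hv, hx⟩ => ⟨⟨v, hv⟩, hx.symm⟩⟩
  rwa [hs] at h

variable {G : DirGraph V E} (p : G.AdmissiblePair)

open scoped Classical in
/-- The idempotents of `I(H,S)` that stand for the vertices of the graph `E_{(H,S)}`: the vertices
in `H` and the elements `v^H` with `v ∈ S`. -/
noncomputable def pairVert (x : {v : V // v ∈ p.H ∪ p.S}) : LPA R G :=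
  if h : x.1 ∈ p.S then breakElem R (p.subset_breaking h) else vert R G x.1

theorem pairVert_of_mem_left {x : {v : V // v ∈ p.H ∪ p.S}} (h : x.1 ∈ p.H) :
    pairVert R p x = vert R G x.1 :=
  dif_neg fun h' => (p.subset_breaking h').1 h

theorem pairVert_of_mem_right {x : {v : V // v ∈ p.H ∪ p.S}} (h : x.1 ∈ p.S) :
    pairVert R p x = breakElem R (p.subset_breaking h) :=
  dif_pos h

/-- A breaking vertex emits infinitely many edges into `H`, because it emits infinitely many edges
and only finitely many of them have their range outside `H`. -/
theorem infinite_emit_of_mem_breaking {H : Set V} {v : V} (hv : v ∈ G.breaking H) :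
    {e | G.src e = v ∧ G.rng e ∈ H}.Infinite := by
  refine fun hfin => hv.2.1 ((hfin.union hv.2.2.2).subset fun e he => ?_)
  by_cases h : G.rng e ∈ H
  · exact .inl ⟨he, h⟩
  · exact .inr ⟨he, h⟩

theorem isCornerFamily_pairGraph [Countable E] :
    IsCornerFamily (G.pairGraph p) G (pairVert R p) Subtype.val Subtype.val where
  vert_injective := Subtype.val_injective
  edge_injective := Subtype.val_injective
  idem x := by
    rcases x.2 with h | h
    · rw [pairVert_of_mem_left R p h, vert_mul_self]
    · rw [pairVert_of_mem_right R p h, breakElem_mul_self]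
  vert_mul x := by
    rcases x.2 with h | h
    · rw [pairVert_of_mem_left R p h, vert_mul_self]
    · rw [pairVert_of_mem_right R p h, vert_mul_breakElem]
  mul_vert x := by
    rcases x.2 with h | h
    · rw [pairVert_of_mem_left R p h, vert_mul_self]
    · rw [pairVert_of_mem_right R p h, breakElem_mul_vert]
  rng e := pairVert_of_mem_left R p (e.2.elim (p.hereditary e.1) fun h => h.2)
  src_mul_edge e := by
    rcases e.2 with h | h
    · rw [pairVert_of_mem_left R p (x := (G.pairGraph p).src e) h]
      exact src_mul_edge e.1
    · rw [pairVert_of_mem_right R p (x := (G.pairGraph p).src e) h.1]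
      exact breakElem_mul_edge _ rfl h.2
  ghost_mul_src e := by
    rcases e.2 with h | h
    · rw [pairVert_of_mem_left R p (x := (G.pairGraph p).src e) h]
      exact ghost_mul_src e.1
    · rw [pairVert_of_mem_right R p (x := (G.pairGraph p).src e) h.1]
      exact ghost_mul_breakElem _ rfl h.2
  edge_or x e := by
    rcases x.2 with hx | hx
    · rw [pairVert_of_mem_left R p hx]
      by_cases h : G.src e = x.1
      · exact .inl ⟨⟨e, .inl (h ▸ hx)⟩, Subtype.ext h, rfl⟩
      · exact .inr ⟨vert_mul_edge_of_ne (Ne.symm h), ghost_mul_vert_of_ne h⟩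
    · rw [pairVert_of_mem_right R p hx]
      by_cases h : G.src e = x.1 ∧ G.rng e ∈ p.H
      · exact .inl ⟨⟨e, .inr ⟨h.1 ▸ hx, h.2⟩⟩, Subtype.ext h.1, rfl⟩
      · rw [not_and] at h
        exact .inr ⟨breakElem_mul_edge_eq_zero _ h, ghost_mul_breakElem_eq_zero _ h⟩
  emit x hfin _ := by
    rcases x.2 with hx | hx
    · refine ⟨pairVert_of_mem_left R p hx, Set.ext fun e => ⟨fun h => ?_, ?_⟩⟩
      · exact ⟨⟨e, .inl ((show G.src e = x.1 from h) ▸ hx)⟩, Subtype.ext h, rfl⟩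
      · rintro ⟨e, h, rfl⟩
        exact congrArg Subtype.val h
    -- The vertices in `S` emit infinitely many edges in the graph of the pair.
    · refine absurd ((hfin.image Subtype.val).subset ?_)
        (infinite_emit_of_mem_breaking (p.subset_breaking hx))
      exact fun e he => ⟨⟨e, .inr ⟨he.1 ▸ hx, he.2⟩⟩, Subtype.ext he.1, rfl⟩
  degree x := by
    rcases x.2 with h | h
    · rw [pairVert_of_mem_left R p h]
      exact vert_mem_component _
    · rw [pairVert_of_mem_right R p h]
      exact breakElem_mem_component _
  smul_ne_zero r x hr h0 := by
    rcases x.2 with h | h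
    · rw [pairVert_of_mem_left R p h] at h0
      exact smul_vert_ne_zero hr _ h0
    -- For an edge `e` from `v` into `H`, the element `e* v^H e` is the vertex `r(e)`.
    · obtain ⟨e, he, hr'⟩ := (infinite_emit_of_mem_breaking (p.subset_breaking h)).nonempty
      rw [pairVert_of_mem_right R p h] at h0
      have := congrArg (fun y => ghost R G e * y * edge R G e) h0
      simp only [mul_smul_comm, smul_mul_assoc, ghost_mul_breakElem _ he hr',
        ghost_mul_edge_self, mul_zero, zero_mul] at this
      exact smul_vert_ne_zero hr _ this

theorem moritaEquivalent_pairIdeal [Countable E] :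
    RingsMoritaEquivalent (pairIdeal R p) (LPA R (G.pairGraph p)) := by
  have h := (isCornerFamily_pairGraph R p).moritaEquivalent
  have hs : Set.range (pairVert R p) = {x | ∃ v ∈ p.H, x = vert R G v} ∪
      {x | ∃ (v : V) (hv : v ∈ p.S), x = breakElem R (p.subset_breaking hv)} := by
    ext x
    constructor
    · rintro ⟨v, rfl⟩
      rcases v.2 with hv | hv
      · exact .inl ⟨v.1, hv, pairVert_of_mem_left R p hv⟩
      · exact .inr ⟨v.1, hv, pairVert_of_mem_right R p hv⟩
    · rintro (⟨v, hv, rfl⟩ | ⟨v, hv, rfl⟩)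
      · exact ⟨⟨v, .inl hv⟩, pairVert_of_mem_left R p hv⟩
      · exact ⟨⟨v, .inr hv⟩, pairVert_of_mem_right R p hv⟩
  rwa [hs] at h

end Leavitt

theorem theorem3p10 {V : Type u} {E : Type v} [Countable V] [Countable E] (G : DirGraph V E)
    (R : Type w) [CommRing R] :
    (∀ (X : Set V) (hX : G.IsHereditary X),
      RingsMoritaEquivalent (Leavitt.vertexIdeal R G X) (Leavitt.LPA R (G.restrict X hX))) ∧
    (∀ p : G.AdmissiblePair,
      RingsMoritaEquivalent (Leavitt.pairIdeal R p) (Leavitt.LPA R (G.pairGraph p))) ∧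
    (∀ p : G.AdmissiblePair,
      ∃ Φ : (Leavitt.pairIdeal R p).ringCon.Quotient ≃+* Leavitt.LPA R (G.quotGraph p),
        (∀ (r : R) (x : Leavitt.LPA R G),
          Φ ((r • x : Leavitt.LPA R G) : (Leavitt.pairIdeal R p).ringCon.Quotient) =
            r • Φ (x : (Leavitt.pairIdeal R p).ringCon.Quotient)) ∧
        (∀ v : V, Φ (Leavitt.vert R G v : (Leavitt.pairIdeal R p).ringCon.Quotient) =
          Leavitt.quotVert R p v) ∧
        (∀ e : E, Φ (Leavitt.edge R G e : (Leavitt.pairIdeal R p).ringCon.Quotient) =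
          Leavitt.quotEdge R p e) ∧
        (∀ e : E, Φ (Leavitt.ghost R G e : (Leavitt.pairIdeal R p).ringCon.Quotient) =
          Leavitt.quotGhost R p e)) ∧
    (Nontrivial R →
      Set.BijOn (fun p : G.AdmissiblePair => Leavitt.pairIdeal R p) Set.univ
        {I : TwoSidedIdeal (Leavitt.LPA R G) |
          Leavitt.IsGradedIdeal I ∧ Leavitt.IsBasicIdeal I}) := by
  refine ⟨Leavitt.moritaEquivalent_vertexIdeal R G, fun p => Leavitt.moritaEquivalent_pairIdeal R p,
    fun p => ?_, fun _ => ⟨fun p _ => ?_, (Leavitt.pairIdeal_injective G).injOn, ?_⟩⟩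
  · obtain ⟨Φ, hΦ⟩ := Leavitt.exists_quotEquiv R p
    refine ⟨Φ, fun r x => ?_, fun v => ?_, fun e => ?_, fun e => ?_⟩
    · rw [hΦ, hΦ, map_smul]
    · rw [hΦ, Leavitt.toQuot_vert]
    · rw [hΦ, Leavitt.toQuot_edge]
    · rw [hΦ, Leavitt.toQuot_ghost]
  · exact ⟨Leavitt.isGradedIdeal_pairIdeal R p, Leavitt.isBasicIdeal_pairIdeal R p⟩
  · rintro I ⟨hI, hb⟩
    exact ⟨Leavitt.admissiblePairOf I, Set.mem_univ _, Leavitt.pairIdeal_admissiblePairOf hI hb⟩
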